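/- \textbf{Setting.} A finite $n$-player normal-form game $\mathcal G$ ($n\ge 1$) has nonempty finite action sets $\mathcal A_i$ and utilities $u_i:\prod_j\mathcal A_j\to[-1,1]$, extended multilinearly to mixed profiles $x\in\mathcal X=\prod_i\Delta(\mathcal A_i)$. Put $\mathrm{SW}(x)=\sum_i u_i(x)$ and $\mathrm{OPT}_{\mathcal G}=\max_{x\in\mathcal X}\mathrm{SW}(x)$. The game is $(\lambda,\mu)$-smooth, where $\lambda>0$ and $\mu>-1$, if there is $x^\star\in\mathcal X$ with $\mathrm{SW}(x^\star)=\mathrm{OPT}_{\mathcal G}$ and $\sum_i u_i(x_i^\star,x_{-i})\ge\lambda\,\mathrm{OPT}_{\mathcal G}-\mu\,\mathrm{SW}(x)$ for all $x\in\mathcal X$. A profile $x\in\mathcal X$ is an $\epsilon$-Nash equilibrium if $u_i(x_i',x_{-i})-u_i(x)\le\epsilon$ for all $i$ and all $x_i'\in\Delta(\mathcal A_i)$. Let $\vec u_i(x_{-i})=(u_i(a,x_{-i}))_{a\in\mathcal A_i}$. Optimistic gradient descent ($\mathtt{OGD}$) with learning rate $\eta$ and initialization $\hat x^{(1)}=x^{(0)}\in\mathcal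 X$ is $$x_i^{(t)}=\mathcal P_{\Delta(\mathcal A_i)}\bigl(\hat x_i^{(t)}+\eta\,\vec u_i(x_{-i}^{(t-1)})\bigr),\qquad \hat x_i^{(t+1)}=\mathcal P_{\Delta(\mathcal A_i)}\bigl(\hat x_i^{(t)}+\eta\,\vec u_i(x_{-i}^{(t)})\bigr),\qquad t\ge1,$$ where $\mathcal P$ is Euclidean projection; we take $\eta=1/(4L)$ with $L=n\max_i|\mathcal A_i|$. Let $\mathcal C$ be a class of games, each given by a bit string; $|\mathcal G|$ is the length of the string that describes $\mathcal G$. Polynomial time is meant in the bit model, and computed profiles are rational. Assume that $\sum_i|\mathcal A_i|$ is polynomially bounded in $|\mathcal G|$ and that the numbers $|\mathcal A_i|$ are computable in polynomial time from the description, and that $\mathcal C$ has the polynomial expectation property: $u_i(x)$ can be computed in polynomial time from $\mathcal G\in\mathcal C$, $i$ and a rational $x\in\mathcal X$. Assume that there is a number $\rho$ such that every $\mathcal G\in\mathcal C$ is $(\lambda_{\mathcal G},\mu_{\mathcal G})$-smooth for some $\lambda_{\mathcal G},\mu_{\mathcal G}$ with $\lambda_{\mathcal G}/(1+\mu_{\mathcal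 G})=\rho$ and $\mu_{\mathcal G}$ bounded above by a polynomial in $|\mathcal G|$. \textbf{Uniform hardness.} Assume that beating the welfare $\rho\cdot\mathrm{OPT}$ is hard throughout $\mathcal C$: for every infinite subfamily $\mathcal S\subseteq\mathcal C$ and every positive polynomial $p$, computing from $\mathcal G\in\mathcal S$ a profile $x\in\mathcal X$ with $\mathrm{SW}(x)\ge\rho\cdot\mathrm{OPT}_{\mathcal G}+1/p(|\mathcal G|)$ is NP-hard, in the sense that a polynomial-time algorithm that does so for every $\mathcal G\in\mathcal S$ would imply $\mathrm P=\mathrm{NP}$. \textbf{Theorem.} Suppose $\mathrm P\neq\mathrm{NP}$. Then for every positive polynomial $p$ there is a polynomial-time algorithm that computes a $1/p(|\mathcal G|)$-Nash equilibrium of every game $\mathcal G\in\mathcal C$, and this algorithm is $\mathtt{OGD}$ except on a finite set of games. Precisely, let a rational initialization $\hat x^{(1)}\in\mathcal X$ be given that is computable in polynomial time from $\mathcal G\in\mathcal C$. Then there are a polynomial-time algorithm $A$, a polynomial $T$ and a finite set $E$ such that for every $\mathcal G\in\mathcal C$ the output $y$ of $A$ on $\mathcal G$ is a $1/p(|\mathcal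 G|)$-Nash equilibrium of $\mathcal G$ and, if $\mathcal G\notin E$, there is $t$ with $1\le t\le T(|\mathcal G|)$ such that the $\mathtt{OGD}$ iterate $x^{(t)}$ is a $1/p(|\mathcal G|)$-Nash equilibrium and $|y_i(a)-x_i^{(t)}(a)|\le 2^{-p(|\mathcal G|)}$ for all $i$ and $a\in\mathcal A_i$. -/

import Mathlib

namespace SmoothGames

noncomputable section

/-! ### A programming language with bit cost, polynomial time, P and NP

Programs act on finite binary trees with integer leaves.  Every executed node of a program is
charged the bit size of its input plus the bit size of its output, so that running times agree with
those of multi-tape Turing machines up to a polynomial. -/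

/-- Data: binary trees whose leaves carry integers. -/
inductive Val : Type
  | int (z : ℤ) : Val
  | pair (a b : Val) : Val

/-- Bit size. -/
def Val.size : Val → ℕ
  | .int z => 1 + Nat.size z.natAbs
  | .pair a b => 1 + a.size + b.size

/-- Lists as right-nested pairs that end in the leaf `0`. -/
def Val.list : List Val → Val
  | [] => .int 0
  | a :: l => .pair a (Val.list l)

/-- A bit string as a datum. -/
def Val.bits (w : List Bool) : Val :=
  Val.list (w.map fun b => .int (if b then 1 else 0))

def Val.left : Val → Val
  | .int _ => .int 0
  | .pair a _ => a

def Val.right : Val → Val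
  | .int _ => .int 0
  | .pair _ b => b

/-- Primitive operations. -/
inductive PrimOp : Type
  | add | sub | mul | div | lt | eq | isPair

open Classical in
/-- The arguments of a binary operation are the components of a pair; `isPair` tells pairs from
leaves. `lt`, `eq`, `isPair` return `1` for yes and `0` for no; `div` rounds down (and `z / 0 = 0`);
ill-typed arguments give `0`. -/
def PrimOp.apply : PrimOp → Val → Val
  | .add, .pair (.int x) (.int y) => .int (x + y)
  | .sub, .pair (.int x) (.int y) => .int (x - y)
  | .mul, .pair (.int x) (.int y) => .int (x * y)
  | .div, .pair (.int x) (.int y) => .int (Int.fdiv x y)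
  | .lt, .pair (.int x) (.int y) => .int (if x < y then 1 else 0)
  | .eq, .pair a b => .int (if a = b then 1 else 0)
  | .isPair, .pair _ _ => .int 1
  | _, _ => .int 0

/-- Programs. `seq p q` is "first `p`, then `q`"; `fork p q` runs both on the same input and
returns the pair of the results; `ite c p q` runs `p` if `c` returns something other than `0`, and
`q` otherwise; `while_ c p` repeats `p` as long as `c` returns something other than `0`. -/
inductive Prog : Type
  | skip : Prog
  | lit (v : Val) : Prog
  | left : Prog
  | right : Prog
  | prim (o : PrimOp) : Prog
  | seq (p q : Prog) : Prog
  | fork (p q : Prog) : Prog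
  | ite (c p q : Prog) : Prog
  | while_ (c p : Prog) : Prog

/-- `Run p x y t`: the program `p` halts on input `x` with output `y` at cost `t`. -/
inductive Run : Prog → Val → Val → ℕ → Prop
  | skip (x : Val) : Run .skip x x (x.size + x.size)
  | lit (v x : Val) : Run (.lit v) x v (x.size + v.size)
  | left (x : Val) : Run .left x x.left (x.size + x.left.size)
  | right (x : Val) : Run .right x x.right (x.size + x.right.size)
  | prim (o : PrimOp) (x : Val) : Run (.prim o) x (o.apply x) (x.size + (o.apply x).size)
  | seq {p q : Prog} {x y z : Val} {s t : ℕ} (hp : Run p x y s) (hq : Run q y z t) :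
      Run (.seq p q) x z (s + t + x.size + z.size)
  | fork {p q : Prog} {x y z : Val} {s t : ℕ} (hp : Run p x y s) (hq : Run q x z t) :
      Run (.fork p q) x (.pair y z) (s + t + x.size + (Val.pair y z).size)
  | ite_true {c p q : Prog} {x b y : Val} {s t : ℕ} (hc : Run c x b s) (hb : b ≠ .int 0)
      (hp : Run p x y t) : Run (.ite c p q) x y (s + t + x.size + y.size)
  | ite_false {c p q : Prog} {x y : Val} {s t : ℕ} (hc : Run c x (.int 0) s)
      (hq : Run q x y t) : Run (.ite c p q) x y (s + t + x.size + y.size)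
  | while_stop {c p : Prog} {x : Val} {s : ℕ} (hc : Run c x (.int 0) s) :
      Run (.while_ c p) x x (s + x.size + x.size)
  | while_step {c p : Prog} {x b y z : Val} {s t r : ℕ} (hc : Run c x b s) (hb : b ≠ .int 0)
      (hp : Run p x y t) (hw : Run (.while_ c p) y z r) :
      Run (.while_ c p) x z (s + t + r + x.size + z.size)

/-- `p` halts on `x` at cost at most `T`, and its output satisfies `R`. -/
def HaltsWithin (p : Prog) (x : Val) (T : ℕ) (R : Val → Prop) : Prop :=
  ∃ (y : Val) (t : ℕ), Run p x y t ∧ t ≤ T ∧ R y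

/-- The class P of languages of bit strings. -/
def ClassP : Set (Set (List Bool)) :=
  {L | ∃ (A : Prog) (q : Polynomial ℕ), ∀ w : List Bool,
    HaltsWithin A (.bits w) (q.eval w.length) fun y => y ≠ .int 0 ↔ w ∈ L}

/-- The class NP: membership is certified by certificates of polynomial length that are verified
in polynomial time. -/
def ClassNP : Set (Set (List Bool)) :=
  {L | ∃ (V : Prog) (q r : Polynomial ℕ) (K : Set (List Bool × List Bool)),
    (∀ w c : List Bool,
      HaltsWithin V (.pair (.bits w) (.bits c)) (q.eval (w.length + c.length)) fun y =>
        y ≠ .int 0 ↔ (w, c) ∈ K) ∧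
    ∀ w : List Bool, w ∈ L ↔ ∃ c : List Bool, c.length ≤ r.eval w.length ∧ (w, c) ∈ K}

/-- The search problem "given an instance `w ∈ S`, find a datum `v` with `R w v`" is solvable in
polynomial time. -/
def SolvableInPolyTime (S : Set (List Bool)) (R : List Bool → Val → Prop) : Prop :=
  ∃ (A : Prog) (q : Polynomial ℕ), ∀ w ∈ S, HaltsWithin A (.bits w) (q.eval w.length) (R w)

/-- NP-hardness of a search problem: a polynomial-time algorithm for it would give P = NP.
(Every polynomial-time reduction from an NP-complete problem has this consequence, so that this is
the weakest notion of hardness.) -/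
def SearchNPHard (S : Set (List Bool)) (R : List Bool → Val → Prop) : Prop :=
  SolvableInPolyTime S R → ClassP = ClassNP

/-! ### Normal-form games -/

/-- A finite normal-form game with players `Fin n`, action sets `Fin (m i)` and utilities in
`[-1, 1]`. -/
structure Game where
  n : ℕ
  n_pos : 0 < n
  m : Fin n → ℕ
  m_pos : ∀ i, 0 < m i
  u : Fin n → (∀ j, Fin (m j)) → ℝ
  u_mem : ∀ i s, u i s ∈ Set.Icc (-1 : ℝ) 1

namespace Game

variable (G : Game)

/-- Tuples of vectors, one vector in `ℝ^(m i)` for each player. -/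
abbrev Vec : Type := ∀ i : Fin G.n, Fin (G.m i) → ℝ

/-- Joint (mixed) strategy profiles. -/
def Mixed : Set G.Vec := {x | ∀ i, x i ∈ stdSimplex ℝ (Fin (G.m i))}

/-- The (multilinear) expected utility of player `i`. -/
def util (i : Fin G.n) (x : G.Vec) : ℝ :=
  ∑ s : (∀ j, Fin (G.m j)), (∏ j, x j (s j)) * G.u i s

/-- The utility vector `u_i(x_{-i})`: its coordinate at `a` is the utility of player `i` when `i`
plays `a` against `x_{-i}`. -/
def utilVec (i : Fin G.n) (x : G.Vec) : Fin (G.m i) → ℝ :=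
  fun a => G.util i (Function.update x i (Pi.single a 1))

/-- Social welfare. -/
def sw (x : G.Vec) : ℝ := ∑ i, G.util i x

/-- The optimal social welfare. -/
def opt : ℝ := sSup (G.sw '' G.Mixed)

/-- `(lam, mu)`-smoothness. -/
def Smooth (lam mu : ℝ) : Prop :=
  0 < lam ∧ -1 < mu ∧ ∃ xs ∈ G.Mixed, G.sw xs = G.opt ∧
    ∀ x ∈ G.Mixed, lam * G.opt - mu * G.sw x ≤ ∑ i, G.util i (Function.update x i (xs i))

/-- `ε`-Nash equilibrium. -/
def IsNash (ε : ℝ) (x : G.Vec) : Prop :=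
  x ∈ G.Mixed ∧ ∀ (i : Fin G.n), ∀ z ∈ stdSimplex ℝ (Fin (G.m i)),
    G.util i (Function.update x i z) - G.util i x ≤ ε

end Game

/-! ### Optimistic gradient descent -/

/-- `y` is the Euclidean projection of `v` to the probability simplex. -/
def IsSimplexProj {k : ℕ} (v y : Fin k → ℝ) : Prop :=
  y ∈ stdSimplex ℝ (Fin k) ∧
    ∀ z ∈ stdSimplex ℝ (Fin k), ∑ a, (v a - y a) ^ 2 ≤ ∑ a, (v a - z a) ^ 2

theorem exists_isSimplexProj {k : ℕ} (hk : 0 < k) (v : Fin k → ℝ) :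
    ∃ y, IsSimplexProj v y := by
  have hne : (stdSimplex ℝ (Fin k)).Nonempty := ⟨_, single_mem_stdSimplex ℝ (⟨0, hk⟩ : Fin k)⟩
  have hc : ContinuousOn (fun z : Fin k → ℝ => ∑ a, (v a - z a) ^ 2) (stdSimplex ℝ (Fin k)) := by
    fun_prop
  obtain ⟨y, hy, hmin⟩ := (isCompact_stdSimplex ℝ (Fin k)).exists_isMinOn hne hc
  exact ⟨y, hy, fun z hz => hmin hz⟩

/-- Euclidean projection to the probability simplex. -/
def simplexProj {k : ℕ} (hk : 0 < k) (v : Fin k → ℝ) : Fin k → ℝ :=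
  Classical.choose (exists_isSimplexProj hk v)

namespace Game

variable (G : Game)

/-- One projected ascent step from `xh` along `η` times the utility vectors at `x`. -/
def ascent (η : ℝ) (xh x : G.Vec) : G.Vec :=
  fun i => simplexProj (G.m_pos i) fun a => xh i a + η * G.utilVec i x a

/-- The state `(xhat^(t+1), x^(t))` of optimistic gradient descent with learning rate `η` and
initialization `x₀ = xhat^(1) = x^(0)`; the prediction is the last observed utility vector. -/
def ogdState (η : ℝ) (x₀ : G.Vec) : ℕ → G.Vec × G.Vec
  | 0 => (x₀, x₀)
  | t + 1 =>
    let s := ogdState η x₀ t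
    let x := G.ascent η s.1 s.2
    (G.ascent η s.1 x, x)

/-- The iterate `x^(t)`, `t ≥ 1`. -/
def ogd (η : ℝ) (x₀ : G.Vec) (t : ℕ) : G.Vec := (G.ogdState η x₀ t).2

/-- A Lipschitz constant of the game operator `x ↦ (utilVec i x)_i`, namely the number of players
times the largest number of actions. -/
def lip : ℝ := G.n * (Finset.univ.sup G.m : ℕ)

/-- The learning rate `1 / (4 L)`. -/
def rate : ℝ := 1 / (4 * G.lip)

/-! ### Representations -/

/-- Tuples of rational vectors. -/
abbrev RatVec : Type := ∀ i : Fin G.n, Fin (G.m i) → ℚ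

variable {G} in
/-- A rational tuple seen as a real one. -/
def RatVec.toReal (y : G.RatVec) : G.Vec := fun i a => (y i a : ℝ)

end Game

/-- The datum `v` represents the rational `q` as a numerator and a positive denominator. -/
def RatRep (v : Val) (q : ℚ) : Prop :=
  ∃ a b : ℤ, 0 < b ∧ v = .pair (.int a) (.int b) ∧ q = (a : ℚ) / b

/-- The datum `v` represents the rational tuple `y` as a list of lists of rationals. -/
def Game.VecRep (G : Game) (v : Val) (y : G.RatVec) : Prop :=
  ∃ f : ∀ i : Fin G.n, Fin (G.m i) → Val, (∀ i a, RatRep (f i a) (y i a)) ∧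
    v = Val.list (List.ofFn fun i => Val.list (List.ofFn (f i)))

/-- The datum `v` represents a rational mixed profile of `G` with property `R`. -/
def Game.OutputsProfile (G : Game) (R : G.Vec → Prop) (v : Val) : Prop :=
  ∃ y : G.RatVec, G.VecRep v y ∧ y.toReal ∈ G.Mixed ∧ R y.toReal

/-- A class of succinctly represented games: a set of bit strings, each of which describes a game.
(The values of `game` outside `inst` play no role.) -/
structure GameClass where
  inst : Set (List Bool)
  game : List Bool → Game

namespace GameClass

variable (C : GameClass)

/-- The numbers of actions of the players can be computed in polynomial time from the
representation, and their sum is polynomially bounded. -/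
def PolynomialType : Prop :=
  ∃ (D : Prog) (q : Polynomial ℕ), ∀ w ∈ C.inst,
    (∑ i, (C.game w).m i) ≤ q.eval w.length ∧
    HaltsWithin D (.bits w) (q.eval w.length) fun v =>
      v = Val.list (List.ofFn fun i => .int ((C.game w).m i))

/-- The polynomial expectation property: the expected utility of a player under a rational product
distribution can be computed in polynomial time. -/
def PolynomialExpectation : Prop :=
  ∃ (E : Prog) (q : Polynomial ℕ), ∀ w ∈ C.inst, ∀ (i : Fin (C.game w).n)
    (y : (C.game w).RatVec) (v : Val), y.toReal ∈ (C.game w).Mixed → (C.game w).VecRep v y →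
    HaltsWithin E (.pair (.bits w) (.pair (.int (i : ℕ)) v)) (q.eval (w.length + v.size))
      fun o => ∃ r : ℚ, RatRep o r ∧ (r : ℝ) = (C.game w).util i y.toReal

/-- Uniform hardness of beating the welfare `ρ * opt`: on every infinite family of games of the
class and for every positive polynomial `p`, it is NP-hard to compute a profile with welfare at
least `ρ * opt + 1 / p`. -/
def UniformlyHard (ρ : ℝ) : Prop :=
  ∀ S ⊆ C.inst, S.Infinite → ∀ p : Polynomial ℕ, (∀ k, 0 < p.eval k) →
    SearchNPHard S fun w => (C.game w).OutputsProfile fun x =>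
      ρ * (C.game w).opt + 1 / ((p.eval w.length : ℕ) : ℝ) ≤ (C.game w).sw x

end GameClass

end

end SmoothGames

namespace SmoothGames
noncomputable section

/-! ### Polynomial bounds -/

/-! The engine is a dichotomy for optimistic gradient descent. By `regret_step`, the learning rate
times the sum of the players' regrets against any fixed profile is at most the decrease of a
nonnegative potential minus a multiple of the squared movement of that round. A round with little
movement produces an approximate equilibrium, by the variational inequality of the projection
(`isNash_of_movement_le`). So if none of the first T iterates is an approximate equilibrium, every
round moves a lot, the negative terms outweigh the initial potential (at most n), and in some round
the total regret against the benchmark profile of smoothness is bounded below zero. Smoothness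
converts this into welfare that exceeds ρ·OPT by an inverse polynomial (`exists_welfare`).

Thus on the games where the dynamics find no equilibrium, the same dynamics beat ρ·OPT in polynomial
time: output the iterate of greatest welfare. Uniform hardness and P ≠ NP then leave only finitely
many such games. These are answered from a table of rational approximate equilibria, which exist by
Nash's theorem (`exists_isNash_zero`). Nash's theorem is derived from Brouwer's theorem on the cube,
whose combinatorial core `sum_cup` is a degree computation modulo 2.

In the bit model the dynamics run on a grid with a common denominator 2^K. The integer projection is
the exact projection of a nearby point (`intProj_isSimplexProj`), so the error is multiplied by a
bounded factor per round, and polynomially many bits suffice for polynomially many rounds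
(`abs_intState_sub_le`). Nash gap and welfare are evaluated on the rounded iterates. `flagged_spec`
and `unflagged_spec` leave enough slack that passing the test certifies both the rounded and the
exact iterate, while failing at every round rules out even a much better exact iterate.

Polynomial time is handled by `Computes`, which speaks of one program on a whole family of inputs
over an arbitrary index type. A loop body is a computation over a sigma type that adjoins the
counter, so nested loops become computations over nested sigma types, and the combinators never
mention explicit running times. -/

theorem polynomial_eval_mono (q : Polynomial ℕ) {a b : ℕ} (h : a ≤ b) : q.eval a ≤ q.eval b := by
  rw [Polynomial.eval_eq_sum_range, Polynomial.eval_eq_sum_range]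
  gcongr

/-- `f` is bounded by a polynomial in `len`. -/
def PolyBdd {ι : Type} (len f : ι → ℕ) : Prop := ∃ q : Polynomial ℕ, ∀ i, f i ≤ q.eval (len i)

namespace PolyBdd

variable {ι κ : Type} {len f g : ι → ℕ}

theorem mono (h : PolyBdd len g) (hfg : ∀ i, f i ≤ g i) : PolyBdd len f :=
  h.imp fun _ hq i => (hfg i).trans (hq i)

theorem const (c : ℕ) : PolyBdd len fun _ => c := ⟨Polynomial.C c, fun i => by simp⟩

theorem self : PolyBdd len len := ⟨Polynomial.X, fun i => by simp⟩

theorem add (hf : PolyBdd len f) (hg : PolyBdd len g) : PolyBdd len fun i => f i + g i := by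
  obtain ⟨p, hp⟩ := hf
  obtain ⟨q, hq⟩ := hg
  exact ⟨p + q, fun i => by rw [Polynomial.eval_add]; exact add_le_add (hp i) (hq i)⟩

theorem mul (hf : PolyBdd len f) (hg : PolyBdd len g) : PolyBdd len fun i => f i * g i := by
  obtain ⟨p, hp⟩ := hf
  obtain ⟨q, hq⟩ := hg
  exact ⟨p * q, fun i => by rw [Polynomial.eval_mul]; exact Nat.mul_le_mul (hp i) (hq i)⟩

theorem poly (q : Polynomial ℕ) (hf : PolyBdd len f) : PolyBdd len fun i => q.eval (f i) := by
  obtain ⟨p, hp⟩ := hf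
  exact ⟨q.comp p, fun i => by rw [Polynomial.eval_comp]; exact polynomial_eval_mono q (hp i)⟩

theorem reindex (h : PolyBdd len f) (e : κ → ι) : PolyBdd (len ∘ e) (f ∘ e) :=
  h.imp fun _ hq i => hq (e i)

end PolyBdd

/-! ### Families of computations with polynomial cost -/

/-- Every rule charges its input and its output. A cost bound is therefore also a size bound, which
is why size estimates need not be carried along with `Computes`. -/
theorem Run.size_le {p : Prog} {x y : Val} {t : ℕ} (h : Run p x y t) : x.size + y.size ≤ t := by
  cases h <;> omega

theorem Run.while_done {c p : Prog} {x : Val} {s : ℕ} (hc : Run c x (.int 0) s) :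
    Run (.while_ c p) x x (s + x.size + x.size) := by
  constructor
  exact hc

/-- One program takes `env i` to `out i` for all `i`, at cost polynomial in `len i`. -/
def Computes {ι : Type} (len : ι → ℕ) (env out : ι → Val) : Prop :=
  ∃ (P : Prog) (q : Polynomial ℕ), ∀ i, ∃ t, Run P (env i) (out i) t ∧ t ≤ q.eval (len i)

namespace Computes

variable {ι κ : Type} {len : ι → ℕ} {env a b c : ι → Val}

theorem bdd_add (h : Computes len env a) : PolyBdd len fun i => (env i).size + (a i).size := by
  obtain ⟨P, q, h⟩ := h
  exact ⟨q, fun i => by obtain ⟨t, ht, hq⟩ := h i; exact ht.size_le.trans hq⟩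

theorem bdd_env (h : Computes len env a) : PolyBdd len fun i => (env i).size :=
  h.bdd_add.mono fun _ => Nat.le_add_right _ _

theorem bdd (h : Computes len env a) : PolyBdd len fun i => (a i).size :=
  h.bdd_add.mono fun _ => Nat.le_add_left _ _

theorem congr (h : Computes len env a) (e : ∀ i, a i = b i) : Computes len env b := by
  rwa [← funext e]

/-- Together with `cost`, this trades the polynomial in the definition for an arbitrary polynomially
bounded cost function, so that costs can be added up pointwise. -/
theorem of_cost {P : Prog} {f : ι → ℕ} (hf : PolyBdd len f)
    (h : ∀ i, ∃ t, Run P (env i) (a i) t ∧ t ≤ f i) : Computes len env a := by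
  obtain ⟨q, hq⟩ := hf
  exact ⟨P, q, fun i => by obtain ⟨t, ht, hle⟩ := h i; exact ⟨t, ht, hle.trans (hq i)⟩⟩

theorem cost (h : Computes len env a) :
    ∃ (P : Prog) (f : ι → ℕ), PolyBdd len f ∧ ∀ i, ∃ t, Run P (env i) (a i) t ∧ t ≤ f i := by
  obtain ⟨P, q, h⟩ := h
  exact ⟨P, fun i => q.eval (len i), ⟨q, fun _ => le_rfl⟩, h⟩

theorem reindex (h : Computes len env a) (e : κ → ι) :
    Computes (fun k => len (e k)) (fun k => env (e k)) (fun k => a (e k)) := by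
  obtain ⟨P, q, h⟩ := h
  exact ⟨P, q, fun k => h (e k)⟩

theorem id (h : PolyBdd len fun i => (env i).size) : Computes len env env :=
  of_cost (P := .skip) (h.add h) fun _ => ⟨_, .skip _, le_rfl⟩

theorem const (h : PolyBdd len fun i => (env i).size) (v : Val) : Computes len env fun _ => v :=
  of_cost (P := .lit v) (h.add (.const v.size)) fun _ => ⟨_, .lit v _, le_rfl⟩

theorem comp (h : Computes len a b) (h' : Computes len env a) : Computes len env b := by
  have h1 := h'.bdd_env
  have h2 := h.bdd
  obtain ⟨P, f, hf, hP⟩ := h'.cost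
  obtain ⟨Q, g, hg, hQ⟩ := h.cost
  refine of_cost (P := .seq P Q) (((hf.add hg).add h1).add h2) fun i => ?_
  obtain ⟨s, hs, hs'⟩ := hP i
  obtain ⟨t, ht, ht'⟩ := hQ i
  exact ⟨_, .seq hs ht, by gcongr⟩

theorem pair (h : Computes len env a) (h' : Computes len env b) :
    Computes len env fun i => .pair (a i) (b i) := by
  have h0 := h.bdd_env
  have h1 := h.bdd
  have h2 := h'.bdd
  obtain ⟨P, f, hf, hP⟩ := h.cost
  obtain ⟨Q, g, hg, hQ⟩ := h'.cost
  refine of_cost (P := .fork P Q)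
    (((hf.add hg).add h0).add (((PolyBdd.const 1).add h1).add h2)) fun i => ?_
  obtain ⟨s, hs, hs'⟩ := hP i
  obtain ⟨t, ht, ht'⟩ := hQ i
  exact ⟨_, .fork hs ht, by simp only [Val.size]; gcongr⟩

theorem fst (h : Computes len env fun i => .pair (a i) (b i)) : Computes len env a := by
  refine comp (of_cost (P := .left) (h.bdd.add h.bdd) fun i => ⟨_, .left _, ?_⟩) h
  simp only [Val.left, Val.size]
  omega

theorem snd (h : Computes len env fun i => .pair (a i) (b i)) : Computes len env b := by
  refine comp (of_cost (P := .right) (h.bdd.add h.bdd) fun i => ⟨_, .right _, ?_⟩) h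
  simp only [Val.right, Val.size]
  omega

/-- The size bound on the result is a separate hypothesis, because each arithmetic operation has its
own growth. -/
theorem prim (o : PrimOp) (h : Computes len env a)
    (hb : PolyBdd len fun i => (o.apply (a i)).size) :
    Computes len env fun i => o.apply (a i) :=
  comp (of_cost (P := .prim o) (h.bdd.add hb) fun _ => ⟨_, .prim o _, le_rfl⟩) h

end Computes

/-! ### Integer arithmetic, comparison and branching at polynomial cost. -/

theorem Val.size_int_bool (c : Prop) [Decidable c] : (Val.int (if c then 1 else 0)).size ≤ 2 := by
  split_ifs <;> simp [Val.size]

theorem Val.size_int_le {z : ℤ} {n : ℕ} (h : z.natAbs < 2 ^ n) : (Val.int z).size ≤ 1 + n := by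
  simp only [Val.size]
  have := Nat.size_le.2 h
  omega

theorem Val.natAbs_lt (z : ℤ) : z.natAbs < 2 ^ (Val.int z).size := by
  refine (Nat.lt_size_self z.natAbs).trans_le (Nat.pow_le_pow_right (by norm_num) ?_)
  simp only [Val.size]
  omega

theorem Val.size_int_natCast_le (n : ℕ) : (Val.int n).size ≤ 1 + n :=
  Val.size_int_le (by simpa using Nat.lt_two_pow_self)

namespace Computes

variable {ι κ : Type} {len : ι → ℕ} {env a b c : ι → Val} {x y : ι → ℤ}

theorem add (hx : Computes len env fun i => .int (x i)) (hy : Computes len env fun i => .int (y i)) :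
    Computes len env fun i => .int (x i + y i) := by
  refine prim .add (hx.pair hy) ((((PolyBdd.const 2).add hx.bdd).add hy.bdd).mono fun i => ?_)
  have := Val.natAbs_lt (x i)
  have := Val.natAbs_lt (y i)
  refine (Val.size_int_le (n := 1 + (Val.int (x i)).size + (Val.int (y i)).size) ?_).trans (by omega)
  have h1 : 2 ^ (Val.int (x i)).size ≤ 2 ^ ((Val.int (x i)).size + (Val.int (y i)).size) :=
    Nat.pow_le_pow_right (by norm_num) (by omega)
  have h2 : 2 ^ (Val.int (y i)).size ≤ 2 ^ ((Val.int (x i)).size + (Val.int (y i)).size) :=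
    Nat.pow_le_pow_right (by norm_num) (by omega)
  rw [add_assoc, pow_add 2 1]
  omega

theorem mul (hx : Computes len env fun i => .int (x i)) (hy : Computes len env fun i => .int (y i)) :
    Computes len env fun i => .int (x i * y i) := by
  refine prim .mul (hx.pair hy) ((((PolyBdd.const 1).add hx.bdd).add hy.bdd).mono fun i => ?_)
  have h1 := Val.natAbs_lt (x i)
  have h2 := Val.natAbs_lt (y i)
  refine (Val.size_int_le (n := (Val.int (x i)).size + (Val.int (y i)).size) ?_).trans (by omega)
  rw [Int.natAbs_mul, pow_add]
  exact Nat.mul_lt_mul'' h1 h2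

theorem int (h : PolyBdd len fun i => (env i).size) (z : ℤ) : Computes len env fun _ => .int z :=
  const h _

theorem neg (hx : Computes len env fun i => .int (x i)) : Computes len env fun i => .int (-x i) :=
  ((int hx.bdd_env (-1)).mul hx).congr fun i => by rw [neg_one_mul]

theorem sub (hx : Computes len env fun i => .int (x i)) (hy : Computes len env fun i => .int (y i)) :
    Computes len env fun i => .int (x i - y i) :=
  (hx.add hy.neg).congr fun i => by rw [← sub_eq_add_neg]

theorem fdiv (hx : Computes len env fun i => .int (x i))
    (hy : Computes len env fun i => .int (y i)) :
    Computes len env fun i => .int (Int.fdiv (x i) (y i)) := by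
  refine prim .div (hx.pair hy) (((PolyBdd.const 2).add hx.bdd).mono fun i => ?_)
  refine (Val.size_int_le (n := 1 + (Val.int (x i)).size) ?_).trans (by omega)
  have h1 := Val.natAbs_lt (x i)
  -- Rounding down can exceed the truncated quotient in absolute value by one, which costs one extra
  -- bit.
  have h2 : (Int.fdiv (x i) (y i)).natAbs ≤ (x i).natAbs + 1 := by
    rw [Int.fdiv_eq_ediv]
    have := Int.natAbs_ediv_le_natAbs (x i) (y i)
    split_ifs <;> omega
  rw [pow_add]
  have := Nat.one_le_two_pow (n := (Val.int (x i)).size)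
  omega

theorem lt (hx : Computes len env fun i => .int (x i)) (hy : Computes len env fun i => .int (y i)) :
    Computes len env fun i => .int (if x i < y i then 1 else 0) :=
  prim .lt (hx.pair hy) ((PolyBdd.const 2).mono fun _ => Val.size_int_bool _)

theorem le (hx : Computes len env fun i => .int (x i)) (hy : Computes len env fun i => .int (y i)) :
    Computes len env fun i => .int (if x i ≤ y i then 1 else 0) :=
  (hx.lt (hy.add (int hx.bdd_env 1))).congr fun i => by simp only [Int.lt_add_one_iff]

open Classical in
theorem eq (ha : Computes len env a) (hb : Computes len env b) :
    Computes len env fun i => .int (if a i = b i then 1 else 0) :=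
  prim .eq (ha.pair hb) ((PolyBdd.const 2).mono fun _ => Val.size_int_bool _)

theorem eqInt (hx : Computes len env fun i => .int (x i))
    (hy : Computes len env fun i => .int (y i)) :
    Computes len env fun i => .int (if x i = y i then 1 else 0) :=
  (hx.eq hy).congr fun i => by simp only [Val.int.injEq]

theorem ite {p : ι → Prop} [∀ i, Decidable (p i)]
    (hp : Computes len env fun i => .int (if p i then 1 else 0))
    (ha : Computes len env a) (hb : Computes len env b) :
    Computes len env fun i => if p i then a i else b i := by
  have h0 := hp.bdd_env
  have h1 := ha.bdd
  have h2 := hb.bdd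
  obtain ⟨P, f, hf, hP⟩ := hp.cost
  obtain ⟨Q, g, hg, hQ⟩ := ha.cost
  obtain ⟨R, h, hh, hR⟩ := hb.cost
  refine of_cost (P := .ite P Q R) ((((hf.add hg).add hh).add h0).add (h1.add h2)) fun i => ?_
  obtain ⟨s, hs, hs'⟩ := hP i
  obtain ⟨t, ht, ht'⟩ := hQ i
  obtain ⟨r, hr, hr'⟩ := hR i
  by_cases hc : p i
  · simp only [hc, if_true] at hs ⊢
    exact ⟨_, .ite_true hs (by simp) ht, by omega⟩
  · simp only [hc, if_false] at hs ⊢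
    exact ⟨_, .ite_false hs hr, by omega⟩

theorem max (hx : Computes len env fun i => .int (x i))
    (hy : Computes len env fun i => .int (y i)) :
    Computes len env fun i => .int (max (x i) (y i)) :=
  ((hx.le hy).ite hy hx).congr fun i => by
    split_ifs with h
    · rw [max_eq_right h]
    · rw [max_eq_left (le_of_not_ge h)]

/-! #### Loops -/

variable {N : ι → ℕ}

/-- The state after k rounds is prescribed as `s i k`. The guard is evaluated once more than the
body, hence the two index types. The guard's cost also bounds the sizes of all states, by
`Run.size_le`. -/
theorem whileLoop (s : ι → ℕ → Val) (hN : PolyBdd len N)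
    (hc : Computes (fun p : Σ i, Fin (N i + 1) => len p.1) (fun p => s p.1 p.2)
      (fun p => .int (if (p.2 : ℕ) < N p.1 then 1 else 0)))
    (hb : Computes (fun p : Σ i, Fin (N i) => len p.1) (fun p => s p.1 p.2)
      (fun p => s p.1 (p.2 + 1))) :
    Computes len (fun i => s i 0) (fun i => s i (N i)) := by
  obtain ⟨P, f, hP⟩ := hc
  obtain ⟨Q, g, hQ⟩ := hb
  refine of_cost (P := .while_ P Q) (f := fun i => (N i + 1) * (3 * f.eval (len i) + g.eval (len i)))
    ((hN.add (.const 1)).mul (((PolyBdd.const 3).mul (.poly f .self)).add (.poly g .self)))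
    fun i => ?_
  have hsz : ∀ k, k ≤ N i → (s i k).size ≤ f.eval (len i) := fun k hk => by
    obtain ⟨t, ht, ht'⟩ := hP ⟨i, k, by omega⟩
    have := ht.size_le
    simp only at this ht'
    omega
  -- Induction on the number j of rounds still to come, since a `while_` derivation unfolds from its
  -- first round.
  have key : ∀ j, j ≤ N i → ∃ t, Run (.while_ P Q) (s i (N i - j)) (s i (N i)) t ∧
      t ≤ (j + 1) * (3 * f.eval (len i) + g.eval (len i)) := by
    intro j
    induction j with
    | zero =>
      intro _
      obtain ⟨t, ht, ht'⟩ := hP ⟨i, N i, by omega⟩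
      simp only [lt_irrefl, if_false] at ht ht'
      refine ⟨_, .while_done ht, ?_⟩
      have := hsz (N i) le_rfl
      rw [Nat.sub_zero]
      omega
    | succ j ih =>
      intro hj
      obtain ⟨r, hr, hr'⟩ := ih (by omega)
      obtain ⟨t, ht, ht'⟩ := hP ⟨i, N i - (j + 1), by omega⟩
      obtain ⟨u, hu, hu'⟩ := hQ ⟨i, N i - (j + 1), by omega⟩
      have e : N i - (j + 1) + 1 = N i - j := by omega
      have e' : N i - (j + 1) < N i := by omega
      simp only [e', if_true] at ht ht'
      simp only [e] at hu hu'
      refine ⟨_, .while_step ht (by simp) hu hr, ?_⟩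
      have h1 := hsz (N i) le_rfl
      have h2 := hsz (N i - (j + 1)) (by omega)
      rw [add_mul (j + 1) 1]
      omega
  simpa using key (N i) le_rfl

/-- The environment of a loop body: the counter and the loop state are added. -/
theorem iterate (s : ι → ℕ → Val) (hN : PolyBdd len N)
    (hs : PolyBdd (fun p : Σ i, Fin (N i + 1) => len p.1) fun p => (s p.1 p.2).size)
    (hn : Computes len env fun i => .int (N i)) (h0 : Computes len env fun i => s i 0)
    (hb : Computes (fun p : Σ i, Fin (N i) => len p.1)
      (fun p => .pair (env p.1) (.pair (.int (p.2 : ℕ)) (s p.1 p.2))) (fun p => s p.1 (p.2 + 1))) :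
    Computes len env fun i => s i (N i) := by
  -- A loop sees nothing but its state, so the environment, the bound and the counter are packed
  -- into it.
  let S : ι → ℕ → Val := fun i k => .pair (.pair (env i) (.int (N i))) (.pair (.int k) (s i k))
  have hS : PolyBdd (fun p : Σ i, Fin (N i + 1) => len p.1) fun p => (S p.1 p.2).size := by
    have h1 := ((hn.bdd_env.add hn.bdd).add hN).reindex (Sigma.fst : (Σ i, Fin (N i + 1)) → ι)
    refine ((h1.add hs).add (.const 5)).mono fun p => ?_
    have h2 := Val.size_int_natCast_le (p.2 : ℕ)
    have h3 := p.2.2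
    simp only [S, Val.size, Function.comp] at h2 ⊢
    omega
  have hS' : PolyBdd (fun p : Σ i, Fin (N i) => len p.1) fun p => (S p.1 p.2).size :=
    hS.reindex fun p : Σ i, Fin (N i) => (⟨p.1, p.2.castSucc⟩ : Σ i, Fin (N i + 1))
  have hw : Computes len (fun i => S i 0) (fun i => S i (N i)) := by
    refine whileLoop S hN ?_ ?_
    · have hid := Computes.id hS
      refine (hid.snd.fst.lt hid.fst.snd).congr fun p => ?_
      simp only [Nat.cast_lt]
    · have hid := Computes.id hS'
      refine (hid.fst.pair (((hid.snd.fst.add (int hS' 1)).congr fun p => ?_).pair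
        (hb.comp (hid.fst.fst.pair hid.snd))))
      simp
  exact (hw.comp (((Computes.id hn.bdd_env).pair hn).pair ((int hn.bdd_env 0).pair h0))).snd.snd

end Computes

/-! ### Lists as data, and loops over `Fin`. -/

theorem Val.size_list_le {B : ℕ} : ∀ l : List Val, (∀ v ∈ l, v.size ≤ B) →
    (Val.list l).size ≤ 2 + l.length * (1 + B)
  | [], _ => by simp [Val.list, Val.size]
  | a :: l, h => by
    have h1 := Val.size_list_le l fun v hv => h v (List.mem_cons_of_mem _ hv)
    have h2 := h a List.mem_cons_self
    simp only [Val.list, Val.size, List.length_cons, add_mul]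
    omega

theorem Val.size_list_drop_le (l : List Val) (k : ℕ) :
    (Val.list (l.drop k)).size ≤ (Val.list l).size := by
  induction l generalizing k with
  | nil => simp
  | cons a l ih =>
    cases k with
    | zero => simp
    | succ k =>
      have := ih k
      simp only [List.drop_succ_cons, Val.list, Val.size]
      omega

theorem Val.length_le_size_list (l : List Val) : l.length ≤ (Val.list l).size := by
  induction l with
  | nil => simp
  | cons a l ih => simp only [Val.list, Val.size, List.length_cons]; omega

/-- Lists of integers are the values of vectors. -/
def Val.vec {n : ℕ} (x : Fin n → ℤ) : Val := Val.list (List.ofFn fun a => Val.int (x a))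

namespace Computes

variable {ι κ : Type} {len : ι → ℕ} {env a b c : ι → Val} {x y : ι → ℤ} {n : ι → ℕ}

/-- A nonempty list is a pair and the empty one a leaf, so this is the test for emptiness. -/
theorem isPair (h : Computes len env a) :
    Computes len env fun i => PrimOp.isPair.apply (a i) := by
  refine prim .isPair h ((PolyBdd.const 2).mono fun i => ?_)
  cases a i <;> simp [PrimOp.apply, Val.size]

theorem bdd_length {l : ι → List Val} (h : Computes len env fun i => Val.list (l i)) :
    PolyBdd len fun i => (l i).length :=
  h.bdd.mono fun _ => Val.length_le_size_list _

/-- The number of rounds is not yet available as a datum, so `iterate` does not apply; the guard is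
the emptiness test on the remaining list. -/
theorem length {l : ι → List Val} (h : Computes len env fun i => Val.list (l i)) :
    Computes len env fun i => .int ((l i).length : ℤ) := by
  let S : ι → ℕ → Val := fun i k => .pair (Val.list ((l i).drop k)) (.int k)
  have hS : PolyBdd (fun p : Σ i, Fin ((l i).length + 1) => len p.1)
      fun p => (S p.1 p.2).size := by
    have h1 := (h.bdd.add h.bdd_length).reindex (Sigma.fst : (Σ i, Fin ((l i).length + 1)) → ι)
    refine (h1.add (.const 2)).mono fun p => ?_
    have h2 := Val.size_int_natCast_le (p.2 : ℕ)
    have h3 := Val.size_list_drop_le (l p.1) p.2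
    have h4 := p.2.2
    simp only [S, Val.size, Function.comp] at h2 ⊢
    omega
  have hS' : PolyBdd (fun p : Σ i, Fin (l i).length => len p.1) fun p => (S p.1 p.2).size :=
    hS.reindex fun p : Σ i, Fin (l i).length => (⟨p.1, p.2.castSucc⟩ : Σ i, Fin ((l i).length + 1))
  have hw : Computes len (fun i => S i 0) (fun i => S i (l i).length) := by
    refine whileLoop S h.bdd_length ?_ ?_
    · refine (Computes.id hS).fst.isPair.congr fun p => ?_
      split_ifs with hp
      · rw [List.drop_eq_getElem_cons hp]
        rfl
      · rw [List.drop_eq_nil_of_le (not_lt.1 hp)]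
        rfl
    · have hid := (Computes.id hS').fst
      have e : ∀ p : Σ i, Fin (l i).length, Val.list ((l p.1).drop p.2) =
          .pair (l p.1)[p.2] (Val.list ((l p.1).drop (p.2 + 1))) := fun p => by
        rw [List.drop_eq_getElem_cons p.2.2]
        rfl
      refine (hid.congr e).snd.pair (((Computes.id hS').snd.add (int hS' 1)).congr fun p => ?_)
      simp
  exact (hw.comp (h.pair (int h.bdd_env 0))).snd

theorem length_ofFn {f : ∀ i, Fin (n i) → Val}
    (h : Computes len env fun i => Val.list (List.ofFn (f i))) :
    Computes len env fun i => .int (n i) :=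
  h.length.congr fun i => by simp

theorem bdd_length_ofFn {f : ∀ i, Fin (n i) → Val}
    (h : Computes len env fun i => Val.list (List.ofFn (f i))) : PolyBdd len n :=
  h.bdd_length.mono fun i => by simp

/-- Drop as many entries as the index says, then take the head. The default value in `getD` is never
reached, because the index lies in `Fin (n i)`. -/
theorem nth {f : ∀ i, Fin (n i) → Val} (h : Computes len env fun i => Val.list (List.ofFn (f i)))
    {k : ∀ i, Fin (n i)} (hk : Computes len env fun i => .int (k i : ℕ)) :
    Computes len env fun i => f i (k i) := by
  let s : ι → ℕ → Val := fun i j => Val.list ((List.ofFn (f i)).drop j)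
  have hs : ∀ i j, j < n i → s i j = .pair ((List.ofFn (f i)).getD j (.int 0)) (s i (j + 1)) := by
    intro i j hj
    simp only [s]
    rw [List.drop_eq_getElem_cons (by simpa using hj), List.getD_eq_getElem _ _ (by simpa using hj)]
    rfl
  have hb : PolyBdd (fun p : Σ i, Fin (k i + 1) => len p.1) fun p => (s p.1 p.2).size :=
    (h.bdd.reindex (Sigma.fst : (Σ i, Fin (k i + 1)) → ι)).mono fun p =>
      Val.size_list_drop_le _ _
  have hb' : PolyBdd (fun p : Σ i, Fin (k i) => len p.1) fun p => (s p.1 p.2).size :=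
    hb.reindex fun p : Σ i, Fin (k i) => (⟨p.1, p.2.castSucc⟩ : Σ i, Fin (k i + 1))
  have hkn : PolyBdd len fun i => (k i : ℕ) := h.bdd_length_ofFn.mono fun i => (k i).2.le
  have hd := iterate (N := fun i => k i) s hkn hb hk (h.congr fun i => by simp [s]) ?_
  · exact (hd.congr fun i => hs i _ (k i).2).fst.congr fun i => by
      rw [List.getD_eq_getElem _ _ (by simp)]
      simp
  · have hid : Computes (fun p : Σ i, Fin (k i) => len p.1)
      (fun p => .pair (env p.1) (.pair (.int (p.2 : ℕ)) (s p.1 p.2))) _ := Computes.id ?_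
    · exact (hid.snd.snd.congr fun p => hs _ _ (p.2.2.trans (k p.1).2)).snd
    · have h1 := (h.bdd_env.add hkn).reindex (Sigma.fst : (Σ i, Fin (k i)) → ι)
      refine ((h1.add hb').add (.const 3)).mono fun p => ?_
      have h2 := Val.size_int_natCast_le (p.2 : ℕ)
      have := p.2.2
      simp only [Val.size, Function.comp] at h2 ⊢
      omega

theorem vec_nth {f : ∀ i, Fin (n i) → ℤ} (h : Computes len env fun i => Val.vec (f i))
    {k : ∀ i, Fin (n i)} (hk : Computes len env fun i => .int (k i : ℕ)) :
    Computes len env fun i => .int (f i (k i)) :=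
  nth (f := fun i a => Val.int (f i a)) h hk

/-- The environment of the body of a loop over `Fin (n i)`. -/
def loopEnv (env : ι → Val) (n : ι → ℕ) (p : Σ i, Fin (n i)) : Val :=
  .pair (env p.1) (.int (p.2 : ℕ))

theorem bdd_loopEnv (he : PolyBdd len fun i => (env i).size) (hn : PolyBdd len n) :
    PolyBdd (fun p : Σ i, Fin (n i) => len p.1) fun p => (loopEnv env n p).size := by
  have h1 := (he.add hn).reindex (Sigma.fst : (Σ i, Fin (n i)) → ι)
  refine (h1.add (.const 3)).mono fun p => ?_
  have h2 := Val.size_int_natCast_le (p.2 : ℕ)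
  have := p.2.2
  simp only [loopEnv, Val.size, Function.comp] at h2 ⊢
  omega

theorem weaken (hn : PolyBdd len n) (h : Computes len env a) :
    Computes (fun p : Σ i, Fin (n i) => len p.1) (loopEnv env n) (fun p => a p.1) :=
  (h.reindex (Sigma.fst : (Σ i, Fin (n i)) → ι)).comp
    (Computes.id (bdd_loopEnv h.bdd_env hn)).fst

theorem index (hn : PolyBdd len n) (he : PolyBdd len fun i => (env i).size) :
    Computes (fun p : Σ i, Fin (n i) => len p.1) (loopEnv env n) (fun p => .int (p.2 : ℕ)) :=
  (Computes.id (bdd_loopEnv he hn)).snd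

/-- Iteration whose body receives the loop environment and the loop state. -/
theorem loop (s : ι → ℕ → Val) (hN : PolyBdd len n)
    (hs : PolyBdd (fun p : Σ i, Fin (n i + 1) => len p.1) fun p => (s p.1 p.2).size)
    (hn : Computes len env fun i => .int (n i)) (h0 : Computes len env fun i => s i 0)
    (hb : Computes (fun p : Σ i, Fin (n i) => len p.1)
      (fun p => .pair (loopEnv env n p) (s p.1 p.2)) (fun p => s p.1 (p.2 + 1))) :
    Computes len env fun i => s i (n i) := by
  refine iterate s hN hs hn h0 (hb.comp ?_)
  have hs' := hs.reindex fun p : Σ i, Fin (n i) => (⟨p.1, p.2.castSucc⟩ : Σ i, Fin (n i + 1))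
  have hid : Computes (fun p : Σ i, Fin (n i) => len p.1)
      (fun p => .pair (env p.1) (.pair (.int (p.2 : ℕ)) (s p.1 p.2))) _ := Computes.id <| by
    refine (((bdd_loopEnv h0.bdd_env hN).add hs').add (.const 1)).mono fun p => ?_
    simp only [loopEnv, Val.size, Function.comp, Fin.val_castSucc]
    omega
  exact (hid.fst.pair hid.snd.fst).pair hid.snd.snd

theorem loopState (s : ι → ℕ → Val) (he : PolyBdd len fun i => (env i).size) (hN : PolyBdd len n)
    (hs : PolyBdd (fun p : Σ i, Fin (n i + 1) => len p.1) fun p => (s p.1 p.2).size) :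
    Computes (fun p : Σ i, Fin (n i) => len p.1)
      (fun p => .pair (loopEnv env n p) (s p.1 p.2))
      (fun p => .pair (loopEnv env n p) (s p.1 p.2)) := by
  have hs' := hs.reindex fun p : Σ i, Fin (n i) => (⟨p.1, p.2.castSucc⟩ : Σ i, Fin (n i + 1))
  refine Computes.id ((((bdd_loopEnv he hN).add hs').add (.const 1)).mono fun p => ?_)
  simp only [loopEnv, Val.size, Function.comp, Fin.val_castSucc]
  omega

/-- Consing adds at the front, so the list is built from its end: after j rounds the state holds the
last j entries, and the body runs the program for `f` at the reversed index. -/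
theorem tabulate {f : ∀ i, Fin (n i) → Val} (hN : PolyBdd len n)
    (hn : Computes len env fun i => .int (n i))
    (hf : Computes (fun p : Σ i, Fin (n i) => len p.1) (loopEnv env n) fun p => f p.1 p.2) :
    Computes len env fun i => Val.list (List.ofFn (f i)) := by
  let s : ι → ℕ → Val := fun i j => Val.list ((List.ofFn (f i)).drop (n i - j))
  have hs : PolyBdd (fun p : Σ i, Fin (n i + 1) => len p.1) fun p => (s p.1 p.2).size := by
    obtain ⟨q, hq⟩ := hf.bdd
    have h1 : PolyBdd len fun i => 2 + n i * (1 + q.eval (len i)) :=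
      (PolyBdd.const 2).add (hN.mul ((PolyBdd.const 1).add (.poly q .self)))
    refine (h1.reindex (Sigma.fst : (Σ i, Fin (n i + 1)) → ι)).mono fun p => ?_
    refine (Val.size_list_drop_le _ _).trans ((Val.size_list_le (B := q.eval (len p.1)) _ ?_).trans
      (by simp))
    intro v hv
    obtain ⟨j, rfl⟩ := (List.mem_ofFn' _ _).1 hv
    exact hq ⟨p.1, j⟩
  have key := loop s hN hs hn (((Computes.int hn.bdd_env 0)).congr fun i => ?_) ?_
  · simpa [s] using key
  · simp only [s, Nat.sub_zero]
    rw [List.drop_eq_nil_of_le (by simp)]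
    rfl
  · have hid := loopState s hn.bdd_env hN hs
    have hf' := hf.reindex fun p : Σ i, Fin (n i) => (⟨p.1, p.2.rev⟩ : Σ i, Fin (n i))
    have hn' := ((hn.reindex (Sigma.fst : (Σ i, Fin (n i)) → ι)).comp hid.fst.fst)
    have hk := ((hn'.sub hid.fst.snd).sub (Computes.int hid.bdd_env 1))
    refine (((hf'.comp (hid.fst.fst.pair (hk.congr fun p => ?_))).pair hid.snd)).congr fun p => ?_
    · have := p.2.2
      simp only [Fin.val_rev]
      congr 1
      omega
    · have := p.2.2
      have e : n p.1 - (p.2 : ℕ) = n p.1 - (p.2 + 1) + 1 := by omega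
      simp only [s]
      rw [List.drop_eq_getElem_cons (i := n p.1 - (p.2 + 1)) (by simp; omega), ← e]
      simp only [Val.list, List.getElem_ofFn]
      rfl

theorem vec_tabulate {f : ∀ i, Fin (n i) → ℤ} (hN : PolyBdd len n)
    (hn : Computes len env fun i => .int (n i))
    (hf : Computes (fun p : Σ i, Fin (n i) => len p.1) (loopEnv env n) fun p => .int (f p.1 p.2)) :
    Computes len env fun i => Val.vec (f i) :=
  tabulate (f := fun i a => Val.int (f i a)) hN hn hf

theorem sum {f : ∀ i, Fin (n i) → ℤ} (hN : PolyBdd len n)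
    (hn : Computes len env fun i => .int (n i))
    (hf : Computes (fun p : Σ i, Fin (n i) => len p.1) (loopEnv env n) fun p => .int (f p.1 p.2)) :
    Computes len env fun i => .int (∑ k, f i k) := by
  let F : ι → ℕ → ℤ := fun i j => if h : j < n i then f i ⟨j, h⟩ else 0
  let s : ι → ℕ → Val := fun i j => .int (∑ k ∈ Finset.range j, F i k)
  have hs : PolyBdd (fun p : Σ i, Fin (n i + 1) => len p.1) fun p => (s p.1 p.2).size := by
    obtain ⟨q, hq⟩ := hf.bdd
    have h1 : PolyBdd len fun i => 1 + (n i + q.eval (len i)) :=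
      (PolyBdd.const 1).add (hN.add (.poly q .self))
    refine (h1.reindex (Sigma.fst : (Σ i, Fin (n i + 1)) → ι)).mono fun p => Val.size_int_le ?_
    have h2 : ∀ k ∈ Finset.range (p.2 : ℕ), (F p.1 k).natAbs ≤ 2 ^ q.eval (len p.1) := by
      intro k hk
      have hk' : k < n p.1 := by
        have := Finset.mem_range.1 hk
        have := p.2.2
        omega
      simp only [F, hk', dif_pos]
      exact (Val.natAbs_lt _).le.trans (Nat.pow_le_pow_right (by norm_num) (hq ⟨p.1, k, hk'⟩))
    refine (Int.natAbs_sum_le _ _).trans_lt ((Finset.sum_le_card_nsmul _ _ _ h2).trans_lt ?_)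
    rw [Finset.card_range, smul_eq_mul, pow_add]
    refine Nat.mul_lt_mul_of_pos_right ?_ (by positivity)
    have := p.2.2
    exact lt_of_le_of_lt (by omega) (Nat.lt_two_pow_self (n := n p.1))
  have key := loop s hN hs hn (((Computes.int hn.bdd_env 0)).congr fun i => ?_) ?_
  · refine key.congr fun i => ?_
    simp only [s, F, Finset.sum_range, Fin.is_lt, dif_pos, Fin.eta]
  · simp [s]
  · have hid := loopState s hn.bdd_env hN hs
    refine (hid.snd.add (hf.comp hid.fst)).congr fun p => ?_
    simp only [s, Finset.sum_range_succ, F, p.2.2, dif_pos, Fin.eta]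

/-- The index of a maximal entry, by linear search. -/
def argmaxAux {n : ℕ} (f : Fin n → ℤ) (h0 : 0 < n) : ℕ → Fin n
  | 0 => ⟨0, h0⟩
  | k + 1 => if h : k < n then
      if f (argmaxAux f h0 k) < f ⟨k, h⟩ then ⟨k, h⟩ else argmaxAux f h0 k
    else argmaxAux f h0 k

/-- Fixed by linear search, rather than chosen, so that a program can find the very same index. -/
def argmax {n : ℕ} (h0 : 0 < n) (f : Fin n → ℤ) : Fin n := argmaxAux f h0 n

theorem le_argmax {n : ℕ} (h0 : 0 < n) (f : Fin n → ℤ) (a : Fin n) : f a ≤ f (argmax h0 f) := by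
  have key : ∀ k, ∀ a : Fin n, (a : ℕ) < k → f a ≤ f (argmaxAux f h0 k) := by
    intro k
    induction k with
    | zero => intro a ha; omega
    | succ k ih =>
      intro a ha
      unfold argmaxAux
      rcases Nat.lt_succ_iff_lt_or_eq.1 ha with h | h
      · have := ih a h
        split_ifs <;> omega
      · have hk : k < n := h ▸ a.2
        have e : a = ⟨k, hk⟩ := Fin.ext h
        subst e
        rw [dif_pos hk]
        split_ifs <;> omega
  exact key n a a.2

theorem argmax_index {f : ∀ i, Fin (n i) → ℤ} (h0 : ∀ i, 0 < n i) (hN : PolyBdd len n)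
    (hn : Computes len env fun i => .int (n i))
    (hf : Computes (fun p : Σ i, Fin (n i) => len p.1) (loopEnv env n) fun p => .int (f p.1 p.2)) :
    Computes len env fun i => .int (argmax (h0 i) (f i) : ℕ) := by
  let s : ι → ℕ → Val := fun i j => .int (argmaxAux (f i) (h0 i) j : ℕ)
  have hs : PolyBdd (fun p : Σ i, Fin (n i + 1) => len p.1) fun p => (s p.1 p.2).size := by
    refine (((PolyBdd.const 1).add hN).reindex
      (Sigma.fst : (Σ i, Fin (n i + 1)) → ι)).mono fun p => ?_
    refine (Val.size_int_natCast_le _).trans ?_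
    simp only [Function.comp]
    have := (argmaxAux (f p.1) (h0 p.1) p.2).2
    omega
  refine loop s hN hs hn (((Computes.int hn.bdd_env 0)).congr fun i => ?_) ?_
  · simp [s, argmaxAux]
  · have hid := loopState s hn.bdd_env hN hs
    -- The program for `f` is run a second time, with the index stored in the state in place of the
    -- counter.
    have h1 := (hf.reindex fun p : Σ i, Fin (n i) =>
      (⟨p.1, argmaxAux (f p.1) (h0 p.1) p.2⟩ : Σ i, Fin (n i))).comp (hid.fst.fst.pair hid.snd)
    refine ((h1.lt (hf.comp hid.fst)).ite hid.fst.snd hid.snd).congr fun p => ?_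
    simp only [s, argmaxAux, p.2.2, dif_pos, Fin.eta]
    split_ifs <;> rfl

theorem sup {f : ∀ i, Fin (n i) → ℤ} (h0 : ∀ i, 0 < n i) (hN : PolyBdd len n)
    (hn : Computes len env fun i => .int (n i))
    (hf : Computes (fun p : Σ i, Fin (n i) => len p.1) (loopEnv env n) fun p => .int (f p.1 p.2)) :
    Computes len env fun i => .int (f i (argmax (h0 i) (f i))) :=
  (hf.reindex fun i => (⟨i, argmax (h0 i) (f i)⟩ : Σ i, Fin (n i))).comp
    ((Computes.id hn.bdd_env).pair (argmax_index h0 hN hn hf))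

/-- Repeated doubling; it is essential that the exponent itself, and not merely its bit size, is
polynomially bounded. -/
theorem two_pow (hN : PolyBdd len n) (hn : Computes len env fun i => .int (n i)) :
    Computes len env fun i => .int (2 ^ n i) := by
  let s : ι → ℕ → Val := fun i j => .int (2 ^ j)
  have hs : PolyBdd (fun p : Σ i, Fin (n i + 1) => len p.1) fun p => (s p.1 p.2).size := by
    refine (((PolyBdd.const 2).add hN).reindex
      (Sigma.fst : (Σ i, Fin (n i + 1)) → ι)).mono fun p => ?_
    refine (Val.size_int_le (n := n p.1 + 1) ?_).trans (by simp only [Function.comp]; omega)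
    rw [Int.natAbs_pow]
    exact Nat.pow_lt_pow_right (by norm_num) p.2.2
  refine loop s hN hs hn (((Computes.int hn.bdd_env 1)).congr fun i => by simp [s]) ?_
  have hid := loopState s hn.bdd_env hN hs
  refine ((Computes.int hid.bdd_env 2).mul hid.snd).congr fun p => ?_
  simp only [s, pow_succ']

theorem poly (q : Polynomial ℕ) (hn : Computes len env fun i => .int (n i)) :
    Computes len env fun i => .int (q.eval (n i) : ℕ) := by
  induction q using Polynomial.induction_on' with
  | add p q hp hq => exact (hp.add hq).congr fun i => by simp
  | monomial k a =>
    induction k with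
    | zero => exact (int hn.bdd_env a).congr fun i => by simp
    | succ k ih => exact (ih.mul hn).congr fun i => by simp [pow_succ, mul_assoc]

end Computes

/-! ### Brouwer's theorem on the cube, by cup products of cochains modulo 2 -/

section Cube

variable {ι : Type*} [DecidableEq ι]

/-- The cup product of the coboundaries of the `0`-cochains `bs`, evaluated on the cube with lowest
vertex `v` and directions `J`. -/
def cup : List ((ι → ℕ) → ZMod 2) → Finset ι → (ι → ℕ) → ZMod 2
  | [], _, _ => 1
  | b :: bs, J, v =>
    ∑ j ∈ J, (b (v + Pi.single j 1) + b v) * cup bs (J.erase j) (v + Pi.single j 1)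

theorem sum_erase_comm (J : Finset ι) (f : ι → ι → ZMod 2) :
    ∑ j ∈ J, ∑ k ∈ J.erase j, f j k = ∑ j ∈ J, ∑ k ∈ J.erase j, f k j :=
  Finset.sum_comm' fun x y => by
    simp only [Finset.mem_erase, ne_eq, eq_comm]
    tauto

/-- Ordered pairs of distinct directions cancel in twos under the swap, modulo 2. -/
theorem sum_erase_symm (J : Finset ι) (f : ι → ι → ZMod 2)
    (h : ∀ j k, f j k = f k j) : ∑ j ∈ J, ∑ k ∈ J.erase j, f j k = 0 := by
  have e : ∑ j ∈ J, ∑ k ∈ J.erase j, f j k = ∑ p ∈ J.offDiag, f p.1 p.2 := by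
    rw [Finset.sum_sigma']
    refine Finset.sum_bij' (fun p _ => (p.1, p.2)) (fun p _ => ⟨p.1, p.2⟩) ?_ ?_ ?_ ?_ ?_
    · rintro ⟨j, k⟩ hp
      simp only [Finset.mem_sigma, Finset.mem_erase, Finset.mem_offDiag] at hp ⊢
      tauto
    · rintro ⟨j, k⟩ hp
      simp only [Finset.mem_sigma, Finset.mem_erase, Finset.mem_offDiag] at hp ⊢
      tauto
    all_goals simp
  rw [e]
  refine Finset.sum_involution (fun p _ => p.swap) ?_ ?_ ?_ ?_
  · intro p _
    simp only [Prod.fst_swap, Prod.snd_swap, h p.2 p.1]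
    exact CharTwo.add_self_eq_zero _
  · intro p hp _ hc
    rw [Finset.mem_offDiag] at hp
    exact hp.2.2 (congrArg Prod.fst hc).symm
  · intro p hp
    rw [Finset.mem_offDiag] at hp ⊢
    exact ⟨hp.2.1, hp.1, fun e => hp.2.2 e.symm⟩
  · intro p _
    exact p.swap_swap

/-- A cup product of coboundaries is closed. Expanding the first factor, the terms at the far corner
cancel by symmetry in the two directions; the others combine, after renaming directions, into
multiples of the coboundary of the shorter product, which vanishes by induction. -/
theorem cup_cocycle (bs : List ((ι → ℕ) → ZMod 2)) : ∀ (J : Finset ι) (v : ι → ℕ),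
    J.card = bs.length + 1 →
    ∑ j ∈ J, (cup bs (J.erase j) (v + Pi.single j 1) + cup bs (J.erase j) v) = 0 := by
  induction bs with
  | nil =>
    intro J v _
    exact Finset.sum_eq_zero fun j _ => CharTwo.add_self_eq_zero _
  | cons b bs ih =>
    intro J v hJ
    have ih' : ∀ j ∈ J, ∀ w, ∑ k ∈ J.erase j, (cup bs ((J.erase j).erase k) (w + Pi.single k 1)
        + cup bs ((J.erase j).erase k) w) = 0 := fun j hj w =>
      ih _ w (by rw [Finset.card_erase_of_mem hj, hJ]; simp)
    have h1 : ∑ j ∈ J, ∑ k ∈ J.erase j, b (v + Pi.single j 1 + Pi.single k 1) *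
        cup bs ((J.erase j).erase k) (v + Pi.single j 1 + Pi.single k 1) = 0 :=
      sum_erase_symm J _ fun j k => by rw [add_right_comm, Finset.erase_right_comm]
    have h1' : ∑ j ∈ J, ∑ k ∈ J.erase j,
        cup bs ((J.erase j).erase k) (v + Pi.single j 1 + Pi.single k 1) = 0 :=
      sum_erase_symm J _ fun j k => by rw [add_right_comm, Finset.erase_right_comm]
    have h2 : ∑ j ∈ J, ∑ k ∈ J.erase j, (b (v + Pi.single j 1) *
        cup bs ((J.erase j).erase k) (v + Pi.single j 1 + Pi.single k 1) +
        b (v + Pi.single j 1) * cup bs ((J.erase j).erase k) (v + Pi.single j 1)) = 0 := by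
      refine Finset.sum_eq_zero fun j hj => ?_
      simp only [← mul_add]
      rw [← Finset.mul_sum, ih' j hj, mul_zero]
    have h4 : ∑ j ∈ J, ∑ k ∈ J.erase j,
        cup bs ((J.erase j).erase k) (v + Pi.single j 1) = 0 := by
      have h := Finset.sum_eq_zero fun j hj => ih' j hj (v + Pi.single j 1)
      simp only [Finset.sum_add_distrib] at h
      rwa [h1', zero_add] at h
    have h3 : ∑ j ∈ J, ∑ k ∈ J.erase j, (b (v + Pi.single k 1) + b v) *
        cup bs ((J.erase j).erase k) (v + Pi.single k 1) =
        ∑ j ∈ J, ∑ k ∈ J.erase j,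
          b (v + Pi.single j 1) * cup bs ((J.erase j).erase k) (v + Pi.single j 1) := by
      have e : ∀ j k, cup bs ((J.erase k).erase j) (v + Pi.single j 1) =
          cup bs ((J.erase j).erase k) (v + Pi.single j 1) := fun j k => by
        rw [Finset.erase_right_comm]
      rw [sum_erase_comm]
      simp only [e, add_mul, Finset.sum_add_distrib, ← Finset.mul_sum]
      rw [h4, mul_zero, add_zero]
    simp only [cup, Finset.sum_add_distrib] at h2 ⊢
    rw [h3]
    simp only [add_mul, Finset.sum_add_distrib]
    rw [h1, zero_add, h2]

/-- Each term of the expanded product contains a difference of `b` along some edge of the cube, so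
it vanishes when `b` is constant on the vertices. -/
theorem cup_eq_zero (b : (ι → ℕ) → ZMod 2) (bs : List ((ι → ℕ) → ZMod 2)) (hb : b ∈ bs) :
    ∀ (J : Finset ι) (v : ι → ℕ),
      (∀ u, (∀ i ∉ J, u i = v i) → (∀ i, v i ≤ u i ∧ u i ≤ v i + 1) → b u = b v) →
      cup bs J v = 0 := by
  induction bs with
  | nil => simp at hb
  | cons b' bs ih =>
    intro J v h
    have hstep : ∀ j ∈ J, b (v + Pi.single j 1) = b v := fun j hj => h _
      (fun i hi => by simp [ne_of_mem_of_not_mem hj hi |>.symm])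
      (fun i => by simp only [Pi.add_apply, Pi.single_apply]; split_ifs <;> omega)
    refine Finset.sum_eq_zero fun j hj => ?_
    rcases List.mem_cons.1 hb with rfl | hb'
    · rw [hstep j hj, CharTwo.add_self_eq_zero, zero_mul]
    · rw [ih hb' (J.erase j) (v + Pi.single j 1) ?_, mul_zero]
      intro u hu hu'
      rw [hstep j hj]
      refine h u (fun i hi => ?_) fun i => ?_
      · rw [hu i (fun hc => hi (Finset.mem_of_mem_erase hc))]
        simp [ne_of_mem_of_not_mem hj hi |>.symm]
      · have h1 := hu' i
        have h2 := hu i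
        simp only [Pi.add_apply, Pi.single_apply, Finset.mem_erase] at h1 h2
        by_cases hij : i = j
        · simp only [hij, ne_eq, not_true, false_and, not_false_iff, if_true, true_imp_iff] at h2 ⊢
          omega
        · simpa [hij] using h1

variable [Fintype ι]

/-- The lowest vertices of the unit cubes in directions `J`, at position `w` otherwise. -/
def box (N : ℕ) (J : Finset ι) (w : ι → ℕ) : Finset (ι → ℕ) :=
  Fintype.piFinset fun i => if i ∈ J then Finset.range N else {w i}

theorem mem_box {N : ℕ} {J : Finset ι} {w v : ι → ℕ} :
    v ∈ box N J w ↔ (∀ i ∈ J, v i < N) ∧ ∀ i ∉ J, v i = w i := by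
  simp only [box, Fintype.mem_piFinset]
  refine ⟨fun h => ⟨fun i hi => by simpa [hi] using h i, fun i hi => by simpa [hi] using h i⟩,
    fun h i => ?_⟩
  split_ifs with hi
  · exact Finset.mem_range.2 (h.1 i hi)
  · exact Finset.mem_singleton.2 (h.2 i hi)

theorem sum_box_eq {N : ℕ} {J : Finset ι} {j : ι} (hj : j ∈ J) (w : ι → ℕ)
    (g : (ι → ℕ) → ZMod 2) : ∑ v ∈ box N J w, g v =
      ∑ t ∈ Finset.range N, ∑ v ∈ box N (J.erase j) (Function.update w j t), g v := by
  rw [← Finset.sum_fiberwise_of_maps_to (g := fun v => v j) (t := Finset.range N)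
    (fun v hv => Finset.mem_range.2 ((mem_box.1 hv).1 j hj))]
  refine Finset.sum_congr rfl fun t ht => Finset.sum_congr ?_ fun _ _ => rfl
  ext v
  simp only [Finset.mem_filter, mem_box, Finset.mem_erase, Function.update_apply]
  refine ⟨fun h => ⟨fun i hi => h.1.1 i hi.2, fun i hi => ?_⟩, fun h => ⟨⟨fun i hi => ?_, fun i hi => ?_⟩, ?_⟩⟩
  · split_ifs with hij
    · rw [hij, h.2]
    · exact h.1.2 i fun hc => hi ⟨hij, hc⟩
  · by_cases hij : i = j
    · have := h.2 i (fun hc => hc.1 hij)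
      rw [if_pos hij] at this
      rw [this]
      exact Finset.mem_range.1 ht
    · exact h.1 i ⟨hij, hi⟩
  · have := h.2 i (fun hc => hi hc.2)
    rwa [if_neg (ne_of_mem_of_not_mem hj hi).symm] at this
  · simpa using h.2 j (by simp)

theorem sum_box_shift {N : ℕ} {J : Finset ι} {j : ι} (hj : j ∉ J) (w : ι → ℕ) (t : ℕ)
    (g : (ι → ℕ) → ZMod 2) :
    ∑ v ∈ box N J (Function.update w j t), g (v + Pi.single j 1) =
      ∑ v ∈ box N J (Function.update w j (t + 1)), g v := by
  refine Finset.sum_bij' (fun v _ => v + Pi.single j 1) (fun v _ => Function.update v j t)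
    ?_ ?_ ?_ ?_ fun _ _ => rfl
  · intro v hv
    rw [mem_box] at hv ⊢
    refine ⟨fun i hi => ?_, fun i hi => ?_⟩
    · simpa [Pi.single_apply, ne_of_mem_of_not_mem hi hj] using hv.1 i hi
    · have := hv.2 i hi
      by_cases hij : i = j
      · subst hij
        simpa using this
      · simpa [hij] using this
  · intro v hv
    rw [mem_box] at hv ⊢
    refine ⟨fun i hi => ?_, fun i hi => ?_⟩
    · simpa [ne_of_mem_of_not_mem hi hj] using hv.1 i hi
    · have := hv.2 i hi
      by_cases hij : i = j
      · subst hij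
        simp
      · simpa [hij] using this
  · intro v hv
    have := (mem_box.1 hv).2 j hj
    ext i
    by_cases hij : i = j
    · subst hij
      simpa using this.symm
    · simp [hij]
  · intro v hv
    have := (mem_box.1 hv).2 j hj
    ext i
    by_cases hij : i = j
    · subst hij
      simpa using this.symm
    · simp [hij]

/-- Stokes' formula in one direction: the slices telescope and only the two faces remain. -/
theorem sum_box_boundary {N : ℕ} {J : Finset ι} {j : ι} (hj : j ∈ J) (w : ι → ℕ)
    (g : (ι → ℕ) → ZMod 2) : ∑ v ∈ box N J w, (g (v + Pi.single j 1) + g v) =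
      ∑ v ∈ box N (J.erase j) (Function.update w j N), g v +
      ∑ v ∈ box N (J.erase j) (Function.update w j 0), g v := by
  have hs := sum_box_eq (N := N) hj w fun v => g (v + Pi.single j 1)
  rw [Finset.sum_add_distrib, sum_box_eq hj w g, hs, ← Finset.sum_add_distrib]
  simp only [sum_box_shift (Finset.notMem_erase j J)]
  have h := Finset.sum_range_sub
    (fun t => ∑ v ∈ box N (J.erase j) (Function.update w j t), g v) N
  simpa only [CharTwo.sub_eq_add] using h

/-- This is a degree computation. Since the product of the later factors is closed, the whole
product is the coboundary of `b j₁` times that product, so its sum over the box is a sum over faces.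
Only the face where coordinate `j₁` equals `N` survives; there `b j₁ = 1`, and what remains is the
same statement in one dimension less. -/
theorem sum_cup {N : ℕ} (b : ι → (ι → ℕ) → ZMod 2) (h0 : ∀ j v, v j = 0 → b j v = 0)
    (h1 : ∀ j v, v j = N → b j v = 1) : ∀ (js : List ι), js.Nodup → ∀ w : ι → ℕ,
    ∑ v ∈ box N js.toFinset w, cup (js.map b) js.toFinset v = 1 := by
  intro js
  induction js with
  | nil =>
    intro _ w
    have : box N ∅ w = {w} := by
      ext v
      simp [mem_box, funext_iff]
    simp [cup, this]
  | cons j₁ js ih =>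
    intro hnd w
    obtain ⟨hj₁, hnd'⟩ := List.nodup_cons.1 hnd
    set J := (j₁ :: js).toFinset with hJ
    have hmem : j₁ ∈ J := by simp [hJ]
    have herase : J.erase j₁ = js.toFinset := by
      rw [hJ, List.toFinset_cons, Finset.erase_insert (by simpa using hj₁)]
    have hcard : J.card = (js.map b).length + 1 := by
      rw [hJ, List.toFinset_card_of_nodup hnd, List.length_cons, List.length_map]
    have hexp : ∀ v, cup ((j₁ :: js).map b) J v =
        ∑ j ∈ J, (b j₁ (v + Pi.single j 1) * cup (js.map b) (J.erase j) (v + Pi.single j 1) +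
          b j₁ v * cup (js.map b) (J.erase j) v) := fun v => by
      have h := cup_cocycle (js.map b) J v hcard
      have h' : ∑ j ∈ J, (b j₁ v * cup (js.map b) (J.erase j) (v + Pi.single j 1) +
          b j₁ v * cup (js.map b) (J.erase j) v) = 0 := by
        simp only [← mul_add]
        rw [← Finset.mul_sum, h, mul_zero]
      simp only [List.map_cons, cup, add_mul, Finset.sum_add_distrib] at h' ⊢
      rw [CharTwo.add_eq_zero.1 h']
    simp only [hexp]
    rw [Finset.sum_comm, Finset.sum_congr rfl fun j hj => sum_box_boundary hj w
      fun v => b j₁ v * cup (js.map b) (J.erase j) v, Finset.sum_eq_single_of_mem j₁ hmem]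
    · rw [Finset.sum_eq_zero (s := box N (J.erase j₁) (Function.update w j₁ 0)), add_zero,
        ← ih hnd' (Function.update w j₁ N), herase]
      · refine Finset.sum_congr rfl fun v hv => ?_
        rw [h1 j₁ v (by simpa using (mem_box.1 hv).2 j₁ (by simpa using hj₁)), one_mul]
      · intro v hv
        rw [h0 j₁ v (by simpa using (mem_box.1 hv).2 j₁ (by simp)), zero_mul]
    -- On the faces in another direction `j` the cochain `b j` is constant, so the product
    -- containing it is zero.
    · intro j hj hne
      have hjs : b j ∈ js.map b := List.mem_map_of_mem (by simpa [hJ, hne] using hj)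
      rw [Finset.sum_eq_zero, Finset.sum_eq_zero, add_zero]
      · intro v hv
        have hv' : v j = 0 := by simpa using (mem_box.1 hv).2 j (by simp)
        rw [cup_eq_zero _ _ hjs, mul_zero]
        intro u hu _
        rw [h0 j v hv', h0 j u ((hu j (by simp)).trans hv')]
      · intro v hv
        have hv' : v j = N := by simpa using (mem_box.1 hv).2 j (by simp)
        rw [cup_eq_zero _ _ hjs, mul_zero]
        intro u hu _
        rw [h1 j v hv', h1 j u ((hu j (by simp)).trans hv')]

/-- A discrete Poincaré–Miranda theorem. -/
theorem exists_cube {N : ℕ} (b : ι → (ι → ℕ) → ZMod 2) (h0 : ∀ j v, v j = 0 → b j v = 0)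
    (h1 : ∀ j v, v j = N → b j v = 1) :
    ∃ v : ι → ℕ, (∀ i, v i < N) ∧ ∀ j, ∃ u : ι → ℕ,
      (∀ i, v i ≤ u i ∧ u i ≤ v i + 1) ∧ b j u ≠ b j v := by
  have h := sum_cup b h0 h1 Finset.univ.toList (Finset.nodup_toList _) 0
  rw [Finset.toList_toFinset] at h
  obtain ⟨v, hv, hne⟩ := Finset.exists_ne_zero_of_sum_ne_zero (h.trans_ne one_ne_zero)
  refine ⟨v, fun i => (mem_box.1 hv).1 i (Finset.mem_univ i), fun j => ?_⟩
  by_contra! hc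
  exact hne (cup_eq_zero (b j) _ (List.mem_map_of_mem (by simp)) _ _ fun u _ hu => hc u hu)

/-- Brouwer's fixed point theorem on the cube. -/
theorem exists_fixedPoint_cube (F : (ι → ℝ) → ι → ℝ) (hF : ContinuousOn F (Set.Icc 0 1))
    (hmaps : Set.MapsTo F (Set.Icc 0 1) (Set.Icc 0 1)) : ∃ x ∈ Set.Icc (0 : ι → ℝ) 1, F x = x := by
  classical
  have hcpt : IsCompact (Set.Icc (0 : ι → ℝ) 1) := isCompact_Icc
  have hdist : ContinuousOn (fun x => dist (F x) x) (Set.Icc (0 : ι → ℝ) 1) :=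
    continuous_dist.comp_continuousOn (hF.prodMk continuousOn_id)
  -- By compactness it suffices that the least displacement `δ` cannot be positive: a grid point of
  -- displacement less than `δ` gives the contradiction.
  obtain ⟨x, hx, hmin⟩ := hcpt.exists_isMinOn ⟨0, by simp⟩ hdist
  refine ⟨x, hx, ?_⟩
  by_contra hne
  have hpos : 0 < dist (F x) x := dist_pos.2 hne
  set δ := dist (F x) x with hδ
  obtain ⟨η, hη, huc⟩ := Metric.uniformContinuousOn_iff.1
    (hcpt.uniformContinuousOn_of_continuous hF) (δ / 4) (by positivity)
  obtain ⟨N, hN⟩ := exists_nat_gt (max (1 / η) (4 / δ))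
  have hN1 : 1 / η < N := (le_max_left _ _).trans_lt hN
  have hN2 : 4 / δ < N := (le_max_right _ _).trans_lt hN
  have hNpos : (0 : ℝ) < N := (by positivity : 0 < 1 / η).trans hN1
  have hN1' : 1 / (N : ℝ) < η := by rw [div_lt_iff₀ hη] at hN1; rw [div_lt_iff₀ hNpos]; linarith
  have hN2' : 1 / (N : ℝ) < δ / 4 := by
    rw [div_lt_iff₀ hpos] at hN2
    rw [div_lt_iff₀ hNpos]
    linarith
  let P : (ι → ℕ) → ι → ℝ := fun v i => v i / N
  -- The label records the sign of the displacement in direction `j`. The values prescribed on the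
  -- two outer faces agree with that sign because `F` maps the cube into itself. A cell that carries
  -- both labels in every direction has displacement at most about `δ / 2`.
  let b : ι → (ι → ℕ) → ZMod 2 := fun j v =>
    if v j = 0 then 0 else if v j = N then 1 else if F (P v) j < P v j then 1 else 0
  obtain ⟨v, hv, hcube⟩ := exists_cube (N := N) b (fun j v h => by simp [b, h])
    (fun j v h => by
      have : N ≠ 0 := by exact_mod_cast hNpos.ne'
      simp only [b, this, h, if_true, if_false])
  have hP : ∀ u : ι → ℕ, (∀ i, u i ≤ v i + 1) → P u ∈ Set.Icc (0 : ι → ℝ) 1 := by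
    intro u hu
    refine ⟨fun i => by simp only [P, Pi.zero_apply]; positivity, fun i => ?_⟩
    simp only [P, Pi.one_apply]
    rw [div_le_one hNpos]
    exact_mod_cast (hu i).trans (hv i)
  have hsign : ∀ j, ∀ u : ι → ℕ, (∀ i, u i ≤ v i + 1) →
      (b j u = 0 → P u j ≤ F (P u) j) ∧ (b j u ≠ 0 → F (P u) j ≤ P u j) := by
    intro j u hu
    have hm := hmaps (hP u hu)
    have h0 := hm.1 j
    have h1 := hm.2 j
    simp only [Pi.zero_apply, Pi.one_apply] at h0 h1
    simp only [b]
    split_ifs with c1 c2 c3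
    · simpa [P, c1] using h0
    · simpa [P, c2, hNpos.ne'] using h1
    · simpa using c3.le
    · simpa using c3
  have hPv := hP v fun i => by omega
  have hbound : dist (F (P v)) (P v) < δ := by
    refine (dist_pi_lt_iff hpos).2 fun j => ?_
    obtain ⟨u, hu, hbu⟩ := hcube j
    have hPu := hP u fun i => (hu i).2
    have hdP : dist (P u) (P v) ≤ 1 / N := by
      refine (dist_pi_le_iff (by positivity)).2 fun i => ?_
      simp only [P]
      rw [Real.dist_eq, ← sub_div, abs_div, abs_of_pos hNpos]
      gcongr
      have h1 : (v i : ℝ) ≤ u i := by exact_mod_cast (hu i).1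
      have h2 : (u i : ℝ) ≤ v i + 1 := by exact_mod_cast (hu i).2
      rw [abs_le]
      constructor <;> linarith
    have h1 := (dist_le_pi_dist (F (P u)) (F (P v)) j).trans_lt
      (huc _ hPu _ hPv (hdP.trans_lt hN1'))
    have h2 := (dist_le_pi_dist (P u) (P v) j).trans hdP
    rw [Real.dist_eq, abs_lt] at h1
    rw [Real.dist_eq, abs_le] at h2
    have s1 := hsign j u fun i => (hu i).2
    have s2 := hsign j v fun i => by omega
    rw [Real.dist_eq, abs_lt]
    by_cases hb : b j v = 0
    · have := s2.1 hb
      have := s1.2 (hb ▸ hbu)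
      constructor <;> linarith
    · have := s2.2 hb
      have hbu' : b j u = 0 := by
        have key : ∀ p q : ZMod 2, p ≠ q → q ≠ 0 → p = 0 := by decide
        exact key _ _ hbu hb
      have := s1.1 hbu'
      constructor <;> linarith
  exact absurd (isMinOn_iff.1 hmin _ hPv) (not_le.2 hbound)

end Cube

/-! ### Projection to the simplex -/

section Projection

variable {k : ℕ} {v v' y y' : Fin k → ℝ}

theorem le_one_of_mem_stdSimplex (h : y ∈ stdSimplex ℝ (Fin k)) (a : Fin k) : y a ≤ 1 := by
  rw [← h.2]
  exact Finset.single_le_sum (f := y) (fun b _ => h.1 b) (Finset.mem_univ a)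

/-- First-order optimality along the segment from `y` to `z`: if the inner product were positive, a
short step towards `z` would reduce the distance to `v`. -/
theorem IsSimplexProj.inner_le (h : IsSimplexProj v y) {z : Fin k → ℝ}
    (hz : z ∈ stdSimplex ℝ (Fin k)) : ∑ a, (v a - y a) * (z a - y a) ≤ 0 := by
  by_contra! hc
  set c := ∑ a, (v a - y a) * (z a - y a) with hcdef
  set d := ∑ a, (z a - y a) ^ 2 with hd
  have hd0 : 0 ≤ d := Finset.sum_nonneg fun a _ => sq_nonneg _
  -- The step is short enough that the quadratic term `t ^ 2 * d` stays below the linear gain `2 * t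
  -- * c`.
  set t := min 1 (c / (d + 1)) with ht
  have ht0 : 0 < t := lt_min one_pos (by positivity)
  have ht1 : t ≤ 1 := min_le_left _ _
  have htd : t * (d + 1) ≤ c := by
    rw [← le_div_iff₀ (by positivity)]
    exact min_le_right _ _
  have hmem : (fun a => (1 - t) * y a + t * z a) ∈ stdSimplex ℝ (Fin k) := by
    have := convex_stdSimplex ℝ (Fin k) h.1 hz (sub_nonneg.2 ht1) ht0.le (by ring)
    simpa [Pi.add_def, Pi.smul_def, smul_eq_mul] using this
  have h1 := h.2 _ hmem
  have e : ∑ a, (v a - ((1 - t) * y a + t * z a)) ^ 2 =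
      ∑ a, (v a - y a) ^ 2 - 2 * t * c + t ^ 2 * d := by
    rw [hcdef, hd, Finset.mul_sum, Finset.mul_sum, ← Finset.sum_sub_distrib,
      ← Finset.sum_add_distrib]
    exact Finset.sum_congr rfl fun a _ => by ring
  rw [e] at h1
  nlinarith

theorem isSimplexProj_of_inner_le (hy : y ∈ stdSimplex ℝ (Fin k))
    (h : ∀ z ∈ stdSimplex ℝ (Fin k), ∑ a, (v a - y a) * (z a - y a) ≤ 0) : IsSimplexProj v y := by
  refine ⟨hy, fun z hz => ?_⟩
  have e : ∑ a, (v a - z a) ^ 2 =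
      ∑ a, (v a - y a) ^ 2 - 2 * ∑ a, (v a - y a) * (z a - y a) + ∑ a, (z a - y a) ^ 2 := by
    rw [Finset.mul_sum, ← Finset.sum_sub_distrib, ← Finset.sum_add_distrib]
    exact Finset.sum_congr rfl fun a _ => by ring
  have h1 := h z hz
  have h2 : 0 ≤ ∑ a, (z a - y a) ^ 2 := Finset.sum_nonneg fun a _ => sq_nonneg _
  linarith

/-- Add the variational inequalities of the two projections, each tested at the other point. -/
theorem IsSimplexProj.nonexpansive (h : IsSimplexProj v y) (h' : IsSimplexProj v' y') :
    ∑ a, (y a - y' a) ^ 2 ≤ ∑ a, (v a - v' a) ^ 2 := by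
  have h1 := h.inner_le h'.1
  have h2 := h'.inner_le h.1
  have key : ∑ a, (y a - y' a) ^ 2 ≤ ∑ a, ((v a - v' a) ^ 2 +
      2 * ((v a - y a) * (y' a - y a)) + 2 * ((v' a - y' a) * (y a - y' a))) := by
    refine Finset.sum_le_sum fun a _ => ?_
    nlinarith [sq_nonneg ((v a - v' a) - (y a - y' a))]
  rw [Finset.sum_add_distrib, Finset.sum_add_distrib, ← Finset.mul_sum, ← Finset.mul_sum] at key
  linarith

theorem IsSimplexProj.unique (h : IsSimplexProj v y) (h' : IsSimplexProj v y') : y = y' := by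
  have h1 := h.nonexpansive h'
  simp only [sub_self, ne_eq, OfNat.ofNat_ne_zero, not_false_eq_true, zero_pow,
    Finset.sum_const_zero] at h1
  have h2 := (Finset.sum_eq_zero_iff_of_nonneg fun a _ => sq_nonneg (y a - y' a)).1
    (le_antisymm h1 (Finset.sum_nonneg fun a _ => sq_nonneg _))
  funext a
  have := h2 a (Finset.mem_univ a)
  nlinarith

theorem simplexProj_spec (hk : 0 < k) (v : Fin k → ℝ) : IsSimplexProj v (simplexProj hk v) :=
  Classical.choose_spec (exists_isSimplexProj hk v)

theorem simplexProj_mem (hk : 0 < k) (v : Fin k → ℝ) : simplexProj hk v ∈ stdSimplex ℝ (Fin k) :=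
  (simplexProj_spec hk v).1

theorem simplexProj_of_mem (hk : 0 < k) (h : v ∈ stdSimplex ℝ (Fin k)) : simplexProj hk v = v :=
  (simplexProj_spec hk v).unique (isSimplexProj_of_inner_le h fun z _ => by simp)

/-- Passing from the Euclidean norm to the maximum norm costs the square root of `k`; the cruder
factor `k` avoids roots. -/
theorem IsSimplexProj.abs_sub_le (h : IsSimplexProj v y) (h' : IsSimplexProj v' y') {e : ℝ}
    (he : ∀ a, |v a - v' a| ≤ e) (a : Fin k) : |y a - y' a| ≤ k * e := by
  have he0 : 0 ≤ e := (abs_nonneg _).trans (he a)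
  have hk : (1 : ℝ) ≤ k := by exact_mod_cast a.pos
  have h1 : (y a - y' a) ^ 2 ≤ ∑ a, (y a - y' a) ^ 2 :=
    Finset.single_le_sum (f := fun a => (y a - y' a) ^ 2) (fun b _ => sq_nonneg _)
      (Finset.mem_univ a)
  have h2 : ∑ a, (v a - v' a) ^ 2 ≤ ∑ _a : Fin k, e ^ 2 :=
    Finset.sum_le_sum fun a _ => sq_le_sq' (abs_le.1 (he a)).1 (abs_le.1 (he a)).2
  rw [Finset.sum_const, Finset.card_univ, Fintype.card_fin, nsmul_eq_mul] at h2
  have h3 := h.nonexpansive h'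
  refine abs_le_of_sq_le_sq ?_ (by positivity)
  nlinarith [sq_nonneg e, mul_nonneg (sq_nonneg e) (sub_nonneg.2 hk)]

theorem continuous_simplexProj (hk : 0 < k) : Continuous (simplexProj (k := k) hk) := by
  refine continuous_iff_continuousAt.2 fun v => tendsto_pi_nhds.2 fun a => ?_
  rw [tendsto_iff_dist_tendsto_zero]
  have hc : Filter.Tendsto (fun w : Fin k → ℝ => Real.sqrt (∑ b, (w b - v b) ^ 2)) (nhds v)
      (nhds 0) := by
    have : Continuous fun w : Fin k → ℝ => Real.sqrt (∑ b, (w b - v b) ^ 2) := by fun_prop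
    simpa using this.tendsto v
  refine squeeze_zero (fun _ => dist_nonneg) (fun w => ?_) hc
  rw [Real.dist_eq]
  refine Real.abs_le_sqrt (le_trans ?_
    ((simplexProj_spec hk w).nonexpansive (simplexProj_spec hk v)))
  exact Finset.single_le_sum (f := fun a => (simplexProj hk w a - simplexProj hk v a) ^ 2)
    (fun b _ => sq_nonneg _) (Finset.mem_univ a)

/-- A rational point of the simplex near a given one. -/
theorem exists_rat_near (hy : y ∈ stdSimplex ℝ (Fin k)) {δ : ℝ} (hδ : 0 < δ) :
    ∃ q : Fin k → ℚ, (fun a => (q a : ℝ)) ∈ stdSimplex ℝ (Fin k) ∧ ∀ a, |(q a : ℝ) - y a| ≤ δ := by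
  have hd : 0 < δ / (k + 1) := by positivity
  -- Round every coordinate up by less than `δ / (k + 1)`. The sum is then at least 1 and barely
  -- more, so dividing by it keeps the point close and makes it a distribution.
  choose q hq1 hq2 using fun a => exists_rat_btwn (lt_add_of_pos_right (y a) hd)
  set S : ℚ := ∑ a, q a with hS
  have hSr : (S : ℝ) = ∑ a, (q a : ℝ) := by push_cast [hS]; rfl
  have hq0 : ∀ a, (0 : ℝ) ≤ q a := fun a => (hy.1 a).trans (hq1 a).le
  have hS1 : (1 : ℝ) ≤ S := by
    rw [hSr, ← hy.2]
    exact Finset.sum_le_sum fun a _ => (hq1 a).le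
  have hS2 : (S : ℝ) ≤ 1 + k * (δ / (k + 1)) := by
    rw [hSr]
    refine (Finset.sum_le_sum fun a _ => (hq2 a).le).trans ?_
    rw [Finset.sum_add_distrib, hy.2]
    simp
  have hSpos : (0 : ℝ) < S := by linarith
  refine ⟨fun a => q a / S, ⟨fun a => ?_, ?_⟩, fun a => ?_⟩
  · push_cast
    exact div_nonneg (hq0 a) hSpos.le
  · push_cast
    rw [← Finset.sum_div, ← hSr, div_self hSpos.ne']
  · push_cast
    have hqS : (q a : ℝ) ≤ S := by
      rw [hSr]
      exact Finset.single_le_sum (f := fun a => (q a : ℝ)) (fun b _ => hq0 b) (Finset.mem_univ a)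
    have h1 : (q a : ℝ) / S ≤ q a := div_le_self (hq0 a) hS1
    have h2 : (q a : ℝ) - q a / S ≤ S - 1 := by
      have e : (q a : ℝ) - q a / S = q a / S * (S - 1) := by field_simp
      rw [e]
      exact mul_le_of_le_one_left (by linarith) ((div_le_one hSpos).2 hqS)
    have h3 : k * (δ / (k + 1)) + δ / (k + 1) = δ := by field_simp
    have h4 := hq1 a
    have h5 := hq2 a
    have h6 : 0 ≤ k * (δ / (k + 1)) := by positivity
    rw [abs_le]
    constructor <;> linarith

end Projection

/-! ### Multilinearity and Lipschitz estimates -/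

namespace Game

variable {G : Game}

theorem util_update (i j : Fin G.n) (x : G.Vec) (z : Fin (G.m j) → ℝ) :
    G.util i (Function.update x j z) =
      ∑ a, z a * G.util i (Function.update x j (Pi.single a 1)) := by
  have key : ∀ (w : Fin (G.m j) → ℝ) (s : ∀ k, Fin (G.m k)),
      ∏ k, Function.update x j w k (s k) = w (s j) * ∏ k ∈ Finset.univ.erase j, x k (s k) := by
    intro w s
    rw [← Finset.mul_prod_erase _ _ (Finset.mem_univ j), Function.update_self]
    congr 1
    refine Finset.prod_congr rfl fun k hk => ?_
    rw [Function.update_of_ne (Finset.ne_of_mem_erase hk)]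
  simp only [util, key, Finset.mul_sum]
  rw [Finset.sum_comm]
  refine Finset.sum_congr rfl fun s _ => ?_
  rw [Finset.sum_eq_single_of_mem (s j) (Finset.mem_univ _)]
  · simp [mul_assoc]
  · intro a _ ha
    simp [ha.symm]

theorem util_update_self (i : Fin G.n) (x : G.Vec) (z : Fin (G.m i) → ℝ) :
    G.util i (Function.update x i z) = ∑ a, z a * G.utilVec i x a :=
  util_update i i x z

theorem util_eq_sum (i : Fin G.n) (x : G.Vec) : G.util i x = ∑ a, x i a * G.utilVec i x a := by
  rw [← util_update_self, Function.update_eq_self]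

theorem update_mem_mixed {x : G.Vec} (hx : x ∈ G.Mixed) (i : Fin G.n) {z : Fin (G.m i) → ℝ}
    (hz : z ∈ stdSimplex ℝ (Fin (G.m i))) : Function.update x i z ∈ G.Mixed := by
  intro j
  by_cases h : j = i
  · subst h
    simpa using hz
  · rw [Function.update_of_ne h]
    exact hx j

theorem single_update_mem_mixed {x : G.Vec} (hx : x ∈ G.Mixed) (i : Fin G.n) (a : Fin (G.m i)) :
    Function.update x i (Pi.single a 1) ∈ G.Mixed :=
  update_mem_mixed hx i (single_mem_stdSimplex ℝ a)

theorem abs_util_le {x : G.Vec} (hx : x ∈ G.Mixed) (i : Fin G.n) : |G.util i x| ≤ 1 := by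
  have h1 : ∑ s : (∀ j, Fin (G.m j)), ∏ j, x j (s j) = 1 := by
    have := Finset.prod_univ_sum (fun j => (Finset.univ : Finset (Fin (G.m j)))) (fun j a => x j a)
    rw [Fintype.piFinset_univ] at this
    rw [← this]
    exact Finset.prod_eq_one fun j _ => (hx j).2
  rw [← h1]
  refine (Finset.abs_sum_le_sum_abs _ _).trans (Finset.sum_le_sum fun s _ => ?_)
  rw [abs_mul, abs_of_nonneg (Finset.prod_nonneg fun j _ => (hx j).1 _)]
  exact mul_le_of_le_one_right (Finset.prod_nonneg fun j _ => (hx j).1 _)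
    (abs_le.2 (G.u_mem i s))

theorem abs_utilVec_le {x : G.Vec} (hx : x ∈ G.Mixed) (i : Fin G.n) (a : Fin (G.m i)) :
    |G.utilVec i x a| ≤ 1 :=
  abs_util_le (single_update_mem_mixed hx i a) i

/-- Replace the strategies one player at a time. Each replacement is linear in that player's
strategy, with coefficients that are utilities of mixed profiles and so at most 1 in absolute value.
-/
theorem abs_util_sub_le {x y : G.Vec} (hx : x ∈ G.Mixed) (hy : y ∈ G.Mixed) (i : Fin G.n) :
    |G.util i x - G.util i y| ≤ ∑ j, ∑ a, |x j a - y j a| := by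
  classical
  have key : ∀ J : Finset (Fin G.n), |G.util i x - G.util i fun j => if j ∈ J then y j else x j| ≤
      ∑ j ∈ J, ∑ a, |x j a - y j a| := by
    intro J
    induction J using Finset.induction_on with
    | empty => simp
    | insert j J hj ih =>
      set h : G.Vec := fun k => if k ∈ J then y k else x k with hh
      have hmem : h ∈ G.Mixed := fun k => by
        simp only [hh]
        split_ifs
        exacts [hy k, hx k]
      have e1 : (fun k => if k ∈ insert j J then y k else x k) = Function.update h j (y j) := by
        funext k
        by_cases hk : k = j
        · subst hk
          simp
        · simp [hk, hh]
      have e2 : h = Function.update h j (x j) := by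
        funext k
        by_cases hk : k = j
        · subst hk
          simp [hh, hj]
        · simp [hk]
      have h1 : |G.util i h - G.util i (Function.update h j (y j))| ≤ ∑ a, |x j a - y j a| := by
        conv_lhs => rw [e2, Function.update_idem, util_update i j h (x j), util_update i j h (y j),
          ← Finset.sum_sub_distrib]
        refine (Finset.abs_sum_le_sum_abs _ _).trans (Finset.sum_le_sum fun a _ => ?_)
        rw [← sub_mul, abs_mul]
        exact mul_le_of_le_one_right (abs_nonneg _)
          (abs_util_le (single_update_mem_mixed hmem j a) i)
      rw [e1, Finset.sum_insert hj, add_comm]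
      exact (abs_sub_le _ (G.util i h) _).trans (add_le_add ih h1)
  simpa using key Finset.univ

theorem abs_utilVec_sub_le {x y : G.Vec} (hx : x ∈ G.Mixed) (hy : y ∈ G.Mixed) (i : Fin G.n)
    (a : Fin (G.m i)) : |G.utilVec i x a - G.utilVec i y a| ≤ ∑ j, ∑ a, |x j a - y j a| := by
  refine (abs_util_sub_le (single_update_mem_mixed hx i a) (single_update_mem_mixed hy i a) i).trans
    (Finset.sum_le_sum fun j _ => Finset.sum_le_sum fun b _ => ?_)
  by_cases h : j = i
  · subst h
    simp
  · simp [h]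

theorem isNash_of_close {x y : G.Vec} {ε δ : ℝ} (hx : G.IsNash ε x) (hy : y ∈ G.Mixed)
    (h : ∑ j, ∑ a, |x j a - y j a| ≤ δ) : G.IsNash (ε + 2 * δ) y := by
  refine ⟨hy, fun i z hz => ?_⟩
  have h1 := abs_le.1 ((abs_util_sub_le hx.1 hy i).trans h)
  have h2 := abs_le.1 ((abs_util_sub_le (update_mem_mixed hx.1 i hz)
    (update_mem_mixed hy i hz) i).trans ((Finset.sum_le_sum fun j _ => Finset.sum_le_sum fun b _ =>
      show _ ≤ |x j b - y j b| from ?_).trans h))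
  · have := hx.2 i z hz
    linarith
  · by_cases hj : j = i
    · subst hj
      simp
    · simp [hj]

/-- A mixed deviation is an average of pure ones, so only finitely many deviations need to be
tested. -/
theorem isNash_iff {x : G.Vec} {ε : ℝ} : G.IsNash ε x ↔ x ∈ G.Mixed ∧
    ∀ i a, G.utilVec i x a - G.util i x ≤ ε := by
  refine ⟨fun h => ⟨h.1, fun i a => h.2 i _ (single_mem_stdSimplex ℝ a)⟩, fun h => ⟨h.1, ?_⟩⟩
  intro i z hz
  rw [util_update_self]
  have : ∑ a, z a * G.utilVec i x a ≤ ∑ a, z a * (ε + G.util i x) :=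
    Finset.sum_le_sum fun a _ => mul_le_mul_of_nonneg_left (by linarith [h.2 i a]) (hz.1 a)
  rw [← Finset.sum_mul, hz.2] at this
  linarith

theorem IsNash.mono {x : G.Vec} {ε ε' : ℝ} (h : G.IsNash ε x) (hle : ε ≤ ε') : G.IsNash ε' x :=
  ⟨h.1, fun i z hz => (h.2 i z hz).trans hle⟩

/-- The largest number of actions. -/
def maxActions (G : Game) : ℕ := Finset.univ.sup G.m

theorem le_maxActions (i : Fin G.n) : G.m i ≤ G.maxActions :=
  Finset.le_sup (f := G.m) (Finset.mem_univ i)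

theorem maxActions_pos : 0 < G.maxActions :=
  (G.m_pos ⟨0, G.n_pos⟩).trans_le (le_maxActions _)

theorem lip_eq : G.lip = G.n * G.maxActions := rfl

theorem one_le_n : (1 : ℝ) ≤ G.n := by exact_mod_cast G.n_pos

theorem one_le_maxActions : (1 : ℝ) ≤ G.maxActions := by exact_mod_cast G.maxActions_pos

theorem one_le_lip : 1 ≤ G.lip := by
  rw [lip_eq]
  nlinarith [G.one_le_n, G.one_le_maxActions]

theorem maxActions_le_lip : (G.maxActions : ℝ) ≤ G.lip := by
  rw [lip_eq]
  nlinarith [G.one_le_n, G.one_le_maxActions]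

theorem sum_const_le (c : ℝ) (hc : 0 ≤ c) : ∑ i, ∑ _a : Fin (G.m i), c ≤ G.lip * c := by
  have : ∀ i, ∑ _a : Fin (G.m i), c ≤ G.maxActions * c := fun i => by
    rw [Finset.sum_const, Finset.card_univ, Fintype.card_fin, nsmul_eq_mul]
    exact mul_le_mul_of_nonneg_right (by exact_mod_cast le_maxActions i) hc
  refine (Finset.sum_le_sum fun i _ => this i).trans ?_
  rw [Finset.sum_const, Finset.card_univ, Fintype.card_fin, nsmul_eq_mul, lip_eq, mul_assoc]

/-- One factor `lip` comes from the Cauchy–Schwarz passage from the ℓ¹ to the ℓ² distance, the other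
from summing over all coordinates; `lip` bounds the number of coordinates. -/
theorem sum_sq_utilVec_sub_le {x y : G.Vec} (hx : x ∈ G.Mixed) (hy : y ∈ G.Mixed) :
    ∑ i, ∑ a, (G.utilVec i x a - G.utilVec i y a) ^ 2 ≤
      G.lip ^ 2 * ∑ i, ∑ a, (x i a - y i a) ^ 2 := by
  set S := ∑ i, ∑ a, (x i a - y i a) ^ 2 with hS
  have hS0 : 0 ≤ S := Finset.sum_nonneg fun i _ => Finset.sum_nonneg fun a _ => sq_nonneg _
  have h1 : (∑ j, ∑ a, |x j a - y j a|) ^ 2 ≤ G.lip * S := by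
    have := sq_sum_le_card_mul_sum_sq (s := (Finset.univ : Finset (Σ j, Fin (G.m j))))
      (f := fun p => |x p.1 p.2 - y p.1 p.2|)
    simp only [sq_abs] at this
    rw [← Finset.univ_sigma_univ, Finset.sum_sigma, Finset.sum_sigma, Finset.card_sigma] at this
    refine this.trans (mul_le_mul_of_nonneg_right ?_ hS0)
    have := G.sum_const_le 1 zero_le_one
    simpa using this
  have h2 : ∀ i a, (G.utilVec i x a - G.utilVec i y a) ^ 2 ≤ G.lip * S := fun i a =>
    (sq_le_sq' (abs_le.1 (abs_utilVec_sub_le hx hy i a)).1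
      (abs_le.1 (abs_utilVec_sub_le hx hy i a)).2).trans h1
  have hL := G.one_le_lip
  refine (Finset.sum_le_sum fun i _ => Finset.sum_le_sum fun a _ => h2 i a).trans
    ((G.sum_const_le _ (by positivity)).trans (le_of_eq (by ring)))

theorem ascent_mem (η : ℝ) (xh x : G.Vec) : G.ascent η xh x ∈ G.Mixed := fun _ =>
  simplexProj_mem _ _

theorem ascent_inner_le (η : ℝ) (xh x z : G.Vec) (hz : z ∈ G.Mixed) (i : Fin G.n) :
    ∑ a, (xh i a + η * G.utilVec i x a - G.ascent η xh x i a) * (z i a - G.ascent η xh x i a) ≤ 0 :=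
  (simplexProj_spec (G.m_pos i) _).inner_le (hz i)

theorem continuous_utilVec (i : Fin G.n) (a : Fin (G.m i)) :
    Continuous fun x : G.Vec => G.utilVec i x a := by
  unfold utilVec util
  refine continuous_finsetSum _ fun s _ => Continuous.mul
    (continuous_finsetProd _ fun j _ => ?_) continuous_const
  by_cases h : j = i
  · subst h
    simpa using continuous_const
  · simp only [Function.update_of_ne h]
    fun_prop

/-- Nash's theorem. -/
theorem exists_isNash_zero (G : Game) : ∃ x, G.IsNash 0 x := by
  -- Brouwer is available on the cube only, so points of the cube are first projected to mixed
  -- profiles and then moved by one projected ascent step.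
  let P : ((Σ i, Fin (G.m i)) → ℝ) → G.Vec := fun z i => simplexProj (G.m_pos i) fun a => z ⟨i, a⟩
  have hP : Continuous P := continuous_pi fun i =>
    (continuous_simplexProj (G.m_pos i)).comp (by fun_prop)
  let F : ((Σ i, Fin (G.m i)) → ℝ) → (Σ i, Fin (G.m i)) → ℝ := fun z p =>
    G.ascent 1 (P z) (P z) p.1 p.2
  have hF : Continuous F := by
    refine continuous_pi fun p => (continuous_apply p.2).comp
      ((continuous_simplexProj (G.m_pos p.1)).comp (continuous_pi fun a => ?_))
    exact ((continuous_apply a).comp ((continuous_apply p.1).comp hP)).add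
      (continuous_const.mul ((continuous_utilVec p.1 a).comp hP))
  obtain ⟨z, -, hz⟩ := exists_fixedPoint_cube F hF.continuousOn fun z _ =>
    ⟨fun p => (G.ascent_mem 1 (P z) (P z) p.1).1 p.2,
      fun p => le_one_of_mem_stdSimplex (G.ascent_mem 1 (P z) (P z) p.1) p.2⟩
  have hfix : P z = G.ascent 1 (P z) (P z) := by
    have h1 : ∀ i, (fun a => z ⟨i, a⟩) = G.ascent 1 (P z) (P z) i := fun i => by
      funext a
      exact (congrFun hz ⟨i, a⟩).symm
    funext i
    change simplexProj (G.m_pos i) (fun a => z ⟨i, a⟩) = _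
    rw [simplexProj_of_mem (G.m_pos i) (by rw [h1 i]; exact G.ascent_mem _ _ _ i), h1 i]
  have hmem : P z ∈ G.Mixed := fun i => simplexProj_mem _ _
  refine ⟨P z, hmem, fun i w hw => ?_⟩
  -- At a fixed point of the ascent step, the variational inequality of the projection is precisely
  -- the equilibrium condition.
  have h := G.ascent_inner_le 1 (P z) (P z) _ (update_mem_mixed hmem i hw) i
  rw [← hfix] at h
  simp only [Function.update_self, one_mul, add_sub_cancel_left] at h
  rw [util_update_self, util_eq_sum i (P z), ← Finset.sum_sub_distrib]
  refine le_of_eq_of_le (Finset.sum_congr rfl fun a _ => ?_) h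
  ring

/-- An exact equilibrium may be irrational, but the table for the exceptional games needs rational
entries; a positive tolerance leaves room for rounding. -/
theorem exists_rat_isNash (G : Game) {ε : ℝ} (hε : 0 < ε) :
    ∃ y : G.RatVec, G.IsNash ε y.toReal := by
  obtain ⟨x, hx⟩ := G.exists_isNash_zero
  have hL := G.one_le_lip
  have hd : 0 < ε / (2 * G.lip) := by positivity
  choose q hq hqx using fun i => exists_rat_near (hx.1 i) hd
  refine ⟨q, (isNash_of_close (δ := ε / 2) hx hq ?_).mono (by linarith)⟩
  refine (Finset.sum_le_sum fun i _ => Finset.sum_le_sum fun a _ =>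
    (abs_sub_comm _ _).trans_le (hqx i a)).trans ((G.sum_const_le _ hd.le).trans (le_of_eq ?_))
  field_simp

theorem exists_vecRep {G : Game} (y : G.RatVec) : ∃ v, G.VecRep v y :=
  ⟨_, fun i a => .pair (.int (y i a).num) (.int (y i a).den), fun i a =>
    ⟨_, _, by exact_mod_cast (y i a).den_pos, rfl, by simp [Rat.num_div_den]⟩, rfl⟩

end Game

/-! ### Optimistic gradient descent and welfare -/

/-- Split `u·(z - x)` into `u·(z - xh')`, `m·(xh' - x)` and `(u - m)·(xh' - x)`. The two variational
inequalities bound the first two parts, and their squared distances telescope. Young's inequality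
bounds the third; the learning rate turns the Lipschitz bound into `1/16` of the squared distance
from `x` to `xp`, which is paid by the step from `xh` to `x` and by the second term of the
potential. A share `1/8` of the squared steps is left over. -/
theorem optimistic_step {κ : Type*} [Fintype κ] {xh x xh' xp m u z : κ → ℝ} {L : ℝ} (hL : 0 < L)
    (h1 : ∑ a, (xh a + 1 / (4 * L) * u a - xh' a) * (z a - xh' a) ≤ 0)
    (h2 : ∑ a, (xh a + 1 / (4 * L) * m a - x a) * (xh' a - x a) ≤ 0)
    (hlip : ∑ a, (u a - m a) ^ 2 ≤ L ^ 2 * ∑ a, (x a - xp a) ^ 2) :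
    1 / (4 * L) * ∑ a, u a * (z a - x a) ≤
      (1 / 2 * ∑ a, (xh a - z a) ^ 2 + 1 / 8 * ∑ a, (xh a - xp a) ^ 2) -
      (1 / 2 * ∑ a, (xh' a - z a) ^ 2 + 1 / 8 * ∑ a, (xh' a - x a) ^ 2) -
      1 / 8 * ∑ a, ((x a - xh a) ^ 2 + (x a - xh' a) ^ 2) := by
  set η := 1 / (4 * L) with hη
  have hη2 : η ^ 2 * L ^ 2 = 1 / 16 := by rw [hη]; field_simp; norm_num
  have key : ∑ a, η * (u a * (z a - x a)) ≤ ∑ a,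
      ((xh a + η * u a - xh' a) * (z a - xh' a) + (xh a + η * m a - x a) * (xh' a - x a) +
      (η ^ 2 * (u a - m a) ^ 2 - 1 / 16 * (x a - xp a) ^ 2) +
      (1 / 2 * (xh a - z a) ^ 2 + 1 / 8 * (xh a - xp a) ^ 2) -
      (1 / 2 * (xh' a - z a) ^ 2 + 1 / 8 * (xh' a - x a) ^ 2) -
      1 / 8 * ((x a - xh a) ^ 2 + (x a - xh' a) ^ 2)) := by
    refine Finset.sum_le_sum fun a _ => ?_
    nlinarith [sq_nonneg (η * (u a - m a) - 1 / 2 * (xh' a - x a)),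
      sq_nonneg ((x a - xh a) - (xh a - xp a)), sq_nonneg (x a - xh a)]
  simp only [Finset.sum_add_distrib, Finset.sum_sub_distrib, ← Finset.mul_sum] at key ⊢
  have h3 := mul_le_mul_of_nonneg_left hlip (sq_nonneg η)
  rw [← mul_assoc, hη2] at h3
  linarith

namespace Game

variable {G : Game}

theorem ogdState_mem {η : ℝ} {x₀ : G.Vec} (h : x₀ ∈ G.Mixed) (t : ℕ) :
    (G.ogdState η x₀ t).1 ∈ G.Mixed ∧ (G.ogdState η x₀ t).2 ∈ G.Mixed := by
  cases t with
  | zero => exact ⟨h, h⟩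
  | succ t => exact ⟨G.ascent_mem _ _ _, G.ascent_mem _ _ _⟩

/-- The sum of the squared lengths of the two steps from `(xhat^(t+1), x^(t))`. -/
def movement (G : Game) (η : ℝ) (x₀ : G.Vec) (t : ℕ) : ℝ :=
  ∑ i, ∑ a, (((G.ogdState η x₀ (t + 1)).2 i a - (G.ogdState η x₀ t).1 i a) ^ 2 +
    ((G.ogdState η x₀ (t + 1)).2 i a - (G.ogdState η x₀ (t + 1)).1 i a) ^ 2)

/-- The potential of the regret analysis. -/
def potential (G : Game) (η : ℝ) (x₀ z : G.Vec) (t : ℕ) : ℝ :=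
  1 / 2 * ∑ i, ∑ a, ((G.ogdState η x₀ t).1 i a - z i a) ^ 2 +
    1 / 8 * ∑ i, ∑ a, ((G.ogdState η x₀ t).1 i a - (G.ogdState η x₀ t).2 i a) ^ 2

theorem potential_nonneg (η : ℝ) (x₀ z : G.Vec) (t : ℕ) : 0 ≤ G.potential η x₀ z t := by
  unfold potential
  positivity

theorem sum_sq_sub_le_two {k : ℕ} {x y : Fin k → ℝ} (hx : x ∈ stdSimplex ℝ (Fin k))
    (hy : y ∈ stdSimplex ℝ (Fin k)) : ∑ a, (x a - y a) ^ 2 ≤ 2 := by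
  have : ∑ a, (x a - y a) ^ 2 ≤ ∑ a, (x a + y a) := Finset.sum_le_sum fun a _ => by
    nlinarith [hx.1 a, hy.1 a, le_one_of_mem_stdSimplex hx a, le_one_of_mem_stdSimplex hy a,
      mul_nonneg (hx.1 a) (hy.1 a)]
  rw [Finset.sum_add_distrib, hx.2, hy.2] at this
  linarith

theorem potential_zero_le {η : ℝ} {x₀ z : G.Vec} (hx : x₀ ∈ G.Mixed) (hz : z ∈ G.Mixed) :
    G.potential η x₀ z 0 ≤ G.n := by
  have : ∑ i, ∑ a, (x₀ i a - z i a) ^ 2 ≤ ∑ _i : Fin G.n, 2 :=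
    Finset.sum_le_sum fun i _ => sum_sq_sub_le_two (hx i) (hz i)
  simp only [Finset.sum_const, Finset.card_univ, Fintype.card_fin, nsmul_eq_mul] at this
  simp only [potential, ogdState, sub_self, ne_eq, OfNat.ofNat_ne_zero, not_false_eq_true, zero_pow,
    Finset.sum_const_zero, mul_zero, add_zero]
  linarith

/-- This is `optimistic_step` for the concatenated vectors of all players. The Lipschitz bound holds
only for the whole operator, so it is the sum of the regrets that is controlled. -/
theorem regret_step {x₀ z : G.Vec} (hx : x₀ ∈ G.Mixed) (hz : z ∈ G.Mixed) (t : ℕ) :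
    G.rate * ∑ i, (G.util i (Function.update (G.ogd G.rate x₀ (t + 1)) i (z i)) -
      G.util i (G.ogd G.rate x₀ (t + 1))) ≤
    G.potential G.rate x₀ z t - G.potential G.rate x₀ z (t + 1) -
      1 / 8 * G.movement G.rate x₀ t := by
  obtain ⟨h1, h2⟩ := ogdState_mem (η := G.rate) hx t
  obtain ⟨h1', h2'⟩ := ogdState_mem (η := G.rate) hx (t + 1)
  have hL : 0 < G.lip := one_pos.trans_le G.one_le_lip
  have e1 : (G.ogdState G.rate x₀ (t + 1)).1 = G.ascent G.rate (G.ogdState G.rate x₀ t).1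
    (G.ogdState G.rate x₀ (t + 1)).2 := rfl
  have e2 : (G.ogdState G.rate x₀ (t + 1)).2 = G.ascent G.rate (G.ogdState G.rate x₀ t).1
    (G.ogdState G.rate x₀ t).2 := rfl
  have key := optimistic_step (κ := Σ i, Fin (G.m i))
    (xh := fun p => (G.ogdState G.rate x₀ t).1 p.1 p.2)
    (x := fun p => (G.ogdState G.rate x₀ (t + 1)).2 p.1 p.2)
    (xh' := fun p => (G.ogdState G.rate x₀ (t + 1)).1 p.1 p.2)
    (xp := fun p => (G.ogdState G.rate x₀ t).2 p.1 p.2)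
    (m := fun p => G.utilVec p.1 (G.ogdState G.rate x₀ t).2 p.2)
    (u := fun p => G.utilVec p.1 (G.ogdState G.rate x₀ (t + 1)).2 p.2)
    (z := fun p => z p.1 p.2) hL ?_ ?_ ?_
  · simp only [← Finset.univ_sigma_univ, Finset.sum_sigma] at key
    refine le_of_eq_of_le ?_ key
    change 1 / (4 * G.lip) * _ = _
    congr 1
    refine Finset.sum_congr rfl fun i _ => ?_
    rw [util_update_self, util_eq_sum, ← Finset.sum_sub_distrib]
    exact Finset.sum_congr rfl fun a _ => by rw [ogd]; ring
  · simp only [← Finset.univ_sigma_univ, Finset.sum_sigma]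
    exact Finset.sum_nonpos fun i _ => ascent_inner_le G.rate _ _ z hz i
  · simp only [← Finset.univ_sigma_univ, Finset.sum_sigma]
    exact Finset.sum_nonpos fun i _ => ascent_inner_le G.rate _ _ _ h1' i
  · simp only [← Finset.univ_sigma_univ, Finset.sum_sigma]
    exact sum_sq_utilVec_sub_le h2' h2

/-- Here `xh'` is the projection of `xh` plus the scaled utilities at `x`. If all three points are
close, its variational inequality, multiplied by `4 * lip`, bounds the gain of every deviation from
`x`. Each coordinate contributes `8 * lip * δ` for replacing `xh` by `xh'` and `δ` for replacing `x`
by `xh'`; there are at most `lip` actions. -/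
theorem isNash_of_movement_le {x₀ : G.Vec} (hx : x₀ ∈ G.Mixed) (t : ℕ) {δ : ℝ} (hδ : 0 ≤ δ)
    (h : G.movement G.rate x₀ t ≤ δ ^ 2) :
    G.IsNash (9 * G.lip ^ 2 * δ) (G.ogd G.rate x₀ (t + 1)) := by
  obtain ⟨h1', h2'⟩ := ogdState_mem (η := G.rate) hx (t + 1)
  have hL := G.one_le_lip
  set xh := (G.ogdState G.rate x₀ t).1 with hxh
  set x := (G.ogdState G.rate x₀ (t + 1)).2 with hxdef
  set xh' := (G.ogdState G.rate x₀ (t + 1)).1 with hxh'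
  have e1 : xh' = G.ascent G.rate xh x := rfl
  have hco : ∀ i a, |xh' i a - xh i a| ≤ 2 * δ ∧ |xh' i a - x i a| ≤ δ := by
    intro i a
    have h3 : (x i a - xh i a) ^ 2 + (x i a - xh' i a) ^ 2 ≤ G.movement G.rate x₀ t := by
      refine le_trans ?_ (Finset.single_le_sum (f := fun i => ∑ a, ((x i a - xh i a) ^ 2 +
        (x i a - xh' i a) ^ 2)) (fun i _ => by positivity) (Finset.mem_univ i))
      exact Finset.single_le_sum (f := fun a => (x i a - xh i a) ^ 2 + (x i a - xh' i a) ^ 2)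
        (fun i _ => by positivity) (Finset.mem_univ a)
    have h4 : |x i a - xh i a| ≤ δ := abs_le_of_sq_le_sq (by nlinarith [sq_nonneg (x i a - xh' i a)]) hδ
    have h5 : |x i a - xh' i a| ≤ δ := abs_le_of_sq_le_sq (by nlinarith [sq_nonneg (x i a - xh i a)]) hδ
    rw [abs_le] at h4 h5
    refine ⟨abs_le.2 ⟨by linarith, by linarith⟩, abs_le.2 ⟨by linarith, by linarith⟩⟩
  refine ⟨h2', fun i z hz => ?_⟩
  have h := G.ascent_inner_le G.rate xh x _ (update_mem_mixed h1' i hz) i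
  rw [← e1] at h
  simp only [Function.update_self] at h
  have hr : G.rate * (4 * G.lip) = 1 := by rw [rate]; field_simp
  have hr0 : 0 < G.rate := by rw [rate]; positivity
  change G.util i (Function.update x i z) - G.util i x ≤ _
  rw [util_update_self, util_eq_sum i x, ← Finset.sum_sub_distrib]
  have hb : ∑ a, (z a * G.utilVec i x a - x i a * G.utilVec i x a) ≤
      4 * G.lip * ∑ a, (xh i a + G.rate * G.utilVec i x a - xh' i a) * (z a - xh' i a) +
      ∑ _a : Fin (G.m i), 9 * G.lip * δ := by
    rw [Finset.mul_sum, ← Finset.sum_add_distrib]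
    refine Finset.sum_le_sum fun a _ => ?_
    obtain ⟨c1, c2⟩ := hco i a
    have c3 : |z a - xh' i a| ≤ 1 := by
      rw [abs_le]
      constructor <;> linarith [hz.1 a, (h1' i).1 a, le_one_of_mem_stdSimplex hz a,
        le_one_of_mem_stdSimplex (h1' i) a]
    have c4 := abs_utilVec_le h2' i a
    have c5 : (xh' i a - xh i a) * (z a - xh' i a) ≤ 2 * δ * 1 :=
      (le_abs_self _).trans (by rw [abs_mul]; gcongr)
    have c6 : G.utilVec i x a * (xh' i a - x i a) ≤ 1 * δ :=
      (le_abs_self _).trans (by rw [abs_mul]; gcongr)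
    have e : z a * G.utilVec i x a - x i a * G.utilVec i x a =
        4 * G.lip * ((xh i a + G.rate * G.utilVec i x a - xh' i a) * (z a - xh' i a)) +
        4 * G.lip * ((xh' i a - xh i a) * (z a - xh' i a)) + G.utilVec i x a * (xh' i a - x i a) := by
      linear_combination (-(G.utilVec i x a * (z a - xh' i a))) * hr
    rw [e]
    have c7 := mul_le_mul_of_nonneg_left c5 (by positivity : (0 : ℝ) ≤ 4 * G.lip)
    have c8 := mul_le_mul_of_nonneg_right hL hδ
    linarith
  have hneg := mul_nonpos_of_nonneg_of_nonpos (by positivity : (0 : ℝ) ≤ 4 * G.lip) h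
  have hm : ∑ _a : Fin (G.m i), 9 * G.lip * δ ≤ G.lip * (9 * G.lip * δ) := by
    rw [Finset.sum_const, Finset.card_univ, Fintype.card_fin, nsmul_eq_mul]
    refine mul_le_mul_of_nonneg_right (le_trans ?_ G.maxActions_le_lip) (by positivity)
    exact_mod_cast le_maxActions i
  have : G.lip * (9 * G.lip * δ) = 9 * G.lip ^ 2 * δ := by ring
  linarith

/-- If no early iterate is an approximate equilibrium, some iterate has high welfare. -/
theorem exists_welfare {lam mu ρ : ℝ} (hs : G.Smooth lam mu) (hρ : ρ = lam / (1 + mu)) {x₀ : G.Vec}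
    (hx : x₀ ∈ G.Mixed) {δ : ℝ} (hδ : 0 ≤ δ) {T : ℕ} (hT0 : 0 < T) (hT : G.n * 16 ≤ T * δ ^ 2)
    (hno : ∀ t < T, ¬ G.IsNash (9 * G.lip ^ 2 * δ) (G.ogd G.rate x₀ (t + 1))) :
    ∃ t < T, ρ * G.opt + G.lip * δ ^ 2 / (4 * (1 + mu)) ≤ G.sw (G.ogd G.rate x₀ (t + 1)) := by
  obtain ⟨-, hmu, xs, hxs, -, hsm⟩ := hs
  have hL := G.one_le_lip
  have hr : G.rate * (4 * G.lip) = 1 := by rw [rate]; field_simp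
  let R : ℕ → ℝ := fun t => ∑ i, (G.util i (Function.update (G.ogd G.rate x₀ (t + 1)) i (xs i)) -
      G.util i (G.ogd G.rate x₀ (t + 1)))
  have hstep : ∀ t < T, G.rate * R t ≤ G.potential G.rate x₀ xs t -
      G.potential G.rate x₀ xs (t + 1) - 1 / 8 * δ ^ 2 := fun t ht => by
    have h1 := regret_step hx hxs t
    have h2 : δ ^ 2 < G.movement G.rate x₀ t :=
      not_le.1 fun hc => hno t ht (isNash_of_movement_le hx t hδ hc)
    simp only [R]
    linarith
  -- The potential telescopes to at most n, and `hT` says that n is at most half of the total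
  -- negative term `T * δ ^ 2 / 8`.
  have hsum : ∑ t ∈ Finset.range T, G.rate * R t ≤ ∑ _t ∈ Finset.range T, -(δ ^ 2 / 16) := by
    refine (Finset.sum_le_sum fun t ht => hstep t (Finset.mem_range.1 ht)).trans ?_
    rw [Finset.sum_sub_distrib, Finset.sum_range_sub']
    simp only [Finset.sum_const, Finset.card_range, nsmul_eq_mul]
    have h1 := potential_zero_le (η := G.rate) hx hxs
    have h2 := G.potential_nonneg G.rate x₀ xs T
    linarith
  obtain ⟨t, ht, hle⟩ := Finset.exists_le_of_sum_le ⟨0, Finset.mem_range.2 hT0⟩ hsum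
  refine ⟨t, Finset.mem_range.1 ht, ?_⟩
  have h1 := hsm _ (ogdState_mem (η := G.rate) hx (t + 1)).2
  change _ ≤ ∑ i, G.util i (Function.update (G.ogd G.rate x₀ (t + 1)) i (xs i)) at h1
  have h2 : R t ≤ -(G.lip * δ ^ 2 / 4) := by
    have := mul_le_mul_of_nonneg_left hle (by positivity : (0 : ℝ) ≤ 4 * G.lip)
    have e : 4 * G.lip * (G.rate * R t) = R t := by linear_combination R t * hr
    linarith
  simp only [R, Finset.sum_sub_distrib] at h2
  have h3 : (0 : ℝ) < 1 + mu := by linarith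
  -- Smoothness at this iterate gives `lam * opt - mu * sw ≤ sw + R t`; solving for `sw` divides the
  -- gain by `1 + mu`.
  have e1 : ρ * G.opt + G.lip * δ ^ 2 / (4 * (1 + mu)) =
      (lam * G.opt + G.lip * δ ^ 2 / 4) / (1 + mu) := by
    rw [hρ]
    field_simp
  rw [e1, div_le_iff₀ h3]
  have h4 : G.sw (G.ogd G.rate x₀ (t + 1)) = ∑ i, G.util i (G.ogd G.rate x₀ (t + 1)) := rfl
  have h5 : (G.ogdState G.rate x₀ (t + 1)).2 = G.ogd G.rate x₀ (t + 1) := rfl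
  rw [h5] at h1
  linarith

end Game

/-! ### Optimistic gradient descent in fixed-point arithmetic -/

section IntegerProjection

variable {k : ℕ}

/-- The number of entries of `V` that are at least `V a`. -/
def upperCount (V : Fin k → ℤ) (a : Fin k) : ℤ := ∑ b, if V a ≤ V b then 1 else 0

/-- The sum of the entries of `V` that are at least `V a`. -/
def upperSum (V : Fin k → ℤ) (a : Fin k) : ℤ := ∑ b, if V a ≤ V b then V b else 0

/-- The threshold of the projection to the simplex of mass `D`, if the support consists of the
entries that are at least `V a`; rounded up. -/
def threshold (D : ℤ) (V : Fin k → ℤ) (a : Fin k) : ℤ :=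
  -Int.fdiv (D - upperSum V a) (upperCount V a)

/-- The true support maximizes the candidate threshold among the upper sets, so taking the maximum
replaces sorting. -/
def maxThreshold (hk : 0 < k) (D : ℤ) (V : Fin k → ℤ) : ℤ :=
  threshold D V (Computes.argmax hk (threshold D V))

def truncation (hk : 0 < k) (D : ℤ) (V : Fin k → ℤ) (a : Fin k) : ℤ :=
  max (V a - maxThreshold hk D V) 0

/-- Rounding the threshold up removes too much mass; by `deficit_nonneg` and `deficit_le` the loss
lies between 0 and `k` units. -/
def deficit (hk : 0 < k) (D : ℤ) (V : Fin k → ℤ) : ℤ := D - ∑ a, truncation hk D V a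

/-- Projection to the simplex of mass `D` in integer arithmetic. -/
def intProj (hk : 0 < k) (D : ℤ) (V : Fin k → ℤ) (a : Fin k) : ℤ :=
  truncation hk D V a + if (a : ℕ) = Computes.argmax hk V then deficit hk D V else 0

variable {D : ℤ} {V : Fin k → ℤ}

theorem upperCount_pos (a : Fin k) : 0 < upperCount V a := by
  refine Finset.sum_pos' (fun b _ => by split_ifs <;> simp) ⟨a, Finset.mem_univ a, by simp⟩

theorem upperCount_le (a : Fin k) : upperCount V a ≤ k := by
  refine (Finset.sum_le_sum (g := fun _ => (1 : ℤ)) fun b _ => ?_).trans (by simp)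
  split_ifs <;> simp

theorem le_threshold_mul (a : Fin k) : upperSum V a - D ≤ threshold D V a * upperCount V a := by
  have hc := upperCount_pos (V := V) a
  rw [threshold, Int.fdiv_eq_ediv_of_nonneg _ hc.le]
  have := Int.ediv_mul_le (D - upperSum V a) hc.ne'
  linarith

theorem threshold_mul_lt (a : Fin k) :
    (threshold D V a - 1) * upperCount V a < upperSum V a - D := by
  have hc := upperCount_pos (V := V) a
  rw [threshold, Int.fdiv_eq_ediv_of_nonneg _ hc.le]
  have := Int.lt_ediv_add_one_mul_self (D - upperSum V a) hc
  linarith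

/-- An average of entries at most `m`, lowered by a share of `D`, stays below `m`. Hence the largest
entry is never strictly below the threshold, and the deficit may be returned there without violating
complementary slackness. -/
theorem threshold_le {m : ℤ} (hD : 0 ≤ D) (hm : ∀ b, V b ≤ m) (a : Fin k) :
    threshold D V a ≤ m := by
  have hc := upperCount_pos (V := V) a
  have h1 := threshold_mul_lt (D := D) (V := V) a
  have h2 : upperSum V a ≤ m * upperCount V a := by
    rw [upperSum, upperCount, Finset.mul_sum]
    refine Finset.sum_le_sum fun b _ => ?_
    split_ifs
    · simpa using hm b
    · simp
  by_contra! hlt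
  nlinarith

/-- At the maximizing candidate, dropping the cutoff at 0 outside its upper set only lowers the sum,
and rounding the threshold loses less than one unit per counted entry. -/
theorem sum_truncation_ge (hk : 0 < k) : D - k ≤ ∑ a, truncation hk D V a := by
  set a := Computes.argmax hk (threshold D V)
  have h1 := threshold_mul_lt (D := D) (V := V) a
  have h2 := upperCount_le (V := V) a
  have h3 : upperSum V a - threshold D V a * upperCount V a ≤ ∑ a, truncation hk D V a := by
    rw [upperSum, upperCount, Finset.mul_sum, ← Finset.sum_sub_distrib]
    refine Finset.sum_le_sum fun b _ => ?_
    simp only [truncation, maxThreshold]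
    split_ifs
    · exact (le_of_eq (by ring)).trans (le_max_left _ _)
    · simp
  linarith

/-- The entries above the threshold form the upper set of the smallest of them, and the threshold is
at least the candidate belonging to that set. -/
theorem sum_truncation_le (hk : 0 < k) (hD : 0 ≤ D) : ∑ a, truncation hk D V a ≤ D := by
  set τ := maxThreshold hk D V with hτ
  by_cases hne : (Finset.univ.filter fun b => τ < V b).Nonempty
  · obtain ⟨a, ha, hmin⟩ := Finset.exists_min_image _ V hne
    simp only [Finset.mem_filter, Finset.mem_univ, true_and] at ha hmin
    have hc := upperCount_pos (V := V) a
    have h1 : threshold D V a ≤ τ := Computes.le_argmax hk _ a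
    have h2 := le_threshold_mul (D := D) (V := V) a
    have h3 : ∑ a, truncation hk D V a = upperSum V a - τ * upperCount V a := by
      rw [upperSum, upperCount, Finset.mul_sum, ← Finset.sum_sub_distrib]
      refine Finset.sum_congr rfl fun b _ => ?_
      simp only [truncation, ← hτ]
      split_ifs with h
      · rw [max_eq_left (by linarith)]
        ring
      · have : ¬ τ < V b := fun hb => h (hmin b hb)
        rw [max_eq_right (by linarith)]
        ring
    nlinarith
  · rw [Finset.not_nonempty_iff_eq_empty, Finset.filter_eq_empty_iff] at hne
    rw [Finset.sum_eq_zero fun b _ => ?_]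
    · exact hD
    · have := hne (Finset.mem_univ b)
      simp only [truncation, ← hτ]
      rw [max_eq_right (by linarith)]

theorem deficit_nonneg (hk : 0 < k) (hD : 0 ≤ D) : 0 ≤ deficit hk D V :=
  sub_nonneg.2 (sum_truncation_le hk hD)

theorem deficit_le (hk : 0 < k) : deficit hk D V ≤ k := by
  have := sum_truncation_ge (D := D) (V := V) hk
  rw [deficit]
  linarith

theorem intProj_nonneg (hk : 0 < k) (hD : 0 ≤ D) (a : Fin k) : 0 ≤ intProj hk D V a := by
  have h1 := deficit_nonneg (V := V) hk hD
  have h2 : 0 ≤ truncation hk D V a := le_max_right _ _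
  rw [intProj]
  split_ifs <;> linarith

theorem sum_intProj (hk : 0 < k) : ∑ a, intProj hk D V a = D := by
  simp only [intProj, Finset.sum_add_distrib, Fin.val_inj, Finset.sum_ite_eq', Finset.mem_univ,
    if_true, deficit]
  ring

theorem mem_stdSimplex_of_int {X : Fin k → ℤ} (hD : 0 < D) (h0 : ∀ a, 0 ≤ X a)
    (hs : ∑ a, X a = D) : (fun a => (X a : ℝ) / D) ∈ stdSimplex ℝ (Fin k) := by
  have hD' : (0 : ℝ) < D := by exact_mod_cast hD
  refine ⟨fun a => div_nonneg (by exact_mod_cast h0 a) hD'.le, ?_⟩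
  rw [← Finset.sum_div, ← Int.cast_sum, hs, div_self hD'.ne']

/-- The integer projection is the exact projection of a nearby point. -/
theorem intProj_isSimplexProj (hk : 0 < k) (hD : 0 < D) :
    IsSimplexProj (fun a => (V a + if a = Computes.argmax hk V then deficit hk D V else 0 : ℝ) / D)
      (fun a => (intProj hk D V a : ℝ) / D) := by
  have hD' : (0 : ℝ) < D := by exact_mod_cast hD
  have hmem : (fun a => (intProj hk D V a : ℝ) / D) ∈ stdSimplex ℝ (Fin k) :=
    mem_stdSimplex_of_int hD (intProj_nonneg hk hD.le) (sum_intProj hk)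
  refine isSimplexProj_of_inner_le hmem fun z hz => ?_
  set τ := maxThreshold hk D V with hτ
  set s := Computes.argmax hk V with hs
  have hmax : τ ≤ V s := threshold_le hD.le (Computes.le_argmax hk V) _
  -- Complementary slackness: the residual is the constant `τ / D` plus a nonpositive term that
  -- vanishes wherever the projected point is positive. The constant drops out on summation, since
  -- both points have mass 1.
  have key : ∀ a, ((V a + if a = s then deficit hk D V else 0 : ℝ) / D -
      (intProj hk D V a : ℝ) / D) * (z a - (intProj hk D V a : ℝ) / D) ≤
      (τ : ℝ) / D * (z a - (intProj hk D V a : ℝ) / D) := by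
    intro a
    have e : ((V a + if a = s then deficit hk D V else 0 : ℝ) / D - (intProj hk D V a : ℝ) / D) =
        ((τ + min (V a - τ) 0 : ℤ) : ℝ) / D := by
      rw [← sub_div]
      congr 1
      have : V a + (if a = s then deficit hk D V else 0) - intProj hk D V a =
          τ + min (V a - τ) 0 := by
        simp only [intProj, truncation, ← hτ, Fin.val_inj, ← hs]
        rcases le_total (V a - τ) 0 with h | h
        · rw [max_eq_right h, min_eq_left h]
          ring
        · rw [max_eq_left h, min_eq_right h]
          ring
      rw [← this]
      push_cast
      rfl
    have hz0 := hz.1 a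
    -- At `s` the truncated mass may be zero while the deficit is not; there the first factor
    -- vanishes by `hmax`.
    have hprod : min (V a - τ) 0 * intProj hk D V a = 0 := by
      by_cases has : a = s
      · rw [has, min_eq_right (by linarith), zero_mul]
      · simp only [intProj, truncation, ← hτ, Fin.val_inj, ← hs, has, if_false, add_zero]
        rcases le_total (V a - τ) 0 with h | h
        · rw [max_eq_right h, mul_zero]
        · rw [min_eq_right h, zero_mul]
    have hprod' : ((min (V a - τ) 0 : ℤ) : ℝ) * (intProj hk D V a : ℝ) = 0 := by
      exact_mod_cast hprod
    have hneg : ((min (V a - τ) 0 : ℤ) : ℝ) ≤ 0 := by exact_mod_cast min_le_right _ _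
    have e2 : ((τ + min (V a - τ) 0 : ℤ) : ℝ) / D * (z a - (intProj hk D V a : ℝ) / D) =
        (τ : ℝ) / D * (z a - (intProj hk D V a : ℝ) / D) +
        ((min (V a - τ) 0 : ℤ) : ℝ) * z a / D -
        ((min (V a - τ) 0 : ℤ) : ℝ) * (intProj hk D V a : ℝ) / (D * D) := by
      rw [Int.cast_add]
      field_simp
      ring
    rw [e, e2, hprod']
    have := div_nonpos_of_nonpos_of_nonneg (mul_nonpos_of_nonpos_of_nonneg hneg hz0) hD'.le
    simp only [zero_div, sub_zero]
    linarith
  refine (Finset.sum_le_sum fun a _ => key a).trans (le_of_eq ?_)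
  rw [← Finset.mul_sum, Finset.sum_sub_distrib, hz.2, hmem.2, sub_self, mul_zero]

theorem abs_intProj_sub_le (hk : 0 < k) (hD : 0 < D) {v : Fin k → ℝ} {e : ℝ}
    (h : ∀ a, |(V a : ℝ) / D - v a| ≤ e) (a : Fin k) :
    |(intProj hk D V a : ℝ) / D - simplexProj hk v a| ≤ k * (e + k / D) := by
  have hD' : (0 : ℝ) < D := by exact_mod_cast hD
  refine (intProj_isSimplexProj hk hD).abs_sub_le (simplexProj_spec hk v) (fun b => ?_) a
  have h1 := abs_le.1 (h b)
  have h2 : (0 : ℝ) ≤ deficit hk D V := by exact_mod_cast deficit_nonneg hk hD.le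
  have h3 : (deficit hk D V : ℝ) ≤ k := by exact_mod_cast deficit_le hk
  have h4 : (0 : ℝ) ≤ ((if b = Computes.argmax hk V then deficit hk D V else 0 : ℤ) : ℝ) / D ∧
      ((if b = Computes.argmax hk V then deficit hk D V else 0 : ℤ) : ℝ) / D ≤ k / D := by
    split_ifs
    · exact ⟨div_nonneg h2 hD'.le, by gcongr⟩
    · exact ⟨by simp, by rw [Int.cast_zero, zero_div]; positivity⟩
  rw [add_div, abs_le]
  constructor <;> linarith [h4.1, h4.2]

end IntegerProjection

namespace Game

/-- Tuples of integer vectors. -/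
abbrev IntVec (G : Game) : Type := ∀ i : Fin G.n, Fin (G.m i) → ℤ

variable {G : Game} {D : ℤ}

/-- The real tuple with numerators `X` and denominator `D`. -/
def scaled (D : ℤ) (X : G.IntVec) : G.Vec := fun i a => (X i a : ℝ) / D

/-- `X` is a mixed profile of mass `D`. -/
def IntMixed (D : ℤ) (X : G.IntVec) : Prop := ∀ i, (∀ a, 0 ≤ X i a) ∧ ∑ a, X i a = D

theorem IntMixed.scaled_mem {X : G.IntVec} (h : IntMixed D X) (hD : 0 < D) :
    scaled D X ∈ G.Mixed := fun i => mem_stdSimplex_of_int hD (h i).1 (h i).2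

def pureUpdate (D : ℤ) (X : G.IntVec) (i : Fin G.n) (a : Fin (G.m i)) : G.IntVec :=
  Function.update X i (Pi.single a D)

theorem IntMixed.pureUpdate {X : G.IntVec} (h : IntMixed D X) (hD : 0 < D) (i : Fin G.n)
    (a : Fin (G.m i)) : IntMixed D (pureUpdate D X i a) := by
  intro j
  by_cases hj : j = i
  · subst hj
    simp only [Game.pureUpdate, Function.update_self]
    refine ⟨fun b => ?_, by simp⟩
    by_cases hb : b = a
    · subst hb
      simpa using hD.le
    · simp [hb]
  · simp only [Game.pureUpdate, Function.update_of_ne hj]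
    exact h j

theorem scaled_pureUpdate (hD : D ≠ 0) (X : G.IntVec) (i : Fin G.n) (a : Fin (G.m i)) :
    scaled D (pureUpdate D X i a) = Function.update (scaled D X) i (Pi.single a 1) := by
  funext j
  by_cases hj : j = i
  · subst hj
    funext b
    by_cases hb : b = a
    · subst hb
      simp [scaled, pureUpdate, hD]
    · simp [scaled, pureUpdate, hb]
  · funext b
    simp [scaled, pureUpdate, hj]

/-- Utilities in fixed-point arithmetic. -/
def intUtil (D : ℤ) (i : Fin G.n) (X : G.IntVec) : ℤ := ⌊(D : ℝ) * G.util i (scaled D X)⌋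

def intUtilVec (D : ℤ) (i : Fin G.n) (X : G.IntVec) (a : Fin (G.m i)) : ℤ :=
  intUtil D i (pureUpdate D X i a)

theorem intUtilVec_eq (hD : D ≠ 0) (i : Fin G.n) (X : G.IntVec) (a : Fin (G.m i)) :
    intUtilVec D i X a = ⌊(D : ℝ) * G.utilVec i (scaled D X) a⌋ := by
  rw [intUtilVec, intUtil, scaled_pureUpdate hD, utilVec]

/-- `4 L` -/
def fourLip (G : Game) : ℤ := 4 * (G.n * G.maxActions)

theorem fourLip_cast : (G.fourLip : ℝ) = 4 * G.lip := by
  rw [fourLip, lip_eq]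
  push_cast
  ring

def intAscent (D : ℤ) (Xh X : G.IntVec) : G.IntVec := fun i =>
  intProj (G.m_pos i) D fun a => Xh i a + Int.fdiv (intUtilVec D i X a) G.fourLip

theorem intAscent_mixed (hD : 0 < D) (Xh X : G.IntVec) : IntMixed D (intAscent D Xh X) :=
  fun i => ⟨intProj_nonneg (G.m_pos i) hD.le, sum_intProj (G.m_pos i)⟩

/-- The learning rate cancels the Lipschitz constant, so the error `e₂` enters with a factor at most
1. Two roundings, of the utility and of the division by `4L`, cost `2 / D`; returning the deficit
costs at most `maxActions / D`. The projection multiplies everything by at most `maxActions`. -/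
theorem abs_intAscent_sub_le (hD : 0 < D) {Xh X : G.IntVec} (hX : IntMixed D X) {xh x : G.Vec}
    (hx : x ∈ G.Mixed) {e₁ e₂ : ℝ} (h1 : ∀ i a, |scaled D Xh i a - xh i a| ≤ e₁)
    (h2 : ∀ i a, |scaled D X i a - x i a| ≤ e₂) (i : Fin G.n) (a : Fin (G.m i)) :
    |scaled D (intAscent D Xh X) i a - G.ascent G.rate xh x i a| ≤
      G.maxActions * (e₁ + e₂ + (2 + G.maxActions) / D) := by
  have hD' : (0 : ℝ) < D := by exact_mod_cast hD
  have hL := G.one_le_lip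
  have hm : (G.m i : ℝ) ≤ G.maxActions := by exact_mod_cast le_maxActions i
  have he1 : 0 ≤ e₁ := (abs_nonneg _).trans (h1 i a)
  have he2 : 0 ≤ e₂ := (abs_nonneg _).trans (h2 i a)
  have hF : (0 : ℤ) < G.fourLip := by
    have : (0 : ℝ) < G.fourLip := by rw [fourLip_cast]; positivity
    exact_mod_cast this
  have hkey : ∀ b, |((Xh i b + Int.fdiv (intUtilVec D i X b) G.fourLip : ℤ) : ℝ) / D -
      (xh i b + G.rate * G.utilVec i x b)| ≤ e₁ + e₂ + 2 / D := by
    intro b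
    have c1 := abs_le.1 (h1 i b)
    have c2 : |G.utilVec i (scaled D X) b - G.utilVec i x b| ≤ G.lip * e₂ :=
      (abs_utilVec_sub_le (hX.scaled_mem hD) hx i b).trans ((Finset.sum_le_sum fun j _ =>
        Finset.sum_le_sum fun b _ => h2 j b).trans (G.sum_const_le _ he2))
    set U := intUtilVec D i X b with hU
    set u := G.utilVec i (scaled D X) b with hu
    have hUf : U = ⌊(D : ℝ) * u⌋ := intUtilVec_eq hD.ne' i X b
    have c3 : (U : ℝ) ≤ D * u := by rw [hUf]; exact Int.floor_le _
    have c4 : (D : ℝ) * u < U + 1 := by rw [hUf]; exact Int.lt_floor_add_one _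
    set q := Int.fdiv U G.fourLip with hq
    have c5 : q * G.fourLip ≤ U := by
      rw [hq, Int.fdiv_eq_ediv_of_nonneg _ hF.le]
      exact Int.ediv_mul_le _ hF.ne'
    have c6 : U < (q + 1) * G.fourLip := by
      rw [hq, Int.fdiv_eq_ediv_of_nonneg _ hF.le]
      exact Int.lt_ediv_add_one_mul_self _ hF
    have c5' : (q : ℝ) * (4 * G.lip) ≤ U := by rw [← fourLip_cast]; exact_mod_cast c5
    have c6' : (U : ℝ) < (q + 1) * (4 * G.lip) := by rw [← fourLip_cast]; exact_mod_cast c6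
    have hr : G.rate * (4 * G.lip) = 1 := by rw [rate]; field_simp
    have hr0 : 0 < G.rate := by rw [rate]; positivity
    have c7 : (q : ℝ) / D ≤ G.rate * u := by
      rw [div_le_iff₀ hD']
      have := mul_le_mul_of_nonneg_left (c5'.trans c3) hr0.le
      have e : G.rate * (q * (4 * G.lip)) = q := by linear_combination (q : ℝ) * hr
      linarith
    have c8 : G.rate * u ≤ q / D + 2 / D := by
      rw [← add_div, le_div_iff₀ hD']
      have h9 : (D : ℝ) * u ≤ (q + 2) * (4 * G.lip) := by linarith
      have := mul_le_mul_of_nonneg_left h9 hr0.le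
      have e : G.rate * ((q + 2) * (4 * G.lip)) = q + 2 := by linear_combination ((q : ℝ) + 2) * hr
      linarith
    have c9 : |G.rate * u - G.rate * G.utilVec i x b| ≤ e₂ := by
      rw [← mul_sub, abs_mul, abs_of_pos hr0]
      have := mul_le_mul_of_nonneg_left c2 hr0.le
      have e : G.rate * (G.lip * e₂) = e₂ / 4 := by linear_combination (e₂ / 4) * hr
      linarith
    have c10 := abs_le.1 c9
    have c11 : 0 ≤ 2 / (D : ℝ) := by positivity
    simp only [scaled] at c1
    push_cast
    rw [add_div, abs_le]
    constructor <;> linarith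
  refine (abs_intProj_sub_le (G.m_pos i) hD hkey a).trans ?_
  have h5 : (G.m i : ℝ) / D ≤ G.maxActions / D := by gcongr
  have h6 : e₁ + e₂ + 2 / (D : ℝ) + G.m i / D ≤ e₁ + e₂ + (2 + G.maxActions) / D := by
    rw [add_div]
    linarith
  have h7 : 0 ≤ e₁ + e₂ + 2 / (D : ℝ) + G.m i / D := by positivity
  exact mul_le_mul hm h6 h7 (by positivity)

/-- The initialization in fixed-point arithmetic. -/
def intInit (D : ℤ) (x₀ : G.RatVec) : G.IntVec := fun i =>
  intProj (G.m_pos i) D fun a => ⌊(D : ℚ) * x₀ i a⌋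

/-- Optimistic gradient descent in fixed-point arithmetic. -/
def intState (D : ℤ) (x₀ : G.RatVec) : ℕ → G.IntVec × G.IntVec
  | 0 => (intInit D x₀, intInit D x₀)
  | t + 1 =>
    let s := intState D x₀ t
    let X := intAscent D s.1 s.2
    (intAscent D s.1 X, X)

theorem intState_mixed (hD : 0 < D) (x₀ : G.RatVec) (t : ℕ) :
    IntMixed D (intState D x₀ t).1 ∧ IntMixed D (intState D x₀ t).2 := by
  cases t with
  | zero => exact ⟨fun i => ⟨intProj_nonneg (G.m_pos i) hD.le, sum_intProj (G.m_pos i)⟩,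
      fun i => ⟨intProj_nonneg (G.m_pos i) hD.le, sum_intProj (G.m_pos i)⟩⟩
  | succ t => exact ⟨intAscent_mixed hD _ _, intAscent_mixed hD _ _⟩

/-- The given profile is its own projection, so only the floors and the deficit contribute. -/
theorem abs_intInit_sub_le (hD : 0 < D) {x₀ : G.RatVec} (hx : x₀.toReal ∈ G.Mixed) (i : Fin G.n)
    (a : Fin (G.m i)) : |scaled D (intInit D x₀) i a - x₀.toReal i a| ≤
      G.maxActions * ((1 + G.maxActions) / D) := by
  have hD' : (0 : ℝ) < D := by exact_mod_cast hD
  have hm : (G.m i : ℝ) ≤ G.maxActions := by exact_mod_cast le_maxActions i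
  have hkey : ∀ b, |((⌊(D : ℚ) * x₀ i b⌋ : ℤ) : ℝ) / D - x₀.toReal i b| ≤ 1 / D := by
    intro b
    have c1 : ((⌊(D : ℚ) * x₀ i b⌋ : ℤ) : ℝ) ≤ D * x₀.toReal i b := by
      rw [RatVec.toReal]
      exact_mod_cast Int.floor_le ((D : ℚ) * x₀ i b)
    have c2 : (D : ℝ) * x₀.toReal i b ≤ (⌊(D : ℚ) * x₀ i b⌋ : ℤ) + 1 := by
      rw [RatVec.toReal]
      exact_mod_cast (Int.lt_floor_add_one ((D : ℚ) * x₀ i b)).le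
    have e : ((⌊(D : ℚ) * x₀ i b⌋ : ℤ) : ℝ) / D - x₀.toReal i b =
        ((⌊(D : ℚ) * x₀ i b⌋ : ℤ) - D * x₀.toReal i b) / D := by
      field_simp
    rw [e, abs_div, abs_of_pos hD']
    gcongr
    rw [abs_le]
    constructor <;> linarith
  have h := abs_intProj_sub_le (G.m_pos i) hD hkey a
  rw [simplexProj_of_mem (G.m_pos i) (hx i)] at h
  refine h.trans ?_
  rw [← add_div]
  gcongr

/-- With M the largest number of actions, an error E becomes at most 3ME in the first half-step and
at most 5M²E in the second. The growth is exponential in `t`, which polynomially many bits of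
precision absorb. -/
theorem abs_intState_sub_le (hD : 0 < D) {x₀ : G.RatVec} (hx : x₀.toReal ∈ G.Mixed) (t : ℕ)
    (i : Fin G.n) (a : Fin (G.m i)) :
    |scaled D (intState D x₀ t).1 i a - (G.ogdState G.rate x₀.toReal t).1 i a| ≤
      (8 * G.maxActions ^ 2) ^ (t + 1) / D ∧
    |scaled D (intState D x₀ t).2 i a - (G.ogdState G.rate x₀.toReal t).2 i a| ≤
      (8 * G.maxActions ^ 2) ^ (t + 1) / D := by
  have hD' : (0 : ℝ) < D := by exact_mod_cast hD
  have hM := G.one_le_maxActions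
  set M : ℝ := ((G.maxActions : ℕ) : ℝ) with hMdef
  have hM2 : M ≤ M ^ 2 := by nlinarith
  induction t generalizing i a with
  | zero =>
    have h := abs_intInit_sub_le hD hx i a
    have : M * ((1 + M) / D) ≤ (8 * M ^ 2) ^ (0 + 1) / D := by
      rw [← mul_div_assoc, zero_add, pow_one]
      exact div_le_div_of_nonneg_right (by nlinarith) hD'.le
    exact ⟨h.trans this, h.trans this⟩
  | succ t ih =>
    obtain ⟨hm1, hm2⟩ := intState_mixed hD x₀ t
    obtain ⟨hm1', hm2'⟩ := intState_mixed hD x₀ (t + 1)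
    obtain ⟨ho1, ho2⟩ := ogdState_mem (η := G.rate) hx t
    obtain ⟨ho1', ho2'⟩ := ogdState_mem (η := G.rate) hx (t + 1)
    set E : ℝ := (8 * M ^ 2) ^ (t + 1) / D with hE
    have hE0 : 0 ≤ E := by positivity
    have hcE : (2 + M) / D ≤ E := by
      rw [hE]
      gcongr
      have h8 : (1 : ℝ) ≤ 8 * M ^ 2 := by nlinarith
      have := le_self_pow₀ h8 (Nat.succ_ne_zero t)
      simp only [Nat.succ_eq_add_one] at this
      nlinarith
    have hE' : (8 * M ^ 2) ^ (t + 1 + 1) / D = 8 * M ^ 2 * E := by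
      rw [hE, pow_succ]
      ring
    have hME : E ≤ M * E := le_mul_of_one_le_left hE0 hM
    have hMME : M * E ≤ M ^ 2 * E := mul_le_mul_of_nonneg_right hM2 hE0
    have s1 : ∀ i a, |scaled D (intState D x₀ (t + 1)).2 i a -
        (G.ogdState G.rate x₀.toReal (t + 1)).2 i a| ≤ 3 * (M * E) := fun i a => by
      refine (abs_intAscent_sub_le hD hm2 ho2 (fun i a => (ih i a).1)
        (fun i a => (ih i a).2) i a).trans ?_
      have : M * (E + E + (2 + M) / D) ≤ M * (E + E + E) := by gcongr
      linarith
    have s2 := abs_intAscent_sub_le hD hm2' ho2' (fun i a => (ih i a).1) s1 i a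
    rw [hE']
    refine ⟨s2.trans ?_, (s1 i a).trans (by linarith)⟩
    have : M * (E + 3 * (M * E) + (2 + M) / D) ≤ M * (E + 3 * (M * E) + E) := by gcongr
    have e : M * (E + 3 * (M * E) + E) = 2 * (M * E) + 3 * (M ^ 2 * E) := by ring
    linarith

end Game

/-! ### Selection of the output -/

namespace Game

variable {G : Game} {D : ℤ}

def intRegret (D : ℤ) (X : G.IntVec) (i : Fin G.n) (a : Fin (G.m i)) : ℤ :=
  intUtilVec D i X a - intUtil D i X

def maxRegret (D : ℤ) (X : G.IntVec) (i : Fin G.n) : ℤ :=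
  intRegret D X i (Computes.argmax (G.m_pos i) (intRegret D X i))

/-- The Nash gap in fixed-point arithmetic. -/
def intGap (D : ℤ) (X : G.IntVec) : ℤ := maxRegret D X (Computes.argmax G.n_pos (maxRegret D X))

/-- The welfare in fixed-point arithmetic. -/
def intWelfare (D : ℤ) (X : G.IntVec) : ℤ := ∑ i, intUtil D i X

theorem intUtil_le (i : Fin G.n) (X : G.IntVec) :
    (intUtil D i X : ℝ) ≤ D * G.util i (scaled D X) := Int.floor_le _

theorem lt_intUtil_add_one (i : Fin G.n) (X : G.IntVec) :
    D * G.util i (scaled D X) < intUtil D i X + 1 := Int.lt_floor_add_one _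

theorem intRegret_le (X : G.IntVec) (i : Fin G.n) (a : Fin (G.m i)) :
    intRegret D X i a ≤ intGap D X :=
  (Computes.le_argmax (G.m_pos i) (intRegret D X i) a).trans
    (Computes.le_argmax G.n_pos (maxRegret D X) i)

/-- Flooring the current utility can only enlarge the computed regret, and flooring the deviation
utility lowers it by less than one unit. -/
theorem isNash_of_intGap {X : G.IntVec} (hD : 0 < D) (hX : IntMixed D X) {ε : ℝ}
    (h : (intGap D X : ℝ) + 1 ≤ D * ε) : G.IsNash ε (scaled D X) := by
  have hD' : (0 : ℝ) < D := by exact_mod_cast hD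
  refine isNash_iff.2 ⟨hX.scaled_mem hD, fun i a => ?_⟩
  have h1 : (intUtilVec D i X a : ℝ) - intUtil D i X ≤ intGap D X := by
    exact_mod_cast intRegret_le X i a
  have h2 := intUtil_le (D := D) i X
  have h3 : (D : ℝ) * G.utilVec i (scaled D X) a < intUtilVec D i X a + 1 := by
    rw [intUtilVec_eq hD.ne']
    exact Int.lt_floor_add_one _
  refine le_of_mul_le_mul_left ?_ hD'
  linarith

theorem IsNash.intGap_le {X : G.IntVec} (hD : 0 < D) {ε : ℝ} (h : G.IsNash ε (scaled D X)) :
    (intGap D X : ℝ) ≤ D * ε + 1 := by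
  have hD' : (0 : ℝ) < D := by exact_mod_cast hD
  set i := Computes.argmax G.n_pos (maxRegret D X)
  set a := Computes.argmax (G.m_pos i) (intRegret D X i)
  have h0 : (intGap D X : ℝ) = intUtilVec D i X a - intUtil D i X := by
    exact_mod_cast show intGap D X = intUtilVec D i X a - intUtil D i X from rfl
  have h1 := (isNash_iff.1 h).2 i a
  have h2 := lt_intUtil_add_one (D := D) i X
  have h3 : (intUtilVec D i X a : ℝ) ≤ D * G.utilVec i (scaled D X) a := by
    rw [intUtilVec_eq hD.ne']
    exact Int.floor_le _
  have h4 := mul_le_mul_of_nonneg_left h1 hD'.le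
  rw [h0]
  linarith

theorem intWelfare_le (X : G.IntVec) : (intWelfare D X : ℝ) ≤ D * G.sw (scaled D X) := by
  rw [intWelfare, sw, Int.cast_sum, Finset.mul_sum]
  exact Finset.sum_le_sum fun i _ => intUtil_le i X

theorem le_intWelfare (X : G.IntVec) : D * G.sw (scaled D X) ≤ intWelfare D X + G.n := by
  rw [intWelfare, sw, Int.cast_sum, Finset.mul_sum]
  refine (Finset.sum_le_sum fun i _ => (lt_intUtil_add_one i X).le).trans ?_
  rw [Finset.sum_add_distrib]
  simp

theorem abs_sw_sub_le {x y : G.Vec} (hx : x ∈ G.Mixed) (hy : y ∈ G.Mixed) :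
    |G.sw x - G.sw y| ≤ G.n * ∑ j, ∑ a, |x j a - y j a| := by
  rw [sw, sw, ← Finset.sum_sub_distrib]
  refine (Finset.abs_sum_le_sum_abs _ _).trans
    ((Finset.sum_le_sum fun i _ => abs_util_sub_le hx hy i).trans ?_)
  simp

/-- The iterate `x^(t+1)` in fixed-point arithmetic. -/
def intIterate (D : ℤ) (x₀ : G.RatVec) (t : ℕ) : G.IntVec := (intState D x₀ (t + 1)).2

/-- The output of the equilibrium algorithm: a single test on this round decides whether any round
passes. -/
def leastGapIndex (D : ℤ) (x₀ : G.RatVec) {T : ℕ} (hT : 0 < T) : Fin T :=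
  Computes.argmax hT fun t => -intGap D (intIterate D x₀ t)

/-- The output of the welfare algorithm, needed only to contradict hardness on the exceptional
games. -/
def bestWelfareIndex (D : ℤ) (x₀ : G.RatVec) {T : ℕ} (hT : 0 < T) : Fin T :=
  Computes.argmax hT fun t => intWelfare D (intIterate D x₀ t)

/-- The reciprocal of the welfare gain, where `Q` bounds the number of players, the numbers of
actions and `1 + mu`, and the target accuracy is `1 / P`. -/
def gainBound (Q P : ℕ) : ℕ := 20736 * P ^ 2 * Q ^ 7

/-- The number of iterations. -/
def numIter (Q P : ℕ) : ℕ := 16 * Q * (72 * P * Q ^ 4) ^ 2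

/-- The number of bits of the common denominator. -/
def numBits (Q P : ℕ) : ℕ :=
  (3 + 2 * Q) * (numIter Q P + 1) + P + 4 * gainBound Q P * Q ^ 3

/-! ### Calibration of precision, number of rounds and welfare gain. -/

section Accuracy

variable {Q P : ℕ}

/-- The first summand of `numBits` pays for the growth over at most `numIter Q P + 1` powers of `8 *
maxActions ^ 2`; the remaining bits are the accuracy that is left. -/
theorem error_bound (hM : G.maxActions ≤ Q) {x₀ : G.RatVec}
    (hx : x₀.toReal ∈ G.Mixed) {t : ℕ} (ht : t < numIter Q P) (i : Fin G.n) (a : Fin (G.m i)) :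
    |scaled (2 ^ numBits Q P) (intIterate (2 ^ numBits Q P) x₀ t) i a -
      G.ogd G.rate x₀.toReal (t + 1) i a| ≤ (1 / 2) ^ (P + 4 * gainBound Q P * Q ^ 3) := by
  refine (abs_intState_sub_le (by positivity) hx (t + 1) i a).2.trans ?_
  have h1 : (8 * (G.maxActions : ℝ) ^ 2) ≤ 2 ^ (3 + 2 * Q) := by
    have h2 : (G.maxActions : ℝ) ≤ 2 ^ Q := by
      have : (Q : ℝ) ≤ 2 ^ Q := by exact_mod_cast (Nat.lt_two_pow_self (n := Q)).le
      exact le_trans (by exact_mod_cast hM) this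
    rw [pow_add, mul_comm 2 Q, pow_mul]
    norm_num
    gcongr
  have h3 : (8 * (G.maxActions : ℝ) ^ 2) ^ (t + 1 + 1) ≤
      2 ^ ((3 + 2 * Q) * (numIter Q P + 1)) := by
    rw [pow_mul]
    refine (pow_le_pow_left₀ (by positivity) h1 _).trans (pow_le_pow_right₀ ?_ (by omega))
    exact one_le_pow₀ (by norm_num)
  push_cast
  rw [div_le_iff₀ (by positivity), numBits, add_assoc ((3 + 2 * Q) * (numIter Q P + 1))]
  refine h3.trans (le_of_eq ?_)
  rw [pow_add (2 : ℝ), mul_left_comm, ← mul_pow]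
  norm_num

theorem error_small :
    ((1 : ℝ) / 2) ^ (P + 4 * gainBound Q P * Q ^ 3) * (4 * gainBound Q P * Q ^ 3) ≤ 1 ∧
    (4 * gainBound Q P * Q ^ 3 : ℝ) ≤ 2 ^ numBits Q P := by
  set Z := 4 * gainBound Q P * Q ^ 3 with hZ
  have hZ' : (4 * gainBound Q P * Q ^ 3 : ℝ) = Z := by rw [hZ]; push_cast; ring
  rw [hZ']
  have h1 : (Z : ℝ) ≤ 2 ^ Z := by exact_mod_cast (Nat.lt_two_pow_self (n := Z)).le
  have h2 : (2 : ℝ) ^ Z ≤ 2 ^ (P + Z) := pow_le_pow_right₀ (by norm_num) (by omega)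
  refine ⟨?_, h1.trans (pow_le_pow_right₀ (by norm_num) (by rw [numBits]; omega))⟩
  calc ((1 : ℝ) / 2) ^ (P + Z) * Z ≤ (1 / 2) ^ (P + Z) * 2 ^ (P + Z) := by
        gcongr
        exact h1.trans h2
    _ = 1 := by rw [← mul_pow]; norm_num

theorem lip_le (hn : G.n ≤ Q) (hM : G.maxActions ≤ Q) : G.lip ≤ (Q : ℝ) ^ 2 := by
  rw [lip_eq, sq]
  have h1 : (G.n : ℝ) ≤ Q := by exact_mod_cast hn
  have h2 : (G.maxActions : ℝ) ≤ Q := by exact_mod_cast hM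
  gcongr

theorem close_bound (hn : G.n ≤ Q) (hM : G.maxActions ≤ Q) {x y : G.Vec}
    {e : ℝ} (he : 0 ≤ e) (h : ∀ i a, |x i a - y i a| ≤ e) :
    ∑ j, ∑ a, |x j a - y j a| ≤ (Q : ℝ) ^ 2 * e :=
  (Finset.sum_le_sum fun i _ => Finset.sum_le_sum fun a _ => h i a).trans
    ((G.sum_const_le e he).trans (mul_le_mul_of_nonneg_right (lip_le hn hM) he))

/-- A small gap in fixed-point arithmetic certifies both the computed and the exact iterate. -/
theorem flagged_spec (hn : G.n ≤ Q) (hM : G.maxActions ≤ Q) (hP : 0 < P) {x₀ : G.RatVec}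
    (hx : x₀.toReal ∈ G.Mixed) {t : ℕ} (ht : t < numIter Q P)
    (hflag : intGap (2 ^ numBits Q P) (intIterate (2 ^ numBits Q P) x₀ t) * (2 * P) ≤
      2 ^ numBits Q P) :
    G.IsNash (1 / P) (scaled (2 ^ numBits Q P) (intIterate (2 ^ numBits Q P) x₀ t)) ∧
    G.IsNash (1 / P) (G.ogd G.rate x₀.toReal (t + 1)) := by
  have hQ : 0 < Q := G.n_pos.trans_le hn
  set K := numBits Q P with hK
  set X := intIterate (2 ^ K) x₀ t with hX
  have hD : (0 : ℤ) < 2 ^ K := by positivity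
  have hXm : IntMixed (2 ^ K) X := (intState_mixed hD x₀ (t + 1)).2
  set e : ℝ := (1 / 2) ^ (P + 4 * gainBound Q P * Q ^ 3) with he
  have he0 : 0 ≤ e := by positivity
  obtain ⟨hs1, hs2⟩ := error_small (Q := Q) (P := P)
  rw [← he] at hs1
  have herr : ∀ i a, |scaled (2 ^ K) X i a - G.ogd G.rate x₀.toReal (t + 1) i a| ≤ e :=
    error_bound hM hx ht
  have hP' : (1 : ℝ) ≤ P := by exact_mod_cast hP
  have hQ' : (1 : ℝ) ≤ Q := by exact_mod_cast hQ
  have hZ : 16 * (P : ℝ) * (Q : ℝ) ^ 2 ≤ 4 * gainBound Q P * Q ^ 3 := by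
    have : 16 * P * Q ^ 2 ≤ 4 * gainBound Q P * Q ^ 3 := by
      rw [gainBound]
      calc 16 * P * Q ^ 2 ≤ 82944 * P * (P * Q ^ 8) * Q ^ 2 := by
            have : 0 < P * Q ^ 8 := by positivity
            nlinarith [Nat.zero_le (P * Q ^ 2), Nat.mul_le_mul_left (P * Q ^ 2) this]
        _ = _ := by ring
    exact_mod_cast this
  have hQ2 : (1 : ℝ) ≤ (Q : ℝ) ^ 2 := one_le_pow₀ hQ'
  -- The test gives gap `1 / (2P)` and the floors at most `1 / (4P)` more. The remaining quarter
  -- covers the passage to the exact iterate, which costs at most `1 / (8P)`.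
  have hgap : G.IsNash (3 / 4 * (1 / P)) (scaled (2 ^ K) X) := by
    refine isNash_of_intGap hD hXm ?_
    have h1 : (intGap (2 ^ K) X : ℝ) * (2 * P) ≤ 2 ^ K := by exact_mod_cast hflag
    have h2 : (4 * P : ℝ) ≤ 2 ^ K := by
      refine le_trans ?_ (hZ.trans hs2)
      nlinarith
    push_cast
    refine le_of_mul_le_mul_right ?_ (by positivity : (0 : ℝ) < 4 * P)
    have e1 : (2 : ℝ) ^ K * (3 / 4 * (1 / P)) * (4 * P) = 3 * 2 ^ K := by field_simp
    rw [e1]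
    linarith
  have hPinv : (0 : ℝ) < 1 / P := by positivity
  refine ⟨hgap.mono (by linarith), (isNash_of_close hgap
    (ogdState_mem (η := G.rate) hx (t + 1)).2 (close_bound hn hM he0 herr)).mono ?_⟩
  have h5 : e * (16 * P * Q ^ 2) ≤ 1 := (mul_le_mul_of_nonneg_left hZ he0).trans hs1
  have h6 : (Q : ℝ) ^ 2 * e ≤ 1 / 16 * (1 / P) := by
    rw [← div_eq_mul_one_div, le_div_iff₀ (by positivity)]
    linarith
  linarith

/-- If no iterate has a small gap in fixed-point arithmetic, the computed iterate of greatest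
welfare beats the welfare guaranteed by smoothness. -/
theorem unflagged_spec (hn : G.n ≤ Q) (hM : G.maxActions ≤ Q) (hP : 0 < P) {x₀ : G.RatVec}
    (hx : x₀.toReal ∈ G.Mixed) {lam mu ρ : ℝ} (hs : G.Smooth lam mu) (hρ : ρ = lam / (1 + mu))
    (hmu : 1 + mu ≤ Q) (hT : 0 < numIter Q P)
    (hflag : ∀ t < numIter Q P,
      ¬ intGap (2 ^ numBits Q P) (intIterate (2 ^ numBits Q P) x₀ t) * (2 * P) ≤ 2 ^ numBits Q P) :
    ρ * G.opt + 1 / ((2 * gainBound Q P : ℕ) : ℝ) ≤ G.sw (scaled (2 ^ numBits Q P)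
      (intIterate (2 ^ numBits Q P) x₀ (bestWelfareIndex (2 ^ numBits Q P) x₀ hT))) := by
  have hQ : 0 < Q := G.n_pos.trans_le hn
  set K := numBits Q P with hK
  have hD : (0 : ℤ) < 2 ^ K := by positivity
  have hDR : (0 : ℝ) < 2 ^ K := by positivity
  set e : ℝ := (1 / 2) ^ (P + 4 * gainBound Q P * Q ^ 3) with he
  have he0 : 0 ≤ e := by positivity
  obtain ⟨hs1, hs2⟩ := error_small (Q := Q) (P := P)
  rw [← he] at hs1
  have herr : ∀ t < numIter Q P, ∀ i a, |scaled (2 ^ K) (intIterate (2 ^ K) x₀ t) i a -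
      G.ogd G.rate x₀.toReal (t + 1) i a| ≤ e := fun t ht => error_bound hM hx ht
  have hP' : (1 : ℝ) ≤ P := by exact_mod_cast hP
  have hQ' : (1 : ℝ) ≤ Q := by exact_mod_cast hQ
  have hL := G.one_le_lip
  have hLQ := lip_le hn hM
  have hQ2 : (1 : ℝ) ≤ (Q : ℝ) ^ 2 := one_le_pow₀ hQ'
  have hH : (gainBound Q P : ℝ) = 20736 * P ^ 2 * Q ^ 7 := by rw [gainBound]; push_cast; ring
  have hHpos : (0 : ℝ) < gainBound Q P := by rw [hH]; positivity
  have hZ : 16 * (P : ℝ) * (Q : ℝ) ^ 2 ≤ 4 * gainBound Q P * Q ^ 3 := by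
    have : 16 * P * Q ^ 2 ≤ 4 * gainBound Q P * Q ^ 3 := by
      rw [gainBound]
      calc 16 * P * Q ^ 2 ≤ 82944 * P * (P * Q ^ 8) * Q ^ 2 := by
            have : 0 < P * Q ^ 8 := by positivity
            nlinarith [Nat.zero_le (P * Q ^ 2), Nat.mul_le_mul_left (P * Q ^ 2) this]
        _ = _ := by ring
    exact_mod_cast this
  -- Chosen so that movement at most `δ ^ 2` yields a `1 / (8P)`-equilibrium.
  set δ : ℝ := 1 / (72 * P * G.lip ^ 2) with hδ
  have hδ0 : 0 < δ := by positivity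
  have hδQ : 1 / (72 * P * Q ^ 4) ≤ δ := by
    rw [hδ]
    refine one_div_le_one_div_of_le (by positivity) ?_
    have : G.lip ^ 2 ≤ ((Q : ℝ) ^ 2) ^ 2 := by gcongr
    rw [← pow_mul] at this
    gcongr
  have hε : 9 * G.lip ^ 2 * δ = 1 / 8 * (1 / P) := by rw [hδ]; field_simp; norm_num
  have hTδ : (G.n : ℝ) * 16 ≤ (numIter Q P : ℕ) * δ ^ 2 := by
    have h1 : (1 / (72 * P * Q ^ 4) : ℝ) ^ 2 ≤ δ ^ 2 := by gcongr
    have h2 : ((numIter Q P : ℕ) : ℝ) * (1 / (72 * P * Q ^ 4) : ℝ) ^ 2 = 16 * Q := by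
      rw [numIter]
      push_cast
      field_simp
    have h3 : (G.n : ℝ) ≤ Q := by exact_mod_cast hn
    have h4 := mul_le_mul_of_nonneg_left h1 (Nat.cast_nonneg (numIter Q P))
    linarith
  -- An exact `1 / (8P)`-equilibrium would make the rounded iterate a `1 / (4P)`-equilibrium, whose
  -- computed gap passes the test at `1 / (2P)` even after the floors.
  have hno : ∀ t < numIter Q P, ¬ G.IsNash (9 * G.lip ^ 2 * δ) (G.ogd G.rate x₀.toReal (t + 1)) := by
    intro t ht hN
    have hXm : IntMixed (2 ^ K) (intIterate (2 ^ K) x₀ t) := (intState_mixed hD x₀ (t + 1)).2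
    have herr' : ∀ i a, |G.ogd G.rate x₀.toReal (t + 1) i a -
        scaled (2 ^ K) (intIterate (2 ^ K) x₀ t) i a| ≤ e := fun i a => by
      rw [abs_sub_comm]
      exact herr t ht i a
    have h1 := isNash_of_close hN (hXm.scaled_mem hD) (close_bound hn hM he0 herr')
    have h5 : e * (16 * P * Q ^ 2) ≤ 1 := (mul_le_mul_of_nonneg_left hZ he0).trans hs1
    have h6 : (Q : ℝ) ^ 2 * e ≤ 1 / 16 * (1 / P) := by
      rw [← div_eq_mul_one_div, le_div_iff₀ (by positivity)]
      linarith
    have h2 : G.IsNash (1 / 4 * (1 / P)) (scaled (2 ^ K) (intIterate (2 ^ K) x₀ t)) :=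
      h1.mono (by rw [hε]; linarith)
    have h3 := h2.intGap_le hD
    refine hflag t ht ?_
    have h4 : (intGap (2 ^ K) (intIterate (2 ^ K) x₀ t) : ℝ) * (2 * P) ≤ 2 ^ K := by
      refine (mul_le_mul_of_nonneg_right h3 (by positivity)).trans ?_
      have h7 : (4 * P : ℝ) ≤ 2 ^ K := by
        refine le_trans ?_ (hZ.trans hs2)
        nlinarith
      push_cast
      have e1 : ((2 : ℝ) ^ K * (1 / 4 * (1 / P)) + 1) * (2 * P) = 1 / 2 * 2 ^ K + 2 * P := by
        field_simp
        ring
      rw [e1]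
      linarith
    exact_mod_cast h4
  obtain ⟨t, ht, hw⟩ := exists_welfare hs hρ hx hδ0.le hT hTδ hno
  set s := bestWelfareIndex (2 ^ K) x₀ hT
  have hXm : IntMixed (2 ^ K) (intIterate (2 ^ K) x₀ t) := (intState_mixed hD x₀ (t + 1)).2
  -- The constant is 20736 = 4 · 72², and the exponent 7 comes from `lip ^ 3 ≤ Q ^ 6` and one more
  -- factor for `1 + mu`.
  have hgain : 1 / (gainBound Q P : ℝ) ≤ G.lip * δ ^ 2 / (4 * (1 + mu)) := by
    have hmu0 : 0 < 1 + mu := by linarith [hs.2.1]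
    rw [div_le_div_iff₀ hHpos (by positivity), one_mul, hδ, hH]
    have e1 : G.lip * (1 / (72 * P * G.lip ^ 2)) ^ 2 * (20736 * P ^ 2 * Q ^ 7) =
        4 * (Q ^ 7 / G.lip ^ 3) := by
      field_simp
      norm_num
    rw [e1]
    have h1 : (Q : ℝ) ≤ Q ^ 7 / G.lip ^ 3 := by
      rw [le_div_iff₀ (by positivity)]
      have : G.lip ^ 3 ≤ ((Q : ℝ) ^ 2) ^ 3 := by gcongr
      calc (Q : ℝ) * G.lip ^ 3 ≤ Q * ((Q : ℝ) ^ 2) ^ 3 := by gcongr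
        _ = (Q : ℝ) ^ 7 := by ring
    linarith
  -- A quarter of the gain is given up for rounding the iterate and a quarter for comparing floored
  -- welfares; this is the factor 2 in the conclusion.
  have h1 : G.sw (G.ogd G.rate x₀.toReal (t + 1)) - 1 / 4 * (1 / gainBound Q P) ≤
      G.sw (scaled (2 ^ K) (intIterate (2 ^ K) x₀ t)) := by
    have h2 := (abs_le.1 (abs_sw_sub_le (hXm.scaled_mem hD)
      (ogdState_mem (η := G.rate) hx (t + 1)).2)).1
    have h3 := close_bound hn hM he0 (herr t ht)
    have h4 : (G.n : ℝ) * ∑ j, ∑ a, |scaled (2 ^ K) (intIterate (2 ^ K) x₀ t) j a -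
        G.ogd G.rate x₀.toReal (t + 1) j a| ≤ Q * (Q ^ 2 * e) := by
      refine mul_le_mul (by exact_mod_cast hn) h3 ?_ (by positivity)
      exact Finset.sum_nonneg fun i _ => Finset.sum_nonneg fun a _ => abs_nonneg _
    have h5 : Q * (Q ^ 2 * e) ≤ 1 / 4 * (1 / gainBound Q P) := by
      rw [← div_eq_mul_one_div, le_div_iff₀ hHpos]
      have e1 : Q * ((Q : ℝ) ^ 2 * e) * gainBound Q P =
          1 / 4 * (e * (4 * gainBound Q P * Q ^ 3)) := by ring
      rw [e1]
      linarith
    change -_ ≤ _ - G.sw (G.ogd G.rate x₀.toReal (t + 1)) at h2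
    change (G.n : ℝ) * ∑ j, ∑ a, |scaled (2 ^ K) (intIterate (2 ^ K) x₀ t) j a -
        (G.ogdState G.rate x₀.toReal (t + 1)).2 j a| ≤ Q * (Q ^ 2 * e) at h4
    linarith
  have h2 : G.sw (scaled (2 ^ K) (intIterate (2 ^ K) x₀ t)) - 1 / 4 * (1 / gainBound Q P) ≤
      G.sw (scaled (2 ^ K) (intIterate (2 ^ K) x₀ s)) := by
    have h3 : (intWelfare (2 ^ K) (intIterate (2 ^ K) x₀ t) : ℝ) ≤
        intWelfare (2 ^ K) (intIterate (2 ^ K) x₀ s) := by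
      exact_mod_cast Computes.le_argmax hT
        (fun t : Fin (numIter Q P) => intWelfare (2 ^ K) (intIterate (2 ^ K) x₀ t)) ⟨t, ht⟩
    have h4 := le_intWelfare (D := 2 ^ K) (intIterate (2 ^ K) x₀ t)
    have h5 := intWelfare_le (D := 2 ^ K) (intIterate (2 ^ K) x₀ s)
    have h6 : (G.n : ℝ) ≤ 1 / 4 * (1 / gainBound Q P) * 2 ^ K := by
      have h7 : (G.n : ℝ) ≤ Q := by exact_mod_cast hn
      have h8 : 4 * gainBound Q P * Q ^ 3 * (1 / 4 * (1 / gainBound Q P)) = (Q : ℝ) ^ 3 := by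
        field_simp
      have h9 := mul_le_mul_of_nonneg_right hs2
        (by positivity : 0 ≤ 1 / 4 * (1 / (gainBound Q P : ℝ)))
      rw [h8] at h9
      have h10 : (Q : ℝ) ≤ Q ^ 3 := le_self_pow₀ hQ' (by norm_num)
      linarith
    push_cast at h4 h5
    refine le_of_mul_le_mul_left ?_ hDR
    linarith
  have e3 : 1 / ((2 * gainBound Q P : ℕ) : ℝ) = 1 / 2 * (1 / gainBound Q P) := by
    push_cast
    field_simp
  rw [e3]
  linarith

end Accuracy

end Game

/-! ### The programs -/

namespace Computes

variable {ι : Type} {len : ι → ℕ} {env : ι → Val} {n : ι → ℕ}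

theorem iteInt {p : ι → Prop} [∀ i, Decidable (p i)] {x y : ι → ℤ}
    (hp : Computes len env fun i => .int (if p i then 1 else 0))
    (hx : Computes len env fun i => .int (x i)) (hy : Computes len env fun i => .int (y i)) :
    Computes len env fun i => .int (if p i then x i else y i) :=
  (hp.ite hx hy).congr fun i => by split_ifs <;> rfl

/-- For each entry, the count and the sum over its upper set are inner loops, indexed by pairs of
entries; no sorting program is needed. -/
theorem intProj {D : ι → ℤ} {V : ∀ i, Fin (n i) → ℤ} (h0 : ∀ i, 0 < n i)
    (hn : Computes len env fun i => .int (n i)) (hD : Computes len env fun i => .int (D i))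
    (hV : Computes len env fun i => Val.vec (V i)) :
    Computes len env fun i => Val.vec (SmoothGames.intProj (h0 i) (D i) (V i)) := by
  have hN : PolyBdd len n := bdd_length_ofFn hV
  have hV1 := weaken hN hV
  have hD1 := weaken hN hD
  have hn1 := weaken hN hn
  have hk := index hN hV.bdd_env
  have hVa : Computes _ _ fun p : Σ i, Fin (n i) => .int (V p.1 p.2) := vec_nth hV1 hk
  have hN1 : PolyBdd (fun p : Σ i, Fin (n i) => len p.1) fun p => n p.1 := hN.reindex Sigma.fst
  have hVa2 := weaken hN1 hVa
  have hVb : Computes _ _ fun q : Σ p : Σ i, Fin (n i), Fin (n p.1) => .int (V q.1.1 q.2) :=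
    vec_nth (f := fun q : Σ p : Σ i, Fin (n i), Fin (n p.1) => V q.1.1) (k := fun q => q.2)
      (weaken hN1 hV1) (index hN1 hVa.bdd_env)
  have hle := hVa2.le hVb
  have hcount : Computes _ _ fun p : Σ i, Fin (n i) => .int (upperCount (V p.1) p.2) :=
    sum (f := fun (p : Σ i, Fin (n i)) b => if V p.1 p.2 ≤ V p.1 b then 1 else 0) hN1 hn1 hle
  have hsum : Computes _ _ fun p : Σ i, Fin (n i) => .int (upperSum (V p.1) p.2) :=
    sum (f := fun (p : Σ i, Fin (n i)) b => if V p.1 p.2 ≤ V p.1 b then V p.1 b else 0) hN1 hn1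
      (hle.iteInt hVb (int hle.bdd_env 0))
  have hthr : Computes _ _ fun p : Σ i, Fin (n i) => .int (threshold (D p.1) (V p.1) p.2) :=
    ((hD1.sub hsum).fdiv hcount).neg
  have hmax : Computes len env fun i => .int (maxThreshold (h0 i) (D i) (V i)) :=
    sup (f := fun i => threshold (D i) (V i)) h0 hN hn hthr
  have htrunc : Computes _ _ fun p : Σ i, Fin (n i) =>
      .int (truncation (h0 p.1) (D p.1) (V p.1) p.2) :=
    (hVa.sub (weaken hN hmax)).max (int hVa.bdd_env 0)
  have hdef : Computes len env fun i => .int (deficit (h0 i) (D i) (V i)) :=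
    hD.sub (sum (f := fun i => truncation (h0 i) (D i) (V i)) hN hn htrunc)
  have harg := weaken hN (argmax_index (f := V) h0 hN hn hVa)
  refine vec_tabulate hN hn (htrunc.add (((hk.eqInt harg).iteInt (weaken hN hdef)
    (int hk.bdd_env 0)).congr fun p => ?_))
  simp only [Nat.cast_inj]

end Computes

/-! ### Encodings of profiles. -/

namespace Game

/-- Integer profiles as data. -/
def IntVec.val {G : Game} (X : G.IntVec) : Val := Val.list (List.ofFn fun i => Val.vec (X i))

/-- Integer profiles with a common denominator, as data. -/
def scaledVal {G : Game} (D : ℤ) (X : G.IntVec) : Val :=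
  Val.list (List.ofFn fun i => Val.list (List.ofFn fun a => .pair (.int (X i a)) (.int D)))

/-- The rational profile with numerators `X` and denominator `D`. -/
def scaledRat {G : Game} (D : ℤ) (X : G.IntVec) : G.RatVec := fun i a => (X i a : ℚ) / D

theorem scaledRat_toReal {G : Game} (D : ℤ) (X : G.IntVec) :
    (scaledRat D X).toReal = scaled D X := by
  funext i a
  simp [RatVec.toReal, scaledRat, scaled]

theorem vecRep_scaledVal {G : Game} {D : ℤ} (hD : 0 < D) (X : G.IntVec) :
    G.VecRep (scaledVal D X) (scaledRat D X) :=
  ⟨fun i a => .pair (.int (X i a)) (.int D), fun i a => ⟨X i a, D, hD, rfl, rfl⟩, rfl⟩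

theorem floor_eq_fdiv {D a b : ℤ} (hb : 0 < b) : ⌊(D : ℝ) * ((a : ℝ) / b)⌋ = Int.fdiv (D * a) b := by
  have hb' : (0 : ℝ) < b := by exact_mod_cast hb
  rw [Int.fdiv_eq_ediv_of_nonneg _ hb.le, Int.floor_eq_iff, ← mul_div_assoc, le_div_iff₀ hb',
    div_lt_iff₀ hb']
  exact ⟨by exact_mod_cast Int.ediv_mul_le (D * a) hb.ne',
    by exact_mod_cast Int.lt_ediv_add_one_mul_self (D * a) hb⟩

theorem pureUpdate_apply {G : Game} (D : ℤ) (X : G.IntVec) (i j : Fin G.n) (a : Fin (G.m i))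
    (b : Fin (G.m j)) : pureUpdate D X i a j b =
      if (j : ℕ) = i then (if (b : ℕ) = a then D else 0) else X j b := by
  by_cases hj : j = i
  · subst hj
    by_cases hb : b = a
    · subst hb
      simp [pureUpdate]
    · simp [pureUpdate, hb, Fin.val_inj]
  · simp [pureUpdate, hj, Fin.val_inj]

end Game

open Game

section Programs

variable {C : GameClass} {ι : Type} {w : ι → C.inst} {env : ι → Val}

/-- The lengths of the instances. -/
abbrev instLen (w : ι → C.inst) (i : ι) : ℕ := (w i).1.length

/-- The games of the instances. -/
abbrev instGame (w : ι → C.inst) (i : ι) : Game := C.game (w i).1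

theorem bdd_bits (w : ι → C.inst) : PolyBdd (instLen w) fun i => (Val.bits (w i).1).size := by
  refine ((PolyBdd.const 2).add (PolyBdd.self.mul (.const 3))).mono fun i => ?_
  refine (Val.size_list_le (B := 2) _ ?_).trans (by simp)
  intro v hv
  obtain ⟨b, -, rfl⟩ := List.mem_map.1 hv
  cases b <;> decide

/-- A specification need not determine the output. Choosing an actual output for every index gives a
definite family that `Computes` can speak of. -/
theorem computes_of_halts {x : ι → Val} {P : Prog} {len : ι → ℕ} {f : ι → ℕ}
    {R : ι → Val → Prop} (hf : PolyBdd len f) (h : ∀ i, HaltsWithin P (x i) (f i) (R i)) :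
    ∃ y : ι → Val, Computes len x y ∧ ∀ i, R i (y i) := by
  choose y t ht hle hR using h
  exact ⟨y, .of_cost hf fun i => ⟨t i, ht i, hle i⟩, hR⟩

theorem computes_len (hw : Computes (instLen w) env fun i => Val.bits (w i).1) :
    Computes (instLen w) env fun i => .int (instLen w i) :=
  (Computes.length hw).congr fun i => by simp

/-- The numbers of players. -/
abbrev players (w : ι → C.inst) (i : ι) : ℕ := (instGame w i).n

/-- The numbers of actions. -/
abbrev playerActions (w : ι → C.inst) (p : Σ i, Fin (players w i)) : ℕ := (instGame w p.1).m p.2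

/-- The environment in a loop over the players. -/
abbrev playerEnv (w : ι → C.inst) (env : ι → Val) : (Σ i, Fin (players w i)) → Val :=
  Computes.loopEnv env (players w)

/-- The environment in a loop over the actions inside a loop over the players. -/
abbrev actionEnv (w : ι → C.inst) (env : ι → Val) :
    (Σ p : Σ i, Fin (players w i), Fin (playerActions w p)) → Val :=
  Computes.loopEnv (playerEnv w env) (playerActions w)

theorem computes_actions (htype : C.PolynomialType)
    (hw : Computes (instLen w) env fun i => Val.bits (w i).1) :
    Computes (instLen w) env
      fun i => Val.list (List.ofFn fun j => .int ((instGame w i).m j)) := by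
  obtain ⟨P, q, h⟩ := htype
  obtain ⟨y, hy, hR⟩ := computes_of_halts (len := instLen w) (f := fun i => q.eval (instLen w i))
    (.poly q .self) fun i => (h _ (w i).2).2
  exact (hy.congr hR).comp hw

theorem computes_players (htype : C.PolynomialType)
    (hw : Computes (instLen w) env fun i => Val.bits (w i).1) :
    Computes (instLen w) env fun i => .int (players w i) :=
  Computes.length_ofFn (computes_actions htype hw)

theorem bdd_players (htype : C.PolynomialType) (w : ι → C.inst) :
    PolyBdd (instLen w) (players w) :=
  Computes.bdd_length_ofFn (computes_actions htype (.id (bdd_bits w)))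

theorem bdd_playerActions (htype : C.PolynomialType) (w : ι → C.inst) :
    PolyBdd (fun p : Σ i, Fin (players w i) => instLen w p.1) (playerActions w) := by
  obtain ⟨P, q, h⟩ := htype
  exact ⟨q, fun p => (Finset.single_le_sum (f := (instGame w p.1).m) (fun _ _ => Nat.zero_le _)
    (Finset.mem_univ p.2)).trans (h _ (w p.1).2).1⟩

theorem computes_playerActions (htype : C.PolynomialType)
    (hw : Computes (instLen w) env fun i => Val.bits (w i).1) :
    Computes (fun p : Σ i, Fin (players w i) => instLen w p.1) (playerEnv w env)
      fun p => .int (playerActions w p) :=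
  Computes.nth (n := fun p : Σ i, Fin (players w i) => players w p.1)
    (f := fun p j => Val.int ((instGame w p.1).m j)) (k := fun p => p.2)
    (Computes.weaken (bdd_players htype w) (computes_actions htype hw))
    (Computes.index (bdd_players htype w) hw.bdd_env)

theorem computes_maxActions (htype : C.PolynomialType)
    (hw : Computes (instLen w) env fun i => Val.bits (w i).1) :
    Computes (instLen w) env fun i => .int (instGame w i).maxActions := by
  refine (Computes.sup (f := fun i (j : Fin (players w i)) => (((instGame w i).m j : ℕ) : ℤ))
    (fun i => (instGame w i).n_pos) (bdd_players htype w) (computes_players htype hw)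
    (computes_playerActions htype hw)).congr fun i => ?_
  congr 2
  refine le_antisymm (le_maxActions _) (Finset.sup_le fun j _ => ?_)
  exact_mod_cast Computes.le_argmax (instGame w i).n_pos
    (fun j => (((instGame w i).m j : ℕ) : ℤ)) j

theorem computes_fourLip (htype : C.PolynomialType)
    (hw : Computes (instLen w) env fun i => Val.bits (w i).1) :
    Computes (instLen w) env fun i => .int (instGame w i).fourLip :=
  (Computes.int hw.bdd_env 4).mul ((computes_players htype hw).mul (computes_maxActions htype hw))

theorem computes_entry {X : ∀ i, (instGame w i).IntVec}
    (hX : Computes (instLen w) env fun i => (X i).val) {k : ∀ i, Fin (players w i)}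
    (hk : Computes (instLen w) env fun i => .int (k i : ℕ)) {a : ∀ i, Fin ((instGame w i).m (k i))}
    (ha : Computes (instLen w) env fun i => .int (a i : ℕ)) :
    Computes (instLen w) env fun i => .int (X i (k i) (a i)) :=
  Computes.vec_nth (f := fun i => X i (k i)) (Computes.nth (f := fun i j => Val.vec (X i j)) hX hk) ha

theorem weaken_player (htype : C.PolynomialType) {x : ι → Val} (h : Computes (instLen w) env x) :
    Computes (fun p : Σ i, Fin (players w i) => instLen w p.1) (playerEnv w env) fun p => x p.1 :=
  Computes.weaken (bdd_players htype w) h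

theorem weaken_action (htype : C.PolynomialType) {x : ι → Val} (h : Computes (instLen w) env x) :
    Computes (fun q : Σ p : Σ i, Fin (players w i), Fin (playerActions w p) => instLen w q.1.1)
      (actionEnv w env) fun q => x q.1.1 :=
  Computes.weaken (bdd_playerActions htype w) (weaken_player htype h)

theorem computes_player_index (htype : C.PolynomialType)
    (hw : Computes (instLen w) env fun i => Val.bits (w i).1) :
    Computes (fun q : Σ p : Σ i, Fin (players w i), Fin (playerActions w p) => instLen w q.1.1)
      (actionEnv w env) fun q => .int (q.1.2 : ℕ) :=
  Computes.weaken (bdd_playerActions htype w) (Computes.index (bdd_players htype w) hw.bdd_env)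

theorem computes_action_index (htype : C.PolynomialType)
    (hw : Computes (instLen w) env fun i => Val.bits (w i).1) :
    Computes (fun q : Σ p : Σ i, Fin (players w i), Fin (playerActions w p) => instLen w q.1.1)
      (actionEnv w env) fun q => .int (q.2 : ℕ) :=
  Computes.index (bdd_playerActions htype w) (weaken_player htype hw).bdd_env

theorem computes_tabulate (htype : C.PolynomialType)
    (hw : Computes (instLen w) env fun i => Val.bits (w i).1)
    {f : ∀ i (j : Fin (players w i)), Fin ((instGame w i).m j) → Val}
    (hf : Computes
      (fun q : Σ p : Σ i, Fin (players w i), Fin (playerActions w p) => instLen w q.1.1)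
      (actionEnv w env) fun q => f q.1.1 q.1.2 q.2) :
    Computes (instLen w) env fun i => Val.list (List.ofFn fun j => Val.list (List.ofFn (f i j))) :=
  Computes.tabulate (f := fun i j => Val.list (List.ofFn (f i j))) (bdd_players htype w)
    (computes_players htype hw)
    (Computes.tabulate (f := fun (p : Σ i, Fin (players w i)) => f p.1 p.2)
      (bdd_playerActions htype w) (computes_playerActions htype hw) hf)

theorem computes_scaledVal (htype : C.PolynomialType)
    (hw : Computes (instLen w) env fun i => Val.bits (w i).1) {D : ι → ℤ}
    {X : ∀ i, (instGame w i).IntVec} (hD : Computes (instLen w) env fun i => .int (D i))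
    (hX : Computes (instLen w) env fun i => (X i).val) :
    Computes (instLen w) env fun i => scaledVal (D i) (X i) :=
  computes_tabulate htype hw (f := fun i j a => .pair (.int (X i j a)) (.int (D i)))
    ((computes_entry (w := fun q : Σ p : Σ i, Fin (players w i), Fin (playerActions w p) => w q.1.1)
      (X := fun q => X q.1.1) (weaken_action htype hX) (k := fun q => q.1.2)
      (computes_player_index htype hw) (a := fun q => q.2)
      (computes_action_index htype hw)).pair (weaken_action htype hD))

/-- The expectation program may return any fraction for the utility; the floor depends only on its
value, so the result is a well-defined integer. -/
theorem computes_intUtil (htype : C.PolynomialType) (hexp : C.PolynomialExpectation)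
    (hw : Computes (instLen w) env fun i => Val.bits (w i).1) {D : ι → ℤ}
    {X : ∀ i, (instGame w i).IntVec} (hD0 : ∀ i, 0 < D i) (hXm : ∀ i, IntMixed (D i) (X i))
    (hD : Computes (instLen w) env fun i => .int (D i))
    (hX : Computes (instLen w) env fun i => (X i).val) {k : ∀ i, Fin (players w i)}
    (hk : Computes (instLen w) env fun i => .int (k i : ℕ)) :
    Computes (instLen w) env fun i => .int (intUtil (D i) (k i) (X i)) := by
  obtain ⟨E, q, h⟩ := hexp
  have hv := computes_scaledVal htype hw hD hX
  obtain ⟨y, hy, hR⟩ := computes_of_halts (len := instLen w)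
    (f := fun i => q.eval (instLen w i + (scaledVal (D i) (X i)).size))
    (.poly q (PolyBdd.self.add hv.bdd)) fun i => h _ (w i).2 (k i) (scaledRat (D i) (X i)) _
      (by rw [scaledRat_toReal]; exact (hXm i).scaled_mem (hD0 i)) (vecRep_scaledVal (hD0 i) (X i))
  choose r hr hru using hR
  choose a b hb hyab hrab using hr
  have hy' := (hy.comp (hw.pair (hk.pair hv))).congr hyab
  refine ((hD.mul hy'.fst).fdiv hy'.snd).congr fun i => ?_
  have : (instGame w i).util (k i) (scaled (D i) (X i)) = (a i : ℝ) / b i := by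
    rw [← scaledRat_toReal, ← hru i, hrab i]
    push_cast
    rfl
  rw [intUtil, this, floor_eq_fdiv (hb i)]

theorem computes_pureUpdate (htype : C.PolynomialType)
    (hw : Computes (instLen w) env fun i => Val.bits (w i).1) {D : ι → ℤ}
    {X : ∀ i, (instGame w i).IntVec} (hD : Computes (instLen w) env fun i => .int (D i))
    (hX : Computes (instLen w) env fun i => (X i).val) {k : ∀ i, Fin (players w i)}
    (hk : Computes (instLen w) env fun i => .int (k i : ℕ)) {a : ∀ i, Fin ((instGame w i).m (k i))}
    (ha : Computes (instLen w) env fun i => .int (a i : ℕ)) :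
    Computes (instLen w) env fun i => (pureUpdate (D i) (X i) (k i) (a i)).val := by
  refine computes_tabulate htype hw
    (f := fun i j b => .int (pureUpdate (D i) (X i) (k i) (a i) j b)) ?_
  have hj := computes_player_index htype hw
  have hb := computes_action_index htype hw
  have hXjb := computes_entry
    (w := fun q : Σ p : Σ i, Fin (players w i), Fin (playerActions w p) => w q.1.1)
    (X := fun q => X q.1.1) (weaken_action htype hX) (k := fun q => q.1.2) hj (a := fun q => q.2) hb
  refine ((hj.eqInt (weaken_action htype hk)).iteInt
    ((hb.eqInt (weaken_action htype ha)).iteInt (weaken_action htype hD)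
      (Computes.int hj.bdd_env 0)) hXjb).congr fun q => ?_
  rw [pureUpdate_apply]
  simp only [Nat.cast_inj]

theorem computes_intUtilVec (htype : C.PolynomialType) (hexp : C.PolynomialExpectation)
    (hw : Computes (instLen w) env fun i => Val.bits (w i).1) {D : ι → ℤ}
    {X : ∀ i, (instGame w i).IntVec} (hD0 : ∀ i, 0 < D i) (hXm : ∀ i, IntMixed (D i) (X i))
    (hD : Computes (instLen w) env fun i => .int (D i))
    (hX : Computes (instLen w) env fun i => (X i).val) {k : ∀ i, Fin (players w i)}
    (hk : Computes (instLen w) env fun i => .int (k i : ℕ)) {a : ∀ i, Fin ((instGame w i).m (k i))}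
    (ha : Computes (instLen w) env fun i => .int (a i : ℕ)) :
    Computes (instLen w) env fun i => .int (intUtilVec (D i) (k i) (X i) (a i)) :=
  computes_intUtil htype hexp hw hD0 (fun i => (hXm i).pureUpdate (hD0 i) (k i) (a i)) hD
    (computes_pureUpdate htype hw hD hX hk ha) hk

theorem computes_intUtilVec_action (htype : C.PolynomialType) (hexp : C.PolynomialExpectation)
    (hw : Computes (instLen w) env fun i => Val.bits (w i).1) {D : ι → ℤ}
    {X : ∀ i, (instGame w i).IntVec} (hD0 : ∀ i, 0 < D i) (hXm : ∀ i, IntMixed (D i) (X i))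
    (hD : Computes (instLen w) env fun i => .int (D i))
    (hX : Computes (instLen w) env fun i => (X i).val) :
    Computes (fun q : Σ p : Σ i, Fin (players w i), Fin (playerActions w p) => instLen w q.1.1)
      (actionEnv w env) fun q => .int (intUtilVec (D q.1.1) q.1.2 (X q.1.1) q.2) :=
  computes_intUtilVec (w := fun q : Σ p : Σ i, Fin (players w i), Fin (playerActions w p) => w q.1.1)
    htype hexp (weaken_action htype hw) (D := fun q => D q.1.1) (X := fun q => X q.1.1)
    (fun q => hD0 q.1.1) (fun q => hXm q.1.1) (weaken_action htype hD) (weaken_action htype hX)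
    (k := fun q => q.1.2) (computes_player_index htype hw) (a := fun q => q.2)
    (computes_action_index htype hw)

theorem computes_intAscent (htype : C.PolynomialType) (hexp : C.PolynomialExpectation)
    (hw : Computes (instLen w) env fun i => Val.bits (w i).1) {D : ι → ℤ}
    {Xh X : ∀ i, (instGame w i).IntVec} (hD0 : ∀ i, 0 < D i) (hXm : ∀ i, IntMixed (D i) (X i))
    (hD : Computes (instLen w) env fun i => .int (D i))
    (hXh : Computes (instLen w) env fun i => (Xh i).val)
    (hX : Computes (instLen w) env fun i => (X i).val) :
    Computes (instLen w) env fun i => (intAscent (D i) (Xh i) (X i)).val := by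
  have hXhjb := computes_entry
    (w := fun q : Σ p : Σ i, Fin (players w i), Fin (playerActions w p) => w q.1.1)
    (X := fun q => Xh q.1.1) (weaken_action htype hXh) (k := fun q => q.1.2)
    (computes_player_index htype hw) (a := fun q => q.2) (computes_action_index htype hw)
  refine Computes.tabulate (f := fun i j => Val.vec (intAscent (D i) (Xh i) (X i) j))
    (bdd_players htype w) (computes_players htype hw) (Computes.intProj
    (V := fun (p : Σ i, Fin (players w i)) a => Xh p.1 p.2 a +
      Int.fdiv (intUtilVec (D p.1) p.2 (X p.1) a) (instGame w p.1).fourLip)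
    (fun p => (instGame w p.1).m_pos p.2) (computes_playerActions htype hw)
    (weaken_player htype hD) (Computes.vec_tabulate (bdd_playerActions htype w)
      (computes_playerActions htype hw) (hXhjb.add ?_)))
  exact (computes_intUtilVec_action htype hexp hw hD0 hXm hD hX).fdiv
    (weaken_action htype (computes_fourLip htype hw))

/-- The fractions of the given profile may have unrelated denominators; multiplying by the common
denominator and rounding down moves them to the grid. -/
theorem computes_intInit (htype : C.PolynomialType) {x₀ : ∀ w, (C.game w).RatVec}
    (hx₀ : SolvableInPolyTime C.inst fun w v => (C.game w).VecRep v (x₀ w))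
    (hw : Computes (instLen w) env fun i => Val.bits (w i).1) {D : ι → ℤ}
    (hD : Computes (instLen w) env fun i => .int (D i)) :
    Computes (instLen w) env fun i => (intInit (D i) (x₀ (w i).1)).val := by
  obtain ⟨A, q, h⟩ := hx₀
  obtain ⟨y, hy, hR⟩ := computes_of_halts (len := instLen w) (f := fun i => q.eval (instLen w i))
    (.poly q .self) fun i => h _ (w i).2
  choose f hf hyf using hR
  choose a b hb hfab hx using hf
  have hv := (hy.comp hw).congr hyf
  have hentry := (Computes.nth
    (f := fun q : Σ p : Σ i, Fin (players w i), Fin (playerActions w p) => f q.1.1 q.1.2)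
    (Computes.nth (f := fun (q : Σ p : Σ i, Fin (players w i), Fin (playerActions w p)) j =>
        Val.list (List.ofFn (f q.1.1 j)))
      (weaken_action htype hv) (k := fun q => q.1.2) (computes_player_index htype hw))
    (k := fun q => q.2) (computes_action_index htype hw)).congr fun q => hfab q.1.1 q.1.2 q.2
  refine Computes.tabulate (f := fun i j => Val.vec (intInit (D i) (x₀ (w i).1) j))
    (bdd_players htype w) (computes_players htype hw) (Computes.intProj
    (V := fun (p : Σ i, Fin (players w i)) a => ⌊(D p.1 : ℚ) * x₀ (w p.1).1 p.2 a⌋)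
    (fun p => (instGame w p.1).m_pos p.2) (computes_playerActions htype hw)
    (weaken_player htype hD) (Computes.vec_tabulate (bdd_playerActions htype w)
      (computes_playerActions htype hw) ?_))
  refine (((weaken_action htype hD).mul hentry.fst).fdiv hentry.snd).congr fun q => ?_
  rw [← floor_eq_fdiv (hb _ _ _), hx q.1.1 q.1.2 q.2]
  congr 1
  have := Rat.floor_cast (α := ℝ)
    ((D q.1.1 : ℚ) * ((a q.1.1 q.1.2 q.2 : ℚ) / b q.1.1 q.1.2 q.2))
  rw [← this]
  push_cast
  rfl

/-- All entries lie between 0 and `D`, so the size of the state does not grow with the number of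
rounds. This is what rounding to a fixed denominator buys. -/
theorem IntMixed.val_size_le {G : Game} {D : ℤ} {X : G.IntVec} (h : IntMixed D X) :
    X.val.size ≤ 2 + G.n * (1 + (2 + G.maxActions * (1 + (Val.int D).size))) := by
  refine (Val.size_list_le (B := 2 + G.maxActions * (1 + (Val.int D).size)) _ ?_).trans (by simp)
  intro v hv
  obtain ⟨i, rfl⟩ := (List.mem_ofFn' _ _).1 hv
  refine (Val.size_list_le (B := (Val.int D).size) _ ?_).trans ?_
  · intro v hv
    obtain ⟨a, rfl⟩ := (List.mem_ofFn' _ _).1 hv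
    have h1 : X i a ≤ D := by
      rw [← (h i).2]
      exact Finset.single_le_sum (f := X i) (fun b _ => (h i).1 b) (Finset.mem_univ a)
    have h2 := (h i).1 a
    simp only [Val.size]
    have : Nat.size (X i a).natAbs ≤ Nat.size D.natAbs := Nat.size_le_size (by omega)
    omega
  · rw [List.length_ofFn]
    have := le_maxActions i
    gcongr

theorem bdd_maxActions (htype : C.PolynomialType) (w : ι → C.inst) :
    PolyBdd (instLen w) fun i => (instGame w i).maxActions := by
  obtain ⟨P, q, h⟩ := htype
  refine ⟨q, fun i => (Finset.sup_le fun j _ => ?_).trans (h _ (w i).2).1⟩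
  exact Finset.single_le_sum (f := (instGame w i).m) (fun _ _ => Nat.zero_le _) (Finset.mem_univ j)

theorem computes_intState (htype : C.PolynomialType) (hexp : C.PolynomialExpectation)
    {x₀ : ∀ w, (C.game w).RatVec}
    (hx₀ : SolvableInPolyTime C.inst fun w v => (C.game w).VecRep v (x₀ w))
    (hw : Computes (instLen w) env fun i => Val.bits (w i).1) {D : ι → ℤ} (hD0 : ∀ i, 0 < D i)
    (hD : Computes (instLen w) env fun i => .int (D i)) {N : ι → ℕ} (hN : PolyBdd (instLen w) N)
    (hn : Computes (instLen w) env fun i => .int (N i)) :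
    Computes (instLen w) env fun i => .pair (intState (D i) (x₀ (w i).1) (N i)).1.val
      (intState (D i) (x₀ (w i).1) (N i)).2.val := by
  let s : ι → ℕ → Val := fun i t => .pair (intState (D i) (x₀ (w i).1) t).1.val
    (intState (D i) (x₀ (w i).1) t).2.val
  have hs : PolyBdd (fun p : Σ i, Fin (N i + 1) => instLen w p.1) fun p => (s p.1 p.2).size := by
    have h1 : PolyBdd (instLen w) fun i => 2 + (instGame w i).n *
        (1 + (2 + (instGame w i).maxActions * (1 + (Val.int (D i)).size))) :=
      (PolyBdd.const 2).add ((bdd_players htype w).mul ((PolyBdd.const 1).add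
        ((PolyBdd.const 2).add ((bdd_maxActions htype w).mul ((PolyBdd.const 1).add hD.bdd)))))
    refine (((PolyBdd.const 1).add (h1.add h1)).reindex
      (Sigma.fst : (Σ i, Fin (N i + 1)) → ι)).mono fun p => ?_
    obtain ⟨hm1, hm2⟩ := intState_mixed (hD0 p.1) (x₀ (w p.1).1) p.2
    exact (Nat.add_le_add (Nat.add_le_add_left (IntMixed.val_size_le hm1) 1)
      (IntMixed.val_size_le hm2)).trans_eq (Nat.add_assoc _ _ _)
  have h0 := computes_intInit htype hx₀ hw hD
  refine Computes.loop s hN hs hn (h0.pair h0) ?_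
  have hid := Computes.loopState s hw.bdd_env hN hs
  have hw' := (hw.reindex (Sigma.fst : (Σ i, Fin (N i)) → ι)).comp hid.fst.fst
  have hD' := (hD.reindex (Sigma.fst : (Σ i, Fin (N i)) → ι)).comp hid.fst.fst
  have hm := fun p : Σ i, Fin (N i) => intState_mixed (hD0 p.1) (x₀ (w p.1).1) p.2
  have hm' := fun p : Σ i, Fin (N i) => intState_mixed (hD0 p.1) (x₀ (w p.1).1) (p.2 + 1)
  have hX := computes_intAscent (w := fun p : Σ i, Fin (N i) => w p.1) htype hexp hw'
    (fun p => hD0 p.1) (fun p => (hm p).2) hD' hid.snd.fst hid.snd.snd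
  have hXh := computes_intAscent (w := fun p : Σ i, Fin (N i) => w p.1) htype hexp hw'
    (fun p => hD0 p.1) (fun p => (hm' p).2) hD' hid.snd.fst hX
  exact hXh.pair hX

theorem computes_intIterate (htype : C.PolynomialType) (hexp : C.PolynomialExpectation)
    {x₀ : ∀ w, (C.game w).RatVec}
    (hx₀ : SolvableInPolyTime C.inst fun w v => (C.game w).VecRep v (x₀ w))
    (hw : Computes (instLen w) env fun i => Val.bits (w i).1) {D : ι → ℤ} (hD0 : ∀ i, 0 < D i)
    (hD : Computes (instLen w) env fun i => .int (D i)) {t : ι → ℕ} (ht : PolyBdd (instLen w) t)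
    (hn : Computes (instLen w) env fun i => .int (t i)) :
    Computes (instLen w) env fun i => (intIterate (D i) (x₀ (w i).1) (t i)).val :=
  (computes_intState htype hexp hx₀ hw hD0 hD (ht.add (.const 1))
    ((hn.add (Computes.int hn.bdd_env 1)).congr fun i => by simp)).snd

theorem computes_intGap (htype : C.PolynomialType) (hexp : C.PolynomialExpectation)
    (hw : Computes (instLen w) env fun i => Val.bits (w i).1) {D : ι → ℤ}
    {X : ∀ i, (instGame w i).IntVec} (hD0 : ∀ i, 0 < D i) (hXm : ∀ i, IntMixed (D i) (X i))
    (hD : Computes (instLen w) env fun i => .int (D i))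
    (hX : Computes (instLen w) env fun i => (X i).val) :
    Computes (instLen w) env fun i => .int (intGap (D i) (X i)) := by
  have hU := computes_intUtil (w := fun p : Σ i, Fin (players w i) => w p.1) htype hexp
    (weaken_player htype hw) (fun p => hD0 p.1) (fun p => hXm p.1) (weaken_player htype hD)
    (weaken_player htype hX) (k := fun p => p.2) (Computes.index (bdd_players htype w) hw.bdd_env)
  exact Computes.sup (f := fun i => maxRegret (D i) (X i)) (fun i => (instGame w i).n_pos)
    (bdd_players htype w) (computes_players htype hw)
    (Computes.sup (f := fun p : Σ i, Fin (players w i) => intRegret (D p.1) (X p.1) p.2)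
      (fun p => (instGame w p.1).m_pos p.2) (bdd_playerActions htype w)
      (computes_playerActions htype hw)
      ((computes_intUtilVec_action htype hexp hw hD0 hXm hD hX).sub
        (Computes.weaken (bdd_playerActions htype w) hU)))

theorem computes_intWelfare (htype : C.PolynomialType) (hexp : C.PolynomialExpectation)
    (hw : Computes (instLen w) env fun i => Val.bits (w i).1) {D : ι → ℤ}
    {X : ∀ i, (instGame w i).IntVec} (hD0 : ∀ i, 0 < D i) (hXm : ∀ i, IntMixed (D i) (X i))
    (hD : Computes (instLen w) env fun i => .int (D i))
    (hX : Computes (instLen w) env fun i => (X i).val) :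
    Computes (instLen w) env fun i => .int (intWelfare (D i) (X i)) :=
  Computes.sum (f := fun i j => intUtil (D i) j (X i)) (bdd_players htype w)
    (computes_players htype hw)
    (computes_intUtil (w := fun p : Σ i, Fin (players w i) => w p.1) htype hexp
    (weaken_player htype hw) (fun p => hD0 p.1) (fun p => hXm p.1) (weaken_player htype hD)
    (weaken_player htype hX) (k := fun p => p.2) (Computes.index (bdd_players htype w) hw.bdd_env))

end Programs
-- Lookup tables and selection of the output iterate.
open Game

theorem Val.list_injective : Function.Injective Val.list := by
  intro l
  induction l with
  | nil =>
    intro l' h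
    cases l' with
    | nil => rfl
    | cons a l' => simp [Val.list] at h
  | cons a l ih =>
    intro l' h
    cases l' with
    | nil => simp [Val.list] at h
    | cons a' l' =>
      simp only [Val.list, Val.pair.injEq] at h
      rw [h.1, ih h.2]

theorem Val.bits_injective : Function.Injective Val.bits := by
  refine Val.list_injective.comp (List.map_injective_iff.2 fun b b' h => ?_)
  revert h
  cases b <;> cases b' <;> simp

section Output

variable {C : GameClass} {ι : Type} {w : ι → C.inst} {env : ι → Val}

open Classical in
/-- The values of a program may be changed on finitely many instances. -/
theorem computes_table {E : Set (List Bool)} (hE : E.Finite) (v : List Bool → Val)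
    (hw : Computes (instLen w) env fun i => Val.bits (w i).1) {x : ι → Val}
    (hx : Computes (instLen w) env x) :
    Computes (instLen w) env fun i => if (w i).1 ∈ E then v (w i).1 else x i := by
  induction E, hE using Set.Finite.induction_on with
  | empty => exact hx.congr fun i => by simp
  | insert _ _ ih =>
    rename_i a E _ _
    refine ((hw.eq (.const hw.bdd_env (Val.bits a))).ite (.const hw.bdd_env (v a)) ih).congr
      fun i => ?_
    simp only [Val.bits_injective.eq_iff, Set.mem_insert_iff]
    by_cases h : (w i).1 = a
    · simp [h]
    · simp [h]

/-- Each round's gap and welfare are computed by running the dynamics afresh from the start. This is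
wasteful but polynomial, and it needs no history in the loop state. -/
theorem computes_argmax_iterate (htype : C.PolynomialType) (hexp : C.PolynomialExpectation)
    {x₀ : ∀ w, (C.game w).RatVec}
    (hx₀ : SolvableInPolyTime C.inst fun w v => (C.game w).VecRep v (x₀ w))
    (hw : Computes (instLen w) env fun i => Val.bits (w i).1) {D : ι → ℤ} (hD0 : ∀ i, 0 < D i)
    (hD : Computes (instLen w) env fun i => .int (D i)) {T : ι → ℕ} (hT0 : ∀ i, 0 < T i)
    (hT : PolyBdd (instLen w) T) (hn : Computes (instLen w) env fun i => .int (T i)) :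
    (Computes (instLen w) env fun i =>
      (intIterate (D i) (x₀ (w i).1) (leastGapIndex (D i) (x₀ (w i).1) (hT0 i))).val) ∧
    Computes (instLen w) env fun i =>
      (intIterate (D i) (x₀ (w i).1) (bestWelfareIndex (D i) (x₀ (w i).1) (hT0 i))).val := by
  have hw' := Computes.weaken hT hw
  have hD' := Computes.weaken hT hD
  have hX := computes_intIterate (w := fun p : Σ i, Fin (T i) => w p.1) htype hexp hx₀ hw'
    (fun p => hD0 p.1) hD' (t := fun p => p.2)
    ((hT.reindex Sigma.fst).mono fun p => p.2.2.le) (Computes.index hT hw.bdd_env)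
  have hXm := fun p : Σ i, Fin (T i) => (intState_mixed (hD0 p.1) (x₀ (w p.1).1) (p.2 + 1)).2
  have hgap := computes_intGap (w := fun p : Σ i, Fin (T i) => w p.1) htype hexp hw'
    (fun p => hD0 p.1) hXm hD' hX
  have hwel := computes_intWelfare (w := fun p : Σ i, Fin (T i) => w p.1) htype hexp hw'
    (fun p => hD0 p.1) hXm hD' hX
  exact ⟨computes_intIterate htype hexp hx₀ hw hD0 hD (hT.mono fun i => (Fin.is_lt _).le)
      (Computes.argmax_index
        (f := fun i (t : Fin (T i)) => -intGap (D i) (intIterate (D i) (x₀ (w i).1) t))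
        hT0 hT hn hgap.neg),
    computes_intIterate htype hexp hx₀ hw hD0 hD (hT.mono fun i => (Fin.is_lt _).le)
      (Computes.argmax_index
        (f := fun i (t : Fin (T i)) => intWelfare (D i) (intIterate (D i) (x₀ (w i).1) t))
        hT0 hT hn hwel)⟩

end Output

theorem numIter_pos {Q P : ℕ} (hQ : 0 < Q) (hP : 0 < P) : 0 < numIter Q P := by
  unfold numIter
  positivity

theorem gainBound_pos {Q P : ℕ} (hQ : 0 < Q) (hP : 0 < P) : 0 < gainBound Q P := by
  unfold gainBound
  positivity

/-- `gainBound` as a polynomial. -/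
def gainBoundPoly (Q P : Polynomial ℕ) : Polynomial ℕ := 20736 * P ^ 2 * Q ^ 7

/-- `numIter` as a polynomial. -/
def numIterPoly (Q P : Polynomial ℕ) : Polynomial ℕ := 16 * Q * (72 * P * Q ^ 4) ^ 2

/-- `numBits` as a polynomial. -/
def numBitsPoly (Q P : Polynomial ℕ) : Polynomial ℕ :=
  (3 + 2 * Q) * (numIterPoly Q P + 1) + P + 4 * gainBoundPoly Q P * Q ^ 3

theorem eval_gainBoundPoly (Q P : Polynomial ℕ) (k : ℕ) :
    (gainBoundPoly Q P).eval k = gainBound (Q.eval k) (P.eval k) := by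
  simp [gainBoundPoly, gainBound]

theorem eval_numIterPoly (Q P : Polynomial ℕ) (k : ℕ) :
    (numIterPoly Q P).eval k = numIter (Q.eval k) (P.eval k) := by
  simp [numIterPoly, numIter]

theorem eval_numBitsPoly (Q P : Polynomial ℕ) (k : ℕ) :
    (numBitsPoly Q P).eval k = numBits (Q.eval k) (P.eval k) := by
  simp [numBitsPoly, numBits, eval_gainBoundPoly, eval_numIterPoly]

end
end SmoothGames

/-! ### The algorithm and its exceptional set. -/

open SmoothGames SmoothGames.Game in
theorem mainTheorem12
    (C : SmoothGames.GameClass) (ρ : ℝ) (lam mu : List Bool → ℝ)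
    (htype : C.PolynomialType) (hexp : C.PolynomialExpectation)
    (hsmooth : ∀ w ∈ C.inst, (C.game w).Smooth (lam w) (mu w) ∧ ρ = lam w / (1 + mu w))
    (hmu : ∃ q : Polynomial ℕ, ∀ w ∈ C.inst, mu w ≤ q.eval w.length)
    (hhard : C.UniformlyHard ρ)
    (hPNP : SmoothGames.ClassP ≠ SmoothGames.ClassNP)
    (p : Polynomial ℕ) (hp : ∀ k, 0 < p.eval k)
    (x₀ : ∀ w, (C.game w).RatVec)
    (hx₀ : ∀ w ∈ C.inst, (x₀ w).toReal ∈ (C.game w).Mixed)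
    (hx₀_poly : SmoothGames.SolvableInPolyTime C.inst fun w v => (C.game w).VecRep v (x₀ w)) :
    ∃ (A : SmoothGames.Prog) (q T : Polynomial ℕ) (E : Set (List Bool)), E.Finite ∧
      ∀ w ∈ C.inst, SmoothGames.HaltsWithin A (.bits w) (q.eval w.length)
        ((C.game w).OutputsProfile fun y =>
          (C.game w).IsNash (1 / ((p.eval w.length : ℕ) : ℝ)) y ∧
          (w ∉ E → ∃ t : ℕ, 1 ≤ t ∧ t ≤ T.eval w.length ∧
            (C.game w).IsNash (1 / ((p.eval w.length : ℕ) : ℝ))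
              ((C.game w).ogd (C.game w).rate (x₀ w).toReal t) ∧
            ∀ i a, |y i a - (C.game w).ogd (C.game w).rate (x₀ w).toReal t i a|
              ≤ (1 / 2 : ℝ) ^ p.eval w.length)) := by
  classical
  obtain ⟨qmu, hqmu⟩ := hmu
  obtain ⟨_, qtype, hqtype⟩ := id htype
  -- One polynomial dominates the number of players, the numbers of actions and `1 + mu`; the final
  -- 1 also makes it positive.
  set Q : Polynomial ℕ := qtype + qmu + 1 with hQdef
  have hQeval : ∀ k, Q.eval k = qtype.eval k + qmu.eval k + 1 := fun k => by simp [hQdef]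
  have hQ0 : ∀ k, 0 < Q.eval k := fun k => by rw [hQeval]; omega
  have hM : ∀ w ∈ C.inst, (C.game w).maxActions ≤ Q.eval w.length := fun w hw => by
    refine (Finset.sup_le fun i _ => ?_).trans
      ((hqtype w hw).1.trans (by rw [hQeval]; omega))
    exact Finset.single_le_sum (f := (C.game w).m) (fun _ _ => Nat.zero_le _) (Finset.mem_univ i)
  have hn : ∀ w ∈ C.inst, (C.game w).n ≤ Q.eval w.length := fun w hw => by
    refine le_trans ?_ ((hqtype w hw).1.trans (by rw [hQeval]; omega))
    have := Finset.sum_le_sum fun i (_ : i ∈ Finset.univ) => Nat.succ_le_of_lt ((C.game w).m_pos i)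
    simpa using this
  have hmuQ : ∀ w ∈ C.inst, 1 + mu w ≤ (Q.eval w.length : ℕ) := fun w hw => by
    have := hqmu w hw
    rw [hQeval]
    push_cast
    have h0 : (0 : ℝ) ≤ qtype.eval w.length := Nat.cast_nonneg _
    linarith
  let D : List Bool → ℤ := fun w => 2 ^ numBits (Q.eval w.length) (p.eval w.length)
  have hD0 : ∀ w, 0 < D w := fun w => by positivity
  have hT0 : ∀ w : List Bool, 0 < numIter (Q.eval w.length) (p.eval w.length) := fun w =>
    numIter_pos (hQ0 _) (hp _)
  let X : ∀ w, (C.game w).IntVec := fun w =>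
    intIterate (D w) (x₀ w) (leastGapIndex (D w) (x₀ w) (hT0 w))
  let Y : ∀ w, (C.game w).IntVec := fun w =>
    intIterate (D w) (x₀ w) (bestWelfareIndex (D w) (x₀ w) (hT0 w))
  have hw : Computes (instLen (id : C.inst → C.inst)) (fun i => Val.bits i.1)
    fun i => Val.bits i.1 := .id (bdd_bits _)
  have hT : PolyBdd (instLen (id : C.inst → C.inst))
      fun i => numIter (Q.eval i.1.length) (p.eval i.1.length) :=
    ⟨numIterPoly Q p, fun i => (eval_numIterPoly Q p _).ge⟩
  have hTc : Computes (instLen (id : C.inst → C.inst)) (fun i => Val.bits i.1)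
      fun i => .int (numIter (Q.eval i.1.length) (p.eval i.1.length) : ℕ) :=
    ((computes_len hw).poly (numIterPoly Q p)).congr fun i => by rw [eval_numIterPoly]; rfl
  have hD : Computes (instLen (id : C.inst → C.inst)) (fun i => Val.bits i.1)
      fun i => .int (D i.1) := by
    have h := (computes_len hw).poly (numBitsPoly Q p)
    refine (Computes.two_pow ⟨numBitsPoly Q p, fun i => le_rfl⟩ h).congr fun i => ?_
    rw [eval_numBitsPoly]
    rfl
  obtain ⟨hX, hY⟩ := computes_argmax_iterate (w := id) htype hexp hx₀_poly hw (fun i => hD0 i.1) hD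
    (fun i => hT0 i.1) hT hTc
  -- The games on which even the iterate of least computed gap fails the test.
  set E : Set (List Bool) := {w | w ∈ C.inst ∧
    ¬ intGap (D w) (X w) * (2 * (p.eval w.length : ℕ)) ≤ D w} with hE
  have hEfin : E.Finite := by
    -- If `E` were infinite, the program for `Y` would beat the hard welfare bound on all of `E`, by
    -- twice the reciprocal polynomial of `gainBoundPoly`, forcing P = NP.
    by_contra hinf
    refine hPNP (hhard E (fun w h => h.1) hinf (2 * gainBoundPoly Q p) (fun k => ?_) ?_)
    · have := gainBound_pos (hQ0 k) (hp k)
      simp only [Polynomial.eval_mul, Polynomial.eval_ofNat, eval_gainBoundPoly]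
      omega
    · obtain ⟨A, q, hA⟩ := computes_scaledVal (w := id) htype hw hD hY
      refine ⟨A, q, fun w hwE => ?_⟩
      obtain ⟨t, ht, hle⟩ := hA ⟨w, hwE.1⟩
      refine ⟨_, t, ht, hle, scaledRat (D w) (Y w), vecRep_scaledVal (hD0 w) _, ?_, ?_⟩
      · rw [scaledRat_toReal]
        exact (intState_mixed (hD0 w) (x₀ w) _).2.scaled_mem (hD0 w)
      · rw [scaledRat_toReal]
        simp only [Polynomial.eval_mul, Polynomial.eval_ofNat, eval_gainBoundPoly]
        refine unflagged_spec (hn w hwE.1) (hM w hwE.1) (hp _) (hx₀ w hwE.1) (hsmooth w hwE.1).1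
          (hsmooth w hwE.1).2 (hmuQ w hwE.1) (hT0 w) fun t ht hle => hwE.2 (le_trans ?_ hle)
        refine mul_le_mul_of_nonneg_right ?_ (by positivity)
        -- `X` has the least gap, so if it fails the test then every round does.
        exact neg_le_neg_iff.1 (Computes.le_argmax (hT0 w)
          (fun t : Fin _ => -intGap (D w) (intIterate (D w) (x₀ w) t)) ⟨t, ht⟩)
  -- These witnesses come from a nonconstructive choice; only the finitely many belonging to `E` are
  -- written into the program.
  have hnash : ∀ w, ∃ (v : Val) (y : (C.game w).RatVec), (C.game w).VecRep v y ∧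
      (C.game w).IsNash (1 / ((p.eval w.length : ℕ) : ℝ)) y.toReal := fun w => by
    have hpos : (0 : ℝ) < (p.eval w.length : ℕ) := by exact_mod_cast hp _
    obtain ⟨y, hy⟩ := (C.game w).exists_rat_isNash (one_div_pos.2 hpos)
    obtain ⟨v, hv⟩ := exists_vecRep y
    exact ⟨v, y, hv, hy⟩
  choose v y hvy hy using hnash
  obtain ⟨A, q, hA⟩ := computes_table (w := id) hEfin v hw
    (computes_scaledVal (w := id) htype hw hD hX)
  refine ⟨A, q, numIterPoly Q p, E, hEfin, fun w hwC => ?_⟩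
  obtain ⟨t, ht, hle⟩ := hA ⟨w, hwC⟩
  refine ⟨_, t, ht, hle, ?_⟩
  by_cases hwE : w ∈ E
  · simp only [id, hwE, if_true]
    exact ⟨y w, hvy w, (hy w).1, hy w, fun h => absurd trivial h⟩
  · simp only [id, hwE, if_false]
    have hflag : intGap (D w) (X w) * (2 * (p.eval w.length : ℕ)) ≤ D w := by
      by_contra h
      exact hwE ⟨hwC, h⟩
    have hlt := (leastGapIndex (D w) (x₀ w) (hT0 w)).2
    obtain ⟨h1, h2⟩ := flagged_spec (hn w hwC) (hM w hwC) (hp _) (hx₀ w hwC) hlt hflag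
    refine ⟨scaledRat (D w) (X w), vecRep_scaledVal (hD0 w) _, ?_, ?_⟩
    · rw [scaledRat_toReal]
      exact h1.1
    · rw [scaledRat_toReal]
      -- `intIterate` at index t corresponds to the exact iterate numbered t + 1, so the round lies
      -- between 1 and the number of iterations.
      refine ⟨h1, fun _ => ⟨_, Nat.succ_pos _, (Nat.succ_le_of_lt hlt).trans
        (eval_numIterPoly Q p _).ge, h2, fun i a => ?_⟩⟩
      exact (error_bound (hM w hwC) (hx₀ w hwC) hlt i a).trans
        (pow_le_pow_of_le_one (by norm_num) (by norm_num) (Nat.le_add_right _ _))
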